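/- For $\operatorname{Im}\tau>0$ and integers $\alpha,\beta$ put $\theta_{\alpha\beta}(z|\tau)=\sum_{k\in\mathbb Z}e^{\pi i(k+\alpha/2)^2\tau+2\pi i(k+\alpha/2)(z+\beta/2)}$, $\theta_1=-\theta_{11}$, $\theta_2=\theta_{10}$, $\theta_3=\theta_{00}$, $\theta_4=\theta_{01}$, $\vartheta_k(\tau)=\theta_k(0|\tau)$, and let $\eta(\tau)=e^{\pi i\tau/12}\prod_{k\ge1}(1-e^{2\pi ik\tau})$. Let $$p=\frac{\vartheta_4(\tau)}{\vartheta_3(\tau)},\qquad q=\frac{\theta_2^2(\frac16|\tau)}{\theta_1^2(\frac16|\tau)},\qquad x(\tau)=\frac{p\,(q^2-1)}{2\,(p^2+q)}.$$ Then the following hold on the upper half-plane $\mathbb H$. (1) The denominators $\vartheta_3(\tau)$, $\theta_1(\frac16|\tau)$, $\theta_3(\frac16|\tau)$ and $p^2+q$ do not vanish, $x$ has neither zeros nor poles in $\mathbb H$, and $$x(\tau)=\frac{\eta^3(\tau)\,\theta_2(\frac13|\tau)}{\theta_1^2(\frac16|\tau)\,\theta_3^2(\frac16|\tau)}.$$ (2)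 The function $x$ uniformizes Schwarz's curve $y^2=x^8+14x^4+1$, every curve $z^n=x^5-x$ $(n\ge1)$ of Burnside's tower, and the product curve $w^2=(x^8+14x^4+1)(x^5-x)$, with punctures over $x\in\{0,\pm1,\pm i,\infty\}$. Here, for each of these curves $C$, this means that there is a single-valued holomorphic function $v$ on $\mathbb H$ (in the role of $y$, $z$, $w$ respectively) such that $\tau\mapsto(x(\tau),v(\tau))$ maps $\mathbb H$ onto the set of points of the affine curve $C$ with $x\notin\{0,\pm1,\pm i\}$; that the group $\Gamma$ of all $g\in SL_2(\mathbb R)$ with $x\circ g=x$ and $v\circ g=v$ is discrete; and that two points of $\mathbb H$ have the same image if and only if they are $\Gamma$-equivalent. For Schwarz's curve, $v=y$ can be chosen so that $p=\dfrac{x^4-y-1}{4x}$ and $q=\dfrac{x^4-y+1}{2x^2}$. (3) For $\tau\in\mathbb H$, $\dot x(\tau)\ne0$ if and only if $x(\tau)^8+14x(\tau)^4+1\ne0$, and at all such $\tau$ the function $x$ satisfies the Fuchsian equation $$\frac{\dddot x}{\dot x^3}-\frac32\frac{\ddot x^2}{\dot x^4}=-\frac12\,\frac{x^{24}-102x^{20}+1167x^{16}+1964x^{12}+1167x^8-102x^4+1}{(x^8+14x^4+1)^2(x^5-x)^2}$$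 $$=-\frac38\sum_\beta\frac1{(x-\beta)^2}-\frac12\sum_\alpha\frac1{(x-\alpha)^2}+\frac{(x^4+7)(5x^4-1)x^3}{(x^8+14x^4+1)(x^5-x)},$$ where dots denote $d/d\tau$, $\beta$ runs over the roots of $\beta^8+14\beta^4+1$ and $\alpha$ over the roots of $\alpha^5-\alpha$ (the octahedral ground forms). -/

import Mathlib

open scoped UpperHalfPlane MatrixGroups

noncomputable section

namespace OctahedralUniformization

/-- Theta series with characteristics `(α, β)`:
`∑_{k ∈ ℤ} exp (π i (k + α/2)² τ + 2 π i (k + α/2) (z + β/2))`. -/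
def thetaChar (α β : ℤ) (z τ : ℂ) : ℂ :=
  ∑' k : ℤ, Complex.exp
    (Real.pi * Complex.I * ((k : ℂ) + (α : ℂ) / 2) ^ 2 * τ
      + 2 * Real.pi * Complex.I * ((k : ℂ) + (α : ℂ) / 2) * (z + (β : ℂ) / 2))

/-- The four Jacobi theta functions `θ₁, θ₂, θ₃, θ₄` of `(z | τ)`. -/
def theta₁ (z τ : ℂ) : ℂ := -thetaChar 1 1 z τ

def theta₂ (z τ : ℂ) : ℂ := thetaChar 1 0 z τ

def theta₃ (z τ : ℂ) : ℂ := thetaChar 0 0 z τ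

def theta₄ (z τ : ℂ) : ℂ := thetaChar 0 1 z τ

/-- `p(τ) = ϑ₄(τ) / ϑ₃(τ)`, where `ϑₖ(τ) = θₖ(0 | τ)`. -/
def pFun (τ : ℂ) : ℂ := theta₄ 0 τ / theta₃ 0 τ

/-- `q(τ) = θ₂²(1/6 | τ) / θ₁²(1/6 | τ)`. -/
def qFun (τ : ℂ) : ℂ := theta₂ (1 / 6) τ ^ 2 / theta₁ (1 / 6) τ ^ 2

/-- The function `x(τ) = p (q² - 1) / (2 (p² + q))`. -/
def xFun (τ : ℂ) : ℂ :=
  pFun τ * (qFun τ ^ 2 - 1) / (2 * (pFun τ ^ 2 + qFun τ))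

/-- Schwarz's hyperelliptic curve `y² = x⁸ + 14 x⁴ + 1`. -/
def schwarzCurve : Set (ℂ × ℂ) := {P | P.2 ^ 2 = P.1 ^ 8 + 14 * P.1 ^ 4 + 1}

/-- The `n`-th curve `zⁿ = x⁵ - x` of Burnside's tower. -/
def burnsideCurve (n : ℕ) : Set (ℂ × ℂ) := {P | P.2 ^ n = P.1 ^ 5 - P.1}

/-- The product curve `w² = (x⁸ + 14 x⁴ + 1) (x⁵ - x)`. -/
def productCurve : Set (ℂ × ℂ) :=
  {P | P.2 ^ 2 = (P.1 ^ 8 + 14 * P.1 ^ 4 + 1) * (P.1 ^ 5 - P.1)}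

/-- The automorphism group of a function on the upper half-plane: all real unimodular
linear-fractional substitutions of `τ` that leave the function unchanged. -/
def autGroup (f : ℂ → ℂ) : Subgroup SL(2, ℝ) where
  carrier := {g | ∀ τ : ℍ, f ↑(g • τ) = f ↑τ}
  one_mem' := by
    intro τ
    rw [one_smul]
  mul_mem' := by
    intro a b ha hb τ
    rw [mul_smul, ha (b • τ), hb τ]
  inv_mem' := by
    intro a ha τ
    have h := ha (a⁻¹ • τ)
    rw [smul_inv_smul] at h
    exact h.symm

/-- The pair of functions `(x, v)` of `τ ∈ ℍ` uniformizes the affine plane curve `C`, with punctures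
over the finite set `E` of values of `x`: both functions are single-valued and holomorphic on the
upper half-plane, `τ ↦ (x(τ), v(τ))` maps `ℍ` onto the part of `C` lying over `x ∉ E`, the group
`Γ = Aut(x) ∩ Aut(v)` is a discrete subgroup of `SL(2, ℝ)`, and two values of `τ` give the same
point of `C` exactly when they are `Γ`-equivalent. Thus `ℍ / Γ` is identified with `C` minus
finitely many points. -/
structure Uniformizes (x v : ℂ → ℂ) (C : Set (ℂ × ℂ)) (E : Set ℂ) : Prop where
  finite_punctures : E.Finite
  holomorphic_fst : DifferentiableOn ℂ x {τ : ℂ | 0 < τ.im}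
  holomorphic_snd : DifferentiableOn ℂ v {τ : ℂ | 0 < τ.im}
  image_eq : Set.range (fun τ : ℍ => (x ↑τ, v ↑τ)) = {P : ℂ × ℂ | P ∈ C ∧ P.1 ∉ E}
  discrete : DiscreteTopology ↥(autGroup x ⊓ autGroup v)
  fiber_eq : ∀ τ₁ τ₂ : ℍ, (x ↑τ₁ = x ↑τ₂ ∧ v ↑τ₁ = v ↑τ₂) ↔
    ∃ g ∈ autGroup x ⊓ autGroup v, g • τ₁ = τ₂

/-- The finite punctures `{0, 1, -1, i, -i}`; together with `∞` they are the vertices of the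
octahedron. -/
def punctures : Set ℂ := {0, 1, -1, Complex.I, -Complex.I}

/-- The meromorphic derivative `[x, τ] = x''' / x'³ - (3/2) x''² / x'⁴`. -/
def meroDeriv (f : ℂ → ℂ) (τ : ℂ) : ℂ :=
  iteratedDeriv 3 f τ / deriv f τ ^ 3 - 3 / 2 * (iteratedDeriv 2 f τ ^ 2 / deriv f τ ^ 4)

/-- The octahedral ground forms, in inhomogeneous form. -/
def faceForm : Polynomial ℂ := Polynomial.X ^ 8 + 14 * Polynomial.X ^ 4 + 1

def vertexForm : Polynomial ℂ := Polynomial.X ^ 5 - Polynomial.X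

/-- The coefficient of the Fuchsian equation as a single fraction. -/
def fuchsQ (x : ℂ) : ℂ :=
  -(1 / 2) * ((x ^ 24 - 102 * x ^ 20 + 1167 * x ^ 16 + 1964 * x ^ 12 + 1167 * x ^ 8
      - 102 * x ^ 4 + 1) / ((x ^ 8 + 14 * x ^ 4 + 1) ^ 2 * (x ^ 5 - x) ^ 2))

/-- The coefficient of the Fuchsian equation in partial fractions. -/
def fuchsQPartial (x : ℂ) : ℂ :=
  -(3 / 8) * (faceForm.roots.map (fun β => 1 / (x - β) ^ 2)).sum
    - 1 / 2 * (vertexForm.roots.map (fun α => 1 / (x - α) ^ 2)).sum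
    + (x ^ 4 + 7) * (5 * x ^ 4 - 1) * x ^ 3 / ((x ^ 8 + 14 * x ^ 4 + 1) * (x ^ 5 - x))

end OctahedralUniformization

end

noncomputable section

namespace OctahedralUniformization

open Complex Filter Topology

/-! Everything is governed by `lambdaFun`, that is p⁴ = ϑ₄⁴/ϑ₃⁴, over which p, x and y are
algebraic.

Algebra. The product formula `thetaShift_mul` turns products of theta values at τ into values at 2τ.
For arguments 0, 1/6, 1/3, 1/2 it yields polynomial identities, and it carries a zero at τ to 2τ,
4τ, …, so that the behaviour at i∞ excludes zeros. It follows that x = θ₄(1/6)/θ₃(1/6) (`xFun_eq`)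
and that 2xp² − (x⁴ − 1)p − 2x³ = 0 (`xFun_pFun`). As a quadratic in p this relation has
discriminant x⁸ + 14x⁴ + 1, and y = x⁴ − 4xp − 1 is a square root of it. So (x, y) and (x, p)
determine each other.

Differential equation. Level-one cusp forms of weight below 12 vanish; this gives the derivative of
p, and Ramanujan's equation for η'/η. Hence x''/x' = 4η'/η + x'γ(x, y) with an explicit γ
(`connection`). In the Schwarzian derivative η'/η drops out, and y cancels from what remains
(`connection_riccati`).

Uniformization. The fibres of λ = p⁴ are orbits of its automorphism group: the points whose fibre is
an orbit form a nonempty clopen set (`uniqueFiber`). An automorphism of λ that matches p, and then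
x, at a single point preserves p, and then x, everywhere, because the branches in question are
unramified. So the fibres of (x, y) are orbits. The range of x is open, and closed off the
punctures, hence is the whole complement of the punctures. The involution `sheetSwap` preserves x
and changes the sign of y, so both sheets of Schwarz's curve are covered. Since x⁵ − x has no zeros
on the half-plane, it has holomorphic roots z of every order; since it vanishes to first order in
the nome at i∞, τ ↦ τ + 2 multiplies z by a primitive root of unity and fixes x. On the product
curve w = yz, and elliptic substitutions take care of the zeros of y. -/

/-! ### Theta series on shifted lattices and their product formulas -/

/-- The general term of a theta series, with summation variable `u`. -/
def gaussTerm (u z τ : ℂ) : ℂ := cexp (Real.pi * I * u ^ 2 * τ + 2 * Real.pi * I * u * z)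

/-- The theta series over the shifted lattice `ℤ + s`. -/
def thetaShift (s z τ : ℂ) : ℂ := ∑' k : ℤ, gaussTerm (k + s) z τ

lemma gaussTerm_shift (k : ℤ) (s z τ : ℂ) :
    gaussTerm (k + s) z τ = cexp (Real.pi * I * s ^ 2 * τ + 2 * Real.pi * I * s * z) *
      jacobiTheta₂_term k (z + s * τ) τ := by
  rw [gaussTerm, jacobiTheta₂_term, ← Complex.exp_add]
  congr 1
  ring

lemma summable_gaussTerm (s z : ℂ) {τ : ℂ} (hτ : 0 < τ.im) :
    Summable fun k : ℤ => gaussTerm (k + s) z τ := by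
  simp_rw [gaussTerm_shift]
  exact ((summable_jacobiTheta₂_term_iff _ _).2 hτ).mul_left _

lemma thetaShift_eq (s z τ : ℂ) :
    thetaShift s z τ = cexp (Real.pi * I * s ^ 2 * τ + 2 * Real.pi * I * s * z) *
      jacobiTheta₂ (z + s * τ) τ := by
  simp_rw [thetaShift, gaussTerm_shift, tsum_mul_left, jacobiTheta₂]

lemma thetaChar_eq (α β : ℤ) (z τ : ℂ) :
    thetaChar α β z τ = thetaShift (α / 2) (z + β / 2) τ := rfl

lemma theta₃_eq (z τ : ℂ) : theta₃ z τ = thetaShift 0 z τ := by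
  simp [theta₃, thetaChar_eq]

lemma theta₄_eq (z τ : ℂ) : theta₄ z τ = thetaShift 0 (z + 1 / 2) τ := by
  simp [theta₄, thetaChar_eq]

lemma theta₂_eq (z τ : ℂ) : theta₂ z τ = thetaShift (1 / 2) z τ := by
  simp [theta₂, thetaChar_eq]

lemma theta₁_eq (z τ : ℂ) : theta₁ z τ = -thetaShift (1 / 2) (z + 1 / 2) τ := by
  simp [theta₁, thetaChar_eq]

lemma gaussTerm_mul (u v x y τ : ℂ) :
    gaussTerm u x τ * gaussTerm v y τ =
      gaussTerm ((u + v) / 2) (x + y) (2 * τ) * gaussTerm ((u - v) / 2) (x - y) (2 * τ) := by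
  simp only [gaussTerm, ← Complex.exp_add]
  congr 1
  ring

lemma thetaShift_add_one (s z τ : ℂ) : thetaShift (s + 1) z τ = thetaShift s z τ := by
  rw [thetaShift, thetaShift, ← (Equiv.addRight (1 : ℤ)).tsum_eq fun k : ℤ => gaussTerm (k + s) z τ]
  refine tsum_congr fun k => ?_
  simp only [Equiv.coe_addRight, Int.cast_add, Int.cast_one]
  rw [add_right_comm, add_assoc (k : ℂ)]

lemma thetaShift_neg (s z τ : ℂ) : thetaShift (-s) (-z) τ = thetaShift s z τ := by
  rw [thetaShift, thetaShift, ← (Equiv.neg ℤ).tsum_eq]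
  refine tsum_congr fun k => ?_
  simp only [Equiv.neg_apply, Int.cast_neg, gaussTerm]
  congr 1
  ring

/-- The bijection `ℤ² ⊔ ℤ² ≃ ℤ²` that sorts the pairs `(m + n, m - n)` and `(m + n + 1, m - n)`. -/
def parityEquiv : (ℤ × ℤ) ⊕ (ℤ × ℤ) ≃ ℤ × ℤ where
  toFun := Sum.elim (fun p => (p.1 + p.2, p.1 - p.2)) (fun p => (p.1 + p.2 + 1, p.1 - p.2))
  invFun p := if (p.1 + p.2) % 2 = 0 then .inl ((p.1 + p.2) / 2, (p.1 - p.2) / 2)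
    else .inr ((p.1 + p.2) / 2, (p.1 - p.2) / 2)
  left_inv := by
    rintro (⟨m, n⟩ | ⟨m, n⟩)
    · have h : (m + n + (m - n)) % 2 = 0 := by omega
      simp only [Sum.elim_inl, h, if_true]
      congr 2 <;> omega
    · have h : ¬ (m + n + 1 + (m - n)) % 2 = 0 := by omega
      simp only [Sum.elim_inr, h, if_false]
      congr 2 <;> omega
  right_inv := by
    rintro ⟨k, l⟩
    dsimp only
    split_ifs with h
    · simp only [Sum.elim_inl, Prod.mk.injEq]
      omega
    · simp only [Sum.elim_inr, Prod.mk.injEq]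
      omega

lemma parityEquiv_inl (p : ℤ × ℤ) : parityEquiv (.inl p) = (p.1 + p.2, p.1 - p.2) := rfl

lemma parityEquiv_inr (p : ℤ × ℤ) : parityEquiv (.inr p) = (p.1 + p.2 + 1, p.1 - p.2) := rfl

lemma im_two_mul {τ : ℂ} (hτ : 0 < τ.im) : 0 < (2 * τ).im := by
  simpa using hτ

lemma summable_gaussTerm_mul (s t x y : ℂ) {τ : ℂ} (hτ : 0 < τ.im) :
    Summable fun p : ℤ × ℤ => gaussTerm (p.1 + s) x τ * gaussTerm (p.2 + t) y τ :=
  summable_mul_of_summable_norm (f := fun k : ℤ => gaussTerm (k + s) x τ)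
    (g := fun k : ℤ => gaussTerm (k + t) y τ)
    (summable_gaussTerm s x hτ).norm (summable_gaussTerm t y hτ).norm

lemma hasSum_gaussTerm_mul (s t x y : ℂ) {τ : ℂ} (hτ : 0 < τ.im) :
    HasSum (fun p : ℤ × ℤ => gaussTerm (p.1 + s) x τ * gaussTerm (p.2 + t) y τ)
      (thetaShift s x τ * thetaShift t y τ) := by
  rw [thetaShift, thetaShift, tsum_mul_tsum_of_summable_norm (summable_gaussTerm s x hτ).norm
    (summable_gaussTerm t y hτ).norm]
  exact (summable_gaussTerm_mul s t x y hτ).hasSum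

/-- The product of two theta series in terms of theta series of the double period. -/
lemma thetaShift_mul (s x y : ℂ) {τ : ℂ} (hτ : 0 < τ.im) :
    thetaShift s x τ * thetaShift s y τ =
      thetaShift s (x + y) (2 * τ) * thetaShift 0 (x - y) (2 * τ) +
      thetaShift (s + 1 / 2) (x + y) (2 * τ) * thetaShift (1 / 2) (x - y) (2 * τ) := by
  have h2 := im_two_mul hτ
  -- The index pairs (k, l) are split by the parity of k + l; in the odd class both half-sum and
  -- half-difference acquire a shift by 1/2.
  refine (hasSum_gaussTerm_mul s s x y hτ).unique (parityEquiv.hasSum_iff.1 (HasSum.sum ?_ ?_))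
  · refine (hasSum_gaussTerm_mul s 0 (x + y) (x - y) h2).congr_fun fun p => ?_
    simp only [Function.comp_apply, parityEquiv_inl]
    rw [gaussTerm_mul]
    push_cast
    congr 2 <;> ring
  · refine (hasSum_gaussTerm_mul (s + 1 / 2) (1 / 2) (x + y) (x - y) h2).congr_fun fun p => ?_
    simp only [Function.comp_apply, parityEquiv_inr]
    rw [gaussTerm_mul]
    push_cast
    congr 2 <;> ring

lemma thetaShift_zero_add_one (z τ : ℂ) : thetaShift 0 (z + 1) τ = thetaShift 0 z τ := by
  refine tsum_congr fun k => ?_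
  rw [gaussTerm, gaussTerm, Complex.exp_eq_exp_iff_exists_int]
  exact ⟨k, by ring⟩

lemma thetaShift_half_add_one (z τ : ℂ) :
    thetaShift (1 / 2) (z + 1) τ = -thetaShift (1 / 2) z τ := by
  rw [thetaShift, thetaShift, ← tsum_neg]
  refine tsum_congr fun k => ?_
  rw [gaussTerm, gaussTerm, ← mul_neg_one, ← Complex.exp_pi_mul_I, ← Complex.exp_add,
    Complex.exp_eq_exp_iff_exists_int]
  exact ⟨k, by ring⟩

lemma thetaShift_zero_neg (z τ : ℂ) : thetaShift 0 (-z) τ = thetaShift 0 z τ := by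
  simpa using thetaShift_neg 0 z τ

lemma thetaShift_half_neg (z τ : ℂ) : thetaShift (1 / 2) (-z) τ = thetaShift (1 / 2) z τ := by
  rw [← thetaShift_neg (1 / 2) z, ← thetaShift_add_one (-(1 / 2))]
  norm_num

lemma theta₃_mul (x y : ℂ) {τ : ℂ} (hτ : 0 < τ.im) :
    theta₃ x τ * theta₃ y τ = theta₃ (x + y) (2 * τ) * theta₃ (x - y) (2 * τ) +
      theta₂ (x + y) (2 * τ) * theta₂ (x - y) (2 * τ) := by
  simp only [theta₃_eq, theta₂_eq]
  rw [thetaShift_mul 0 x y hτ, zero_add]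

lemma theta₂_mul (x y : ℂ) {τ : ℂ} (hτ : 0 < τ.im) :
    theta₂ x τ * theta₂ y τ = theta₂ (x + y) (2 * τ) * theta₃ (x - y) (2 * τ) +
      theta₃ (x + y) (2 * τ) * theta₂ (x - y) (2 * τ) := by
  simp only [theta₃_eq, theta₂_eq]
  rw [thetaShift_mul (1 / 2) x y hτ, add_halves, ← thetaShift_add_one 0 (x + y), zero_add]

/-- The sum over the plane `a + b + c = s` in the product of three theta series. -/
def planeSum (s : ℤ) (τ : ℂ) : ℂ := ∑' p : ℤ × ℤ,
  cexp (Real.pi * I * (p.1 ^ 2 + p.2 ^ 2 + (s - p.1 - p.2) ^ 2) * τ +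
    2 * Real.pi * I * ((p.2 - (s - p.1 - p.2)) / 3))

/-- The rotation (a, b, c) ↦ (b, c, a) preserves the plane and the quadratic form, while b − c
becomes (b − c) + 3c − s. The sum is therefore multiplied by e^{−2πis/3}, which is not 1. -/
lemma planeSum_eq_zero {s : ℤ} (hs : ¬ (3 : ℤ) ∣ s) (τ : ℂ) : planeSum s τ = 0 := by
  let e : ℤ × ℤ ≃ ℤ × ℤ :=
    { toFun := fun p => (p.2, s - p.1 - p.2)
      invFun := fun p => (s - p.1 - p.2, p.1)
      left_inv := fun p => by ext <;> simp
      right_inv := fun p => by ext <;> simp; ring }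
  have h : planeSum s τ = cexp (2 * Real.pi * I * (-s / 3)) * planeSum s τ := by
    conv_lhs => rw [planeSum, ← e.tsum_eq]
    rw [planeSum, ← tsum_mul_left]
    refine tsum_congr fun p => ?_
    rw [← Complex.exp_add, Complex.exp_eq_exp_iff_exists_int]
    refine ⟨s - p.1 - p.2, ?_⟩
    simp only [e, Equiv.coe_fn_mk]
    push_cast
    ring
  have h1 : cexp (2 * Real.pi * I * (-s / 3)) ≠ 1 := by
    rw [Ne, Complex.exp_eq_one_iff]
    rintro ⟨n, hn⟩
    have h2 : (2 * Real.pi * I : ℂ) ≠ 0 := Complex.two_pi_I_ne_zero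
    have h3 : (-s / 3 : ℂ) = n := mul_left_cancel₀ h2 (by rw [hn]; ring)
    have h4 : (s : ℂ) = ((3 * -n : ℤ) : ℂ) := by
      push_cast
      rw [← h3]
      ring
    exact hs ⟨-n, by exact_mod_cast h4⟩
  by_contra h0
  exact h1 (mul_right_cancel₀ h0 (by rw [← h, one_mul]))

/-- Translation by (m, m, m) maps the plane of sum 0 onto that of sum 3m and adds 3m² to the
quadratic form. -/
lemma planeSum_three_mul (m : ℤ) (τ : ℂ) :
    planeSum (3 * m) τ = cexp (3 * Real.pi * I * m ^ 2 * τ) * planeSum 0 τ := by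
  rw [planeSum, planeSum, ← tsum_mul_left, ← (Equiv.addRight ((m, m) : ℤ × ℤ)).tsum_eq]
  refine tsum_congr fun p => ?_
  rw [← Complex.exp_add]
  simp only [Equiv.coe_addRight, Prod.fst_add, Prod.snd_add]
  push_cast
  congr 1
  ring

/-- The product of three theta series along a subgroup of order three. -/
lemma theta₃_triple_mul (z : ℂ) {τ : ℂ} (hτ : 0 < τ.im) :
    theta₃ z τ * theta₃ (z + 1 / 3) τ * theta₃ (z - 1 / 3) τ =
      planeSum 0 τ * theta₃ (3 * z) (3 * τ) := by
  simp only [theta₃_eq]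
  let f : (ℤ × ℤ) × ℤ → ℂ := fun p => gaussTerm (p.1.1 + 0) z τ * gaussTerm (p.1.2 + 0) (z + 1 / 3) τ *
    gaussTerm (p.2 + 0) (z - 1 / 3) τ
  let e : (ℤ × ℤ) × ℤ ≃ (ℤ × ℤ) × ℤ :=
    { toFun := fun p => (p.1, p.2 - p.1.1 - p.1.2)
      invFun := fun p => (p.1, p.2 + p.1.1 + p.1.2)
      left_inv := fun p => by ext <;> simp; ring
      right_inv := fun p => by ext <;> simp; ring }
  have hf : Summable f := summable_mul_of_summable_norm
    (f := fun p : ℤ × ℤ => gaussTerm (p.1 + 0) z τ * gaussTerm (p.2 + 0) (z + 1 / 3) τ)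
    (g := fun k : ℤ => gaussTerm (k + 0) (z - 1 / 3) τ)
    (summable_gaussTerm_mul 0 0 z (z + 1 / 3) hτ).norm (summable_gaussTerm 0 (z - 1 / 3) hτ).norm
  have hfe : Summable fun p : ℤ × (ℤ × ℤ) => f (e p.swap) :=
    (Equiv.prodComm _ _).summable_iff.2 (e.summable_iff.2 hf)
  have hterm (s : ℤ) (p : ℤ × ℤ) : f (e (p, s)) = cexp (2 * Real.pi * I * s * z) *
      cexp (Real.pi * I * (p.1 ^ 2 + p.2 ^ 2 + (s - p.1 - p.2) ^ 2) * τ +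
        2 * Real.pi * I * ((p.2 - (s - p.1 - p.2)) / 3)) := by
    simp only [f, e, gaussTerm, Equiv.coe_fn_mk, ← Complex.exp_add]
    push_cast
    congr 1
    ring
  -- The triple series is summed first over the planes a + b + c = s, on which the dependence on z
  -- is constant.
  have h1 : thetaShift 0 z τ * thetaShift 0 (z + 1 / 3) τ * thetaShift 0 (z - 1 / 3) τ =
      ∑' s : ℤ, cexp (2 * Real.pi * I * s * z) * planeSum s τ := by
    calc _ = ∑' p, f p := by
          rw [(hasSum_gaussTerm_mul 0 0 z (z + 1 / 3) hτ).tsum_eq.symm, thetaShift,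
            tsum_mul_tsum_of_summable_norm (summable_gaussTerm_mul 0 0 z (z + 1 / 3) hτ).norm
              (summable_gaussTerm 0 (z - 1 / 3) hτ).norm]
      _ = ∑' p : ℤ × (ℤ × ℤ), f (e p.swap) := by
          rw [← e.tsum_eq, ← (Equiv.prodComm _ _).tsum_eq]
          rfl
      _ = ∑' s : ℤ, ∑' p : ℤ × ℤ, f (e (p, s)) := hfe.tsum_prod
      _ = _ := by simp_rw [hterm, tsum_mul_left, planeSum]
  -- Only the planes with 3 ∣ s contribute, and they assemble to a theta series of period 3τ.
  have hinj : Function.Injective fun m : ℤ => 3 * m := fun a b h => by simpa using h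
  rw [h1, ← hinj.tsum_eq (f := fun s : ℤ => cexp (2 * Real.pi * I * s * z) * planeSum s τ),
    thetaShift, ← tsum_mul_left]
  · refine tsum_congr fun m => ?_
    rw [planeSum_three_mul, gaussTerm, ← mul_assoc, mul_comm (planeSum 0 τ), ← Complex.exp_add]
    push_cast
    congr 2
    ring
  · intro s hs
    by_contra hn
    refine hs ?_
    have : ¬ (3 : ℤ) ∣ s := fun ⟨m, hm⟩ => hn ⟨m, hm.symm⟩
    simp [planeSum_eq_zero this]

/-! ### Limits at the cusp i∞ -/

/-- The filter of neighbourhoods of `i∞`. -/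
def atInfty : Filter ℂ := comap im atTop

instance : NeBot atInfty := by
  refine comap_neBot fun t ht => ?_
  obtain ⟨a, ha⟩ := (mem_atTop_sets.1 ht)
  exact ⟨a * I, by simpa using ha a le_rfl⟩

lemma tendsto_im_atInfty : Tendsto im atInfty atTop := tendsto_comap

lemma eventually_im_atInfty (M : ℝ) : ∀ᶠ τ in atInfty, M < im τ :=
  tendsto_im_atInfty.eventually_gt_atTop M

lemma eventually_atInfty {P : ℂ → Prop} :
    (∀ᶠ τ in atInfty, P τ) ↔ ∃ M : ℝ, ∀ τ : ℂ, M < τ.im → P τ := by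
  constructor
  · intro h
    obtain ⟨t, ht, hs⟩ := mem_comap.1 h
    obtain ⟨a, ha⟩ := mem_atTop_sets.1 ht
    exact ⟨a, fun τ hτ => hs (ha _ hτ.le)⟩
  · rintro ⟨M, hM⟩
    exact (eventually_im_atInfty M).mono hM

/-- The nome `e^{π i τ}`. -/
def nome (τ : ℂ) : ℂ := cexp (Real.pi * I * τ)

lemma nome_ne_zero (τ : ℂ) : nome τ ≠ 0 := Complex.exp_ne_zero _

lemma tendsto_cexp_atInfty {c : ℝ} (hc : 0 < c) :
    Tendsto (fun τ : ℂ => cexp (c * I * τ)) atInfty (𝓝 0) := by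
  rw [tendsto_zero_iff_norm_tendsto_zero]
  have : (fun τ : ℂ => ‖cexp (c * I * τ)‖) = fun τ => Real.exp (-(c * τ.im)) := by
    funext τ
    rw [Complex.norm_exp]
    congr 1
    simp
  rw [this]
  exact Real.tendsto_exp_neg_atTop_nhds_zero.comp
    (tendsto_im_atInfty.const_mul_atTop hc)

lemma tendsto_nome : Tendsto nome atInfty (𝓝 0) := tendsto_cexp_atInfty Real.pi_pos

lemma tendsto_const_mul_atInfty {c : ℝ} (hc : 0 < c) :
    Tendsto (fun τ : ℂ => c * τ) atInfty atInfty := by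
  refine tendsto_comap_iff.2 ?_
  have : im ∘ (fun τ : ℂ => c * τ) = fun τ => c * τ.im := by
    funext τ
    simp
  rw [this]
  exact tendsto_im_atInfty.const_mul_atTop hc

lemma summable_half_pow_natAbs : Summable fun k : ℤ => (1 / 2 : ℝ) ^ k.natAbs := by
  refine Summable.of_nat_of_neg ?_ ?_ <;> simpa using summable_geometric_two

/-- For |q| < 1/2 the terms are dominated by a geometric series in |k|. As 0⁰ = 1, the limit retains
exactly the terms with exponent 0. -/
lemma tendsto_tsum_mul_pow (f : ℤ → ℂ) (e : ℤ → ℕ) (hf : ∀ k, ‖f k‖ = 1)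
    (he : ∀ k : ℤ, k.natAbs ≤ e k + 1) :
    Tendsto (fun q : ℂ => ∑' k, f k * q ^ e k) (𝓝 0) (𝓝 (∑' k, f k * 0 ^ e k)) := by
  refine tendsto_tsum_of_dominated_convergence (bound := fun k : ℤ => 2 * (1 / 2 : ℝ) ^ k.natAbs)
    (summable_half_pow_natAbs.mul_left 2) (fun k => ?_) ?_
  · exact (continuous_const.mul (continuous_pow (e k))).tendsto 0
  · filter_upwards [Metric.ball_mem_nhds (0 : ℂ) (by norm_num : (0 : ℝ) < 1 / 2)] with q hq k
    have hq' : ‖q‖ ≤ 1 / 2 := (mem_ball_zero_iff.1 hq).le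
    rw [norm_mul, hf, one_mul, norm_pow]
    calc ‖q‖ ^ e k ≤ (1 / 2) ^ e k := pow_le_pow_left₀ (norm_nonneg _) hq' _
      _ = 2 * (1 / 2) ^ (e k + 1) := by ring
      _ ≤ 2 * (1 / 2) ^ k.natAbs := by
        have := pow_le_pow_of_le_one (by norm_num : (0 : ℝ) ≤ 1 / 2) (by norm_num) (he k)
        linarith

lemma norm_cexp_two_pi_mul (k : ℝ) (z : ℝ) : ‖cexp (2 * Real.pi * I * k * z)‖ = 1 := by
  rw [show (2 * Real.pi * I * k * z : ℂ) = ((2 * Real.pi * k * z : ℝ) : ℂ) * I by push_cast; ring]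
  exact Complex.norm_exp_ofReal_mul_I _

lemma tendsto_theta₃ (z : ℝ) : Tendsto (fun τ => theta₃ z τ) atInfty (𝓝 1) := by
  have h := (tendsto_tsum_mul_pow (fun k : ℤ => cexp (2 * Real.pi * I * k * z))
    (fun k => k.natAbs ^ 2) (fun k => norm_cexp_two_pi_mul k z) (fun k => by nlinarith)).comp tendsto_nome
  rw [tsum_eq_single 0] at h
  · simp only [Int.cast_zero, mul_zero, zero_mul, Complex.exp_zero] at h
    refine (h.congr fun τ => ?_).trans (by simp)
    rw [theta₃_eq, thetaShift]
    refine tsum_congr fun k => ?_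
    rw [gaussTerm, nome, ← Complex.exp_nat_mul, ← Complex.exp_add]
    congr 1
    rw [Nat.cast_pow, ← Int.cast_natCast, ← Int.cast_pow, Int.natAbs_sq, Int.cast_pow]
    ring
  · intro k hk
    simp [hk]

lemma tendsto_theta₂ (z : ℝ) : Tendsto (fun τ => theta₂ z τ / cexp (Real.pi * I * τ / 4)) atInfty
    (𝓝 (2 * Complex.cos (Real.pi * z))) := by
  have h := (tendsto_tsum_mul_pow (fun k : ℤ => cexp (2 * Real.pi * I * ((k + 1 / 2 : ℝ) : ℂ) * z))
    (fun k => (k * (k + 1)).natAbs) (fun k => norm_cexp_two_pi_mul _ z)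
    (fun k => by
      rw [Int.natAbs_mul]
      rcases eq_or_ne k (-1) with rfl | h
      · simp
      · have : 1 ≤ (k + 1).natAbs := by omega
        exact (Nat.le_mul_of_pos_right _ this).trans (Nat.le_succ _))).comp tendsto_nome
  -- Since (k + 1/2)² = k(k + 1) + 1/4, the lowest power of the nome is attained at k = 0 and k =
  -- −1; these two terms give the cosine.
  rw [tsum_eq_sum (s := {0, -1})] at h
  · rw [Finset.sum_pair (by norm_num)] at h
    refine (h.congr fun τ => ?_).trans (le_of_eq ?_)
    · rw [theta₂_eq, thetaShift, ← tsum_div_const]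
      refine tsum_congr fun k => ?_
      rw [gaussTerm, nome, ← Complex.exp_nat_mul, ← Complex.exp_add, ← Complex.exp_sub]
      congr 1
      have h0 : 0 ≤ k * (k + 1) := by
        rcases le_or_gt 0 k with h | h <;> nlinarith
      have h1 : (((k * (k + 1)).natAbs : ℕ) : ℂ) = ((k * (k + 1) : ℤ) : ℂ) := by
        rw [← Int.cast_natCast, Int.natAbs_of_nonneg h0]
      rw [h1]
      push_cast
      ring
    · congr 1
      rw [Complex.two_cos]
      simp
      congr 2 <;> ring
  · intro k hk
    have : k * (k + 1) ≠ 0 := by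
      simp only [Finset.mem_insert, Finset.mem_singleton, not_or] at hk
      exact mul_ne_zero hk.1 (by omega)
    simp [this]

/-- A zero at τ would recur at 2ⁿτ for all n, and these points tend to i∞. -/
lemma ne_zero_of_doubling {f : ℂ → ℂ} (hf : ∀ τ : ℂ, 0 < τ.im → f τ = 0 → f (2 * τ) = 0)
    (h : ∀ᶠ τ in atInfty, f τ ≠ 0) {τ : ℂ} (hτ : 0 < τ.im) : f τ ≠ 0 := by
  intro h0
  have hn (n : ℕ) : 0 < (2 ^ n * τ).im ∧ f (2 ^ n * τ) = 0 := by
    induction n with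
    | zero => simpa using ⟨hτ, h0⟩
    | succ n ih =>
      rw [pow_succ', mul_assoc]
      exact ⟨im_two_mul ih.1, hf _ ih.1 ih.2⟩
  have ht : Tendsto (fun n : ℕ => (2 : ℂ) ^ n * τ) atTop atInfty := by
    refine tendsto_comap_iff.2 ?_
    have : im ∘ (fun n : ℕ => (2 : ℂ) ^ n * τ) = fun n : ℕ => (2 : ℝ) ^ n * τ.im := by
      funext n
      have : ((2 : ℂ) ^ n) = ((2 ^ n : ℝ) : ℂ) := by push_cast; rfl
      simp only [Function.comp_apply]
      rw [this, im_ofReal_mul]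
    rw [this]
    exact (tendsto_pow_atTop_atTop_of_one_lt (by norm_num)).atTop_mul_const hτ
  obtain ⟨n, h⟩ := (ht.eventually h).exists
  exact h (hn n).2

/-! ### Theta constants and theta values at 1/6, 1/3, 1/2, 2/3 -/

/-- The theta constants and the values of the theta functions at `1/6`. -/
def null₂ (τ : ℂ) : ℂ := theta₂ 0 τ

def null₃ (τ : ℂ) : ℂ := theta₃ 0 τ

def null₄ (τ : ℂ) : ℂ := theta₄ 0 τ

def sixth₁ (τ : ℂ) : ℂ := theta₁ (1 / 6) τ

def sixth₂ (τ : ℂ) : ℂ := theta₂ (1 / 6) τ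

def sixth₃ (τ : ℂ) : ℂ := theta₃ (1 / 6) τ

def sixth₄ (τ : ℂ) : ℂ := theta₄ (1 / 6) τ

section Values

variable (τ : ℂ)

lemma theta₃_neg (z : ℂ) : theta₃ (-z) τ = theta₃ z τ := by
  simp only [theta₃_eq, thetaShift_zero_neg]

lemma theta₂_neg (z : ℂ) : theta₂ (-z) τ = theta₂ z τ := by
  simp only [theta₂_eq, thetaShift_half_neg]

lemma theta₃_add_one (z : ℂ) : theta₃ (z + 1) τ = theta₃ z τ := by
  simp only [theta₃_eq, thetaShift_zero_add_one]

lemma theta₂_add_one (z : ℂ) : theta₂ (z + 1) τ = -theta₂ z τ := by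
  simp only [theta₂_eq, thetaShift_half_add_one]

lemma theta₄_eq_theta₃ (z : ℂ) : theta₄ z τ = theta₃ (z + 1 / 2) τ := by
  simp only [theta₄_eq, theta₃_eq]

lemma theta₁_eq_theta₂ (z : ℂ) : theta₁ z τ = -theta₂ (z + 1 / 2) τ := by
  simp only [theta₁_eq, theta₂_eq]

lemma theta₃_half : theta₃ (1 / 2) τ = null₄ τ := by
  rw [null₄, theta₄_eq_theta₃, zero_add]

lemma theta₂_half : theta₂ (1 / 2) τ = 0 := by
  have h := theta₂_add_one τ (-(1 / 2))
  rw [theta₂_neg, show (-(1 / 2) + 1 : ℂ) = 1 / 2 by norm_num] at h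
  exact self_eq_neg.1 h

lemma theta₃_one : theta₃ 1 τ = null₃ τ := by
  simpa [null₃] using theta₃_add_one τ 0

lemma theta₂_one : theta₂ 1 τ = -null₂ τ := by
  simpa [null₂] using theta₂_add_one τ 0

lemma theta₃_third : theta₃ (1 / 3) τ = sixth₄ τ := by
  rw [sixth₄, theta₄_eq_theta₃, ← theta₃_neg τ (1 / 3), ← theta₃_add_one]
  norm_num

lemma theta₂_third : theta₂ (1 / 3) τ = sixth₁ τ := by
  rw [sixth₁, theta₁_eq_theta₂, ← theta₂_neg τ (1 / 3), ← neg_eq_iff_eq_neg, ← theta₂_add_one]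
  norm_num

lemma theta₃_two_thirds : theta₃ (2 / 3) τ = sixth₄ τ := by
  rw [sixth₄, theta₄_eq_theta₃]
  norm_num

lemma theta₂_two_thirds : theta₂ (2 / 3) τ = -sixth₁ τ := by
  rw [sixth₁, theta₁_eq_theta₂]
  norm_num

end Values

/-! ### Doubling formulas: the product formula at special arguments -/

section Doubling

variable {τ : ℂ} (hτ : 0 < τ.im)
include hτ

lemma null₃_sq : null₃ τ ^ 2 = null₃ (2 * τ) ^ 2 + null₂ (2 * τ) ^ 2 := by
  have h := theta₃_mul 0 0 hτ
  simp only [add_zero, sub_zero] at h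
  simpa only [null₃, null₂, sq] using h

lemma null₂_sq : null₂ τ ^ 2 = 2 * null₃ (2 * τ) * null₂ (2 * τ) := by
  have h := theta₂_mul 0 0 hτ
  simp only [add_zero, sub_zero] at h
  simp only [null₃, null₂, sq, h]
  ring

lemma null₄_sq : null₄ τ ^ 2 = null₃ (2 * τ) ^ 2 - null₂ (2 * τ) ^ 2 := by
  have h := theta₃_mul (1 / 2) (1 / 2) hτ
  rw [show (1 / 2 + 1 / 2 : ℂ) = 1 by norm_num, sub_self, theta₃_half, theta₃_one, theta₂_one] at h
  simp only [null₃, null₂, sq] at h ⊢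
  rw [h]
  ring

lemma null₃_mul_null₄ : null₃ τ * null₄ τ = null₄ (2 * τ) ^ 2 := by
  have h := theta₃_mul (1 / 2) 0 hτ
  rw [add_zero, sub_zero, theta₃_half, theta₃_half, theta₂_half] at h
  rw [null₃, mul_comm, h]
  ring

lemma sixth₃_sq : sixth₃ τ ^ 2 =
    sixth₄ (2 * τ) * null₃ (2 * τ) + sixth₁ (2 * τ) * null₂ (2 * τ) := by
  have h := theta₃_mul (1 / 6) (1 / 6) hτ
  rw [show (1 / 6 + 1 / 6 : ℂ) = 1 / 3 by norm_num, sub_self, theta₃_third, theta₂_third] at h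
  rw [sixth₃, sq, h, null₃, null₂]

lemma sixth₄_sq : sixth₄ τ ^ 2 =
    sixth₄ (2 * τ) * null₃ (2 * τ) - sixth₁ (2 * τ) * null₂ (2 * τ) := by
  have h := theta₃_mul (1 / 3) (1 / 3) hτ
  rw [show (1 / 3 + 1 / 3 : ℂ) = 2 / 3 by norm_num, sub_self, theta₃_third, theta₃_two_thirds,
    theta₂_two_thirds] at h
  rw [sq, h, null₃, null₂]
  ring

lemma sixth₂_sq : sixth₂ τ ^ 2 =
    sixth₁ (2 * τ) * null₃ (2 * τ) + sixth₄ (2 * τ) * null₂ (2 * τ) := by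
  have h := theta₂_mul (1 / 6) (1 / 6) hτ
  rw [show (1 / 6 + 1 / 6 : ℂ) = 1 / 3 by norm_num, sub_self, theta₃_third, theta₂_third] at h
  rw [sixth₂, sq, h, null₃, null₂]

lemma sixth₁_sq : sixth₁ τ ^ 2 =
    sixth₄ (2 * τ) * null₂ (2 * τ) - sixth₁ (2 * τ) * null₃ (2 * τ) := by
  have h := theta₂_mul (1 / 3) (1 / 3) hτ
  rw [show (1 / 3 + 1 / 3 : ℂ) = 2 / 3 by norm_num, sub_self, theta₂_third, theta₃_two_thirds,
    theta₂_two_thirds] at h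
  rw [sq, h, null₃, null₂]
  ring

lemma sixth₁_mul_null₂ : sixth₁ τ * null₂ τ = 2 * sixth₄ (2 * τ) * sixth₁ (2 * τ) := by
  have h := theta₂_mul (1 / 3) 0 hτ
  rw [add_zero, sub_zero, theta₃_third, theta₂_third, theta₂_third] at h
  rw [null₂, h]
  ring

lemma sixth₂_mul_null₂ : sixth₂ τ * null₂ τ = 2 * sixth₃ (2 * τ) * sixth₂ (2 * τ) := by
  have h := theta₂_mul (1 / 6) 0 hτ
  rw [add_zero, sub_zero] at h
  rw [null₂, sixth₂, h, sixth₃, sixth₂]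
  ring

lemma sixth₁_mul_sixth₂ : sixth₁ τ * sixth₂ τ = null₄ (2 * τ) * sixth₂ (2 * τ) := by
  have h := theta₂_mul (1 / 3) (1 / 6) hτ
  rw [show (1 / 3 + 1 / 6 : ℂ) = 1 / 2 by norm_num, show (1 / 3 - 1 / 6 : ℂ) = 1 / 6 by norm_num,
    theta₂_third, theta₂_half, theta₃_half] at h
  rw [sixth₂, h, sixth₂]
  ring

lemma sixth₄_mul_sixth₃ : sixth₄ τ * sixth₃ τ = null₄ (2 * τ) * sixth₃ (2 * τ) := by
  have h := theta₃_mul (1 / 3) (1 / 6) hτ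
  rw [show (1 / 3 + 1 / 6 : ℂ) = 1 / 2 by norm_num, show (1 / 3 - 1 / 6 : ℂ) = 1 / 6 by norm_num,
    theta₃_third, theta₂_half, theta₃_half] at h
  rw [sixth₃, h, sixth₃]
  ring

end Doubling

/-! ### Leading terms at i∞ and the translation τ ↦ τ + 1 -/

section Limits

/-- `e^{π i τ / 4}`, the leading term of `θ₁` and `θ₂`. -/
def nomeQuarter (τ : ℂ) : ℂ := cexp (Real.pi * I * τ / 4)

lemma nomeQuarter_ne_zero (τ : ℂ) : nomeQuarter τ ≠ 0 := Complex.exp_ne_zero _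

lemma nomeQuarter_pow_four (τ : ℂ) : nomeQuarter τ ^ 4 = nome τ := by
  rw [nomeQuarter, nome, ← Complex.exp_nat_mul]
  congr 1
  push_cast
  ring

lemma tendsto_null₃ : Tendsto null₃ atInfty (𝓝 1) := by
  simpa using! tendsto_theta₃ 0

lemma tendsto_null₄ : Tendsto null₄ atInfty (𝓝 1) := by
  refine (tendsto_theta₃ (1 / 2)).congr fun τ => ?_
  rw [← theta₃_half]
  norm_num

lemma tendsto_sixth₃ : Tendsto sixth₃ atInfty (𝓝 1) := by
  refine (tendsto_theta₃ (1 / 6)).congr fun τ => ?_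
  rw [sixth₃]
  norm_num

lemma tendsto_sixth₄ : Tendsto sixth₄ atInfty (𝓝 1) := by
  refine (tendsto_theta₃ (1 / 3)).congr fun τ => ?_
  rw [← theta₃_third]
  norm_num

lemma tendsto_null₂ : Tendsto (fun τ => null₂ τ / nomeQuarter τ) atInfty (𝓝 2) := by
  simpa using! tendsto_theta₂ 0

lemma tendsto_sixth₁ : Tendsto (fun τ => sixth₁ τ / nomeQuarter τ) atInfty (𝓝 1) := by
  have h := tendsto_theta₂ (1 / 3)
  have h1 : Complex.cos (Real.pi * ((1 / 3 : ℝ) : ℂ)) = 1 / 2 := by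
    rw [← ofReal_mul, ← ofReal_cos, mul_one_div, Real.cos_pi_div_three]
    norm_num
  rw [h1, show (2 * (1 / 2) : ℂ) = 1 by norm_num] at h
  refine h.congr fun τ => ?_
  rw [← theta₂_third, nomeQuarter]
  norm_num

lemma tendsto_sixth₂ : Tendsto (fun τ => sixth₂ τ / nomeQuarter τ) atInfty
    (𝓝 ((Real.sqrt 3 : ℝ) : ℂ)) := by
  have h := tendsto_theta₂ (1 / 6)
  have h1 : 2 * Complex.cos (Real.pi * ((1 / 6 : ℝ) : ℂ)) = ((Real.sqrt 3 : ℝ) : ℂ) := by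
    rw [← ofReal_mul, ← ofReal_cos, mul_one_div, Real.cos_pi_div_six]
    push_cast
    ring
  rw [h1] at h
  refine h.congr fun τ => ?_
  rw [sixth₂, nomeQuarter]
  norm_num

end Limits

section Translation

lemma theta₃_period_add_one (z τ : ℂ) : theta₃ z (τ + 1) = theta₃ (z + 1 / 2) τ := by
  rw [theta₃_eq, theta₃_eq]
  refine tsum_congr fun k => ?_
  rw [gaussTerm, gaussTerm, Complex.exp_eq_exp_iff_exists_int]
  obtain ⟨m, hm⟩ : (2 : ℤ) ∣ k * (k - 1) := (Int.even_mul_pred_self k).two_dvd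
  refine ⟨m, ?_⟩
  have : (k : ℂ) * (k - 1) = 2 * m := by exact_mod_cast congrArg (Int.cast (R := ℂ)) hm
  linear_combination (Real.pi * I) * this

lemma theta₂_period_add_one (z τ : ℂ) :
    theta₂ z (τ + 1) = cexp (Real.pi * I / 4) * theta₂ z τ := by
  rw [theta₂_eq, theta₂_eq, thetaShift, thetaShift, ← tsum_mul_left]
  refine tsum_congr fun k => ?_
  rw [gaussTerm, gaussTerm, ← Complex.exp_add, Complex.exp_eq_exp_iff_exists_int]
  obtain ⟨m, hm⟩ : (2 : ℤ) ∣ k * (k + 1) := (Int.even_mul_succ_self k).two_dvd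
  refine ⟨m, ?_⟩
  have : (k : ℂ) * (k + 1) = 2 * m := by exact_mod_cast congrArg (Int.cast (R := ℂ)) hm
  linear_combination (Real.pi * I) * this

lemma null₃_add_one (τ : ℂ) : null₃ (τ + 1) = null₄ τ := by
  rw [null₃, theta₃_period_add_one, zero_add, theta₃_half]

lemma null₄_add_one (τ : ℂ) : null₄ (τ + 1) = null₃ τ := by
  rw [← theta₃_half, theta₃_period_add_one, add_halves, theta₃_one]

lemma null₂_add_one (τ : ℂ) : null₂ (τ + 1) = cexp (Real.pi * I / 4) * null₂ τ :=
  theta₂_period_add_one 0 τ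

lemma sixth₄_add_one (τ : ℂ) : sixth₄ (τ + 1) = sixth₃ τ := by
  rw [← theta₃_third, theta₃_period_add_one, sixth₃, ← theta₃_neg, ← theta₃_add_one]
  norm_num

lemma sixth₃_add_one (τ : ℂ) : sixth₃ (τ + 1) = sixth₄ τ := by
  rw [sixth₃, theta₃_period_add_one, sixth₄, theta₄_eq_theta₃]

end Translation

/-! ### Nonvanishing of the theta values -/

section NonVanishing

variable {τ : ℂ} (hτ : 0 < τ.im)
include hτ

lemma null₄_ne_zero : null₄ τ ≠ 0 := by
  refine ne_zero_of_doubling (fun τ hτ h => ?_) (tendsto_null₄.eventually_ne one_ne_zero) hτ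
  have := null₃_mul_null₄ hτ
  rw [h, mul_zero] at this
  exact pow_eq_zero_iff two_ne_zero |>.1 this.symm

lemma null₃_ne_zero : null₃ τ ≠ 0 := by
  rw [← null₄_add_one]
  exact null₄_ne_zero (by simpa using hτ)

omit hτ in
lemma eventually_ne_zero_of_tendsto_div {f g : ℂ → ℂ} {c : ℂ} (hc : c ≠ 0)
    (h : Tendsto (fun τ => f τ / g τ) atInfty (𝓝 c)) : ∀ᶠ τ in atInfty, f τ ≠ 0 :=
  (h.eventually_ne hc).mono fun τ h h0 => h (by rw [h0, zero_div])

lemma null₂_ne_zero : null₂ τ ≠ 0 := by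
  refine ne_zero_of_doubling (fun τ hτ h => ?_)
    (eventually_ne_zero_of_tendsto_div two_ne_zero tendsto_null₂) hτ
  have := null₂_sq hτ
  rw [h] at this
  simpa [null₃_ne_zero (im_two_mul hτ)] using this

/-- If the value vanishes at τ but not at 2τ, then `sixth₁_mul_null₂` forces `sixth₄` to vanish at
2τ, and `sixth₁_sq` then reduces to a product of nonzero factors equal to 0. -/
lemma sixth₁_ne_zero : sixth₁ τ ≠ 0 := by
  refine ne_zero_of_doubling (fun τ hτ h => ?_)
    (eventually_ne_zero_of_tendsto_div one_ne_zero tendsto_sixth₁) hτ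
  by_contra h1
  have h2 := sixth₁_mul_null₂ hτ
  have h3 := sixth₁_sq hτ
  rw [h] at h2 h3
  have h4 : sixth₄ (2 * τ) = 0 := by simpa [h1] using h2
  rw [h4] at h3
  simp [h1, null₃_ne_zero (im_two_mul hτ)] at h3

lemma sixth₂_ne_zero : sixth₂ τ ≠ 0 := by
  refine ne_zero_of_doubling (fun τ hτ h => ?_)
    (eventually_ne_zero_of_tendsto_div (by simp) tendsto_sixth₂) hτ
  have := sixth₁_mul_sixth₂ hτ
  rw [h] at this
  simpa [null₄_ne_zero (im_two_mul hτ)] using this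

/-- Here the doubling formula is read backwards: the value is a factor of a product that is nonzero
at τ/2. -/
lemma sixth₄_ne_zero : sixth₄ τ ≠ 0 := by
  have h1 : 0 < (τ / 2).im := by simpa using hτ
  have h := sixth₁_mul_null₂ h1
  rw [mul_div_cancel₀ _ two_ne_zero] at h
  intro h0
  rw [h0] at h
  simp [sixth₁_ne_zero h1, null₂_ne_zero h1] at h

lemma sixth₃_ne_zero : sixth₃ τ ≠ 0 := by
  rw [← sixth₄_add_one]
  exact sixth₄_ne_zero (by simpa using hτ)

/-- After multiplication by `sixth₂`, the products (ϑ₂ · `sixth₂`)(ϑ₃ϑ₄) and (`sixth₁` ·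
`sixth₂`)(`sixth₃` · `sixth₄`) double to the same monomial at 2τ, up to the factor 2. -/
lemma null_mul_eq : null₂ τ * null₃ τ * null₄ τ = 2 * sixth₁ τ * sixth₃ τ * sixth₄ τ := by
  refine mul_right_cancel₀ (sixth₂_ne_zero hτ) ?_
  linear_combination null₃ τ * null₄ τ * sixth₂_mul_null₂ hτ +
    2 * sixth₃ (2 * τ) * sixth₂ (2 * τ) * null₃_mul_null₄ hτ -
    2 * sixth₄ τ * sixth₃ τ * sixth₁_mul_sixth₂ hτ -
    2 * null₄ (2 * τ) * sixth₂ (2 * τ) * sixth₄_mul_sixth₃ hτ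

end NonVanishing

/-! ### Algebraic relations between x, p and q -/

section Algebraic

variable {τ : ℂ} (hτ : 0 < τ.im)
include hτ

lemma null₃_pow_four : null₃ τ ^ 4 = null₂ τ ^ 4 + null₄ τ ^ 4 := by
  linear_combination (null₃ τ ^ 2 + (null₃ (2 * τ) ^ 2 + null₂ (2 * τ) ^ 2)) * null₃_sq hτ -
    (null₂ τ ^ 2 + 2 * null₃ (2 * τ) * null₂ (2 * τ)) * null₂_sq hτ -
    (null₄ τ ^ 2 + (null₃ (2 * τ) ^ 2 - null₂ (2 * τ) ^ 2)) * null₄_sq hτ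

lemma sixth₃_pow_four_sub : sixth₃ τ ^ 4 - sixth₄ τ ^ 4 = sixth₁ τ * null₂ τ ^ 3 := by
  rw [show sixth₁ τ * null₂ τ ^ 3 = sixth₁ τ * null₂ τ * null₂ τ ^ 2 by ring,
    show sixth₃ τ ^ 4 - sixth₄ τ ^ 4 = (sixth₃ τ ^ 2) ^ 2 - (sixth₄ τ ^ 2) ^ 2 by ring,
    sixth₃_sq hτ, sixth₄_sq hτ, null₂_sq hτ, sixth₁_mul_null₂ hτ]
  ring

/-- The squares at τ are quadratic forms in the values at 2τ, so such identities become polynomial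
ones. This one makes q² − 1 a monomial in theta values. -/
lemma sixth₂_pow_four_sub : sixth₂ τ ^ 4 - sixth₁ τ ^ 4 = sixth₁ τ * null₂ τ ^ 3 := by
  rw [show sixth₁ τ * null₂ τ ^ 3 = sixth₁ τ * null₂ τ * null₂ τ ^ 2 by ring,
    show sixth₂ τ ^ 4 - sixth₁ τ ^ 4 = (sixth₂ τ ^ 2) ^ 2 - (sixth₁ τ ^ 2) ^ 2 by ring,
    sixth₂_sq hτ, sixth₁_sq hτ, null₂_sq hτ, sixth₁_mul_null₂ hτ]
  ring

lemma null_sixth_add : null₄ τ ^ 2 * sixth₁ τ ^ 2 + null₃ τ ^ 2 * sixth₂ τ ^ 2 =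
    null₂ τ ^ 2 * sixth₃ τ ^ 2 := by
  rw [null₄_sq hτ, sixth₁_sq hτ, null₃_sq hτ, sixth₂_sq hτ, null₂_sq hτ, sixth₃_sq hτ]
  ring

lemma null_sixth_sub : sixth₃ τ ^ 2 * null₄ τ ^ 2 + sixth₁ τ ^ 2 * null₂ τ ^ 2 =
    sixth₄ τ ^ 2 * null₃ τ ^ 2 := by
  rw [null₄_sq hτ, sixth₁_sq hτ, null₃_sq hτ, sixth₄_sq hτ, null₂_sq hτ, sixth₃_sq hτ]
  ring

lemma sixth_mul_sub : sixth₄ τ ^ 2 * sixth₂ τ ^ 2 - sixth₃ τ ^ 2 * sixth₁ τ ^ 2 =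
    sixth₁ τ * null₂ τ * null₄ τ ^ 2 := by
  rw [null₄_sq hτ, sixth₁_sq hτ, sixth₂_sq hτ, sixth₄_sq hτ, sixth₁_mul_null₂ hτ, sixth₃_sq hτ]
  ring

omit hτ in
lemma pFun_eq : pFun τ = null₄ τ / null₃ τ := rfl

omit hτ in
lemma qFun_eq : qFun τ = sixth₂ τ ^ 2 / sixth₁ τ ^ 2 := rfl

lemma pFun_sq_add_qFun :
    pFun τ ^ 2 + qFun τ = null₂ τ ^ 2 * sixth₃ τ ^ 2 / (null₃ τ ^ 2 * sixth₁ τ ^ 2) := by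
  have h3 := null₃_ne_zero hτ
  have s1 := sixth₁_ne_zero hτ
  rw [pFun_eq, qFun_eq]
  field_simp
  linear_combination null_sixth_add hτ

lemma pFun_sq_add_qFun_ne_zero : pFun τ ^ 2 + qFun τ ≠ 0 := by
  rw [pFun_sq_add_qFun hτ]
  exact div_ne_zero (mul_ne_zero (pow_ne_zero _ (null₂_ne_zero hτ))
    (pow_ne_zero _ (sixth₃_ne_zero hτ))) (mul_ne_zero (pow_ne_zero _ (null₃_ne_zero hτ))
    (pow_ne_zero _ (sixth₁_ne_zero hτ)))

/-- Both q² − 1 and p² + q are monomials in theta values, hence so is x, and `null_mul_eq` collapses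
it to one quotient. This form shows that x has no zeros or poles. -/
lemma xFun_eq : xFun τ = sixth₄ τ / sixth₃ τ := by
  have h3 := null₃_ne_zero hτ
  have h2 := null₂_ne_zero hτ
  have s1 := sixth₁_ne_zero hτ
  have s3 := sixth₃_ne_zero hτ
  have hq : qFun τ ^ 2 - 1 = null₂ τ ^ 3 / sixth₁ τ ^ 3 := by
    rw [qFun_eq]
    field_simp
    linear_combination sixth₂_pow_four_sub hτ
  rw [xFun, pFun_sq_add_qFun hτ, hq, pFun_eq]
  field_simp
  linear_combination null_mul_eq hτ

lemma pFun_ne_zero : pFun τ ≠ 0 := div_ne_zero (null₄_ne_zero hτ) (null₃_ne_zero hτ)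

lemma xFun_ne_zero : xFun τ ≠ 0 := by
  rw [xFun_eq hτ]
  exact div_ne_zero (sixth₄_ne_zero hτ) (sixth₃_ne_zero hτ)

lemma xFun_pow_four_ne_one : xFun τ ^ 4 ≠ 1 := by
  have s3 := sixth₃_ne_zero hτ
  intro h
  rw [xFun_eq hτ, div_pow, div_eq_one_iff_eq (pow_ne_zero _ s3)] at h
  have := sixth₃_pow_four_sub hτ
  rw [h, sub_self] at this
  exact mul_ne_zero (sixth₁_ne_zero hτ) (pow_ne_zero _ (null₂_ne_zero hτ)) this.symm

lemma one_sub_pFun_pow_four : 1 - pFun τ ^ 4 = null₂ τ ^ 4 / null₃ τ ^ 4 := by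
  have h3 := null₃_ne_zero hτ
  rw [pFun_eq]
  field_simp
  linear_combination null₃_pow_four hτ

lemma pFun_pow_four_ne_one : pFun τ ^ 4 ≠ 1 := by
  intro h
  have := one_sub_pFun_pow_four hτ
  rw [h, sub_self] at this
  exact div_ne_zero (pow_ne_zero _ (null₂_ne_zero hτ)) (pow_ne_zero _ (null₃_ne_zero hτ)) this.symm

/-- The algebraic relation between `x` and `p`. -/
lemma xFun_pFun : 2 * xFun τ * pFun τ ^ 2 - (xFun τ ^ 4 - 1) * pFun τ - 2 * xFun τ ^ 3 = 0 := by
  have h3 := null₃_ne_zero hτ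
  have s3 := sixth₃_ne_zero hτ
  rw [xFun_eq hτ, pFun_eq]
  field_simp
  linear_combination null₄ τ * null₃ τ * sixth₃_pow_four_sub hτ +
    sixth₁ τ * null₂ τ ^ 2 * null_mul_eq hτ + 2 * sixth₃ τ * sixth₄ τ * null_sixth_sub hτ

lemma xFun_sq_mul_qFun : xFun τ ^ 2 * qFun τ = 1 + 2 * xFun τ * pFun τ := by
  have h3 := null₃_ne_zero hτ
  have s3 := sixth₃_ne_zero hτ
  have s1 := sixth₁_ne_zero hτ
  rw [xFun_eq hτ, pFun_eq, qFun_eq]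
  field_simp
  linear_combination null₃ τ * sixth_mul_sub hτ + sixth₁ τ * null₄ τ * null_mul_eq hτ

/-- This is `theta₃_triple_mul` at z = 0; the next lemma is its case z = 1/2. The factor `planeSum 0
τ` is common to both and cancels in `xFun_sq_mul_pFun_three`. -/
lemma null₃_triple : null₃ τ * sixth₄ τ ^ 2 = planeSum 0 τ * null₃ (3 * τ) := by
  have h := theta₃_triple_mul 0 hτ
  rw [zero_add, zero_sub, theta₃_neg, theta₃_third, mul_zero] at h
  rw [null₃, null₃, ← h]
  ring

lemma null₄_triple : null₄ τ * sixth₃ τ ^ 2 = planeSum 0 τ * null₄ (3 * τ) := by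
  have h := theta₃_triple_mul (1 / 2) hτ
  rw [theta₃_half, show (1 / 2 + 1 / 3 : ℂ) = -(1 / 6) + 1 by norm_num,
    show (1 / 2 - 1 / 3 : ℂ) = 1 / 6 by norm_num, theta₃_add_one, theta₃_neg,
    show (3 * (1 / 2) : ℂ) = 1 / 2 + 1 by norm_num, theta₃_add_one, theta₃_half] at h
  rw [sixth₃, ← h]
  ring

/-- `x² = p(τ) / p(3τ)`. -/
lemma xFun_sq_mul_pFun_three : xFun τ ^ 2 * pFun (3 * τ) = pFun τ := by
  have hτ3 : 0 < (3 * τ).im := by simpa using hτ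
  have h3 := null₃_ne_zero hτ
  have h33 := null₃_ne_zero hτ3
  have s3 := sixth₃_ne_zero hτ
  rw [xFun_eq hτ, pFun_eq, pFun_eq]
  field_simp
  linear_combination null₄ (3 * τ) * null₃_triple hτ - null₃ (3 * τ) * null₄_triple hτ

end Algebraic

/-- The function `y` on Schwarz's curve. -/
def yFun (τ : ℂ) : ℂ := xFun τ ^ 4 - 4 * xFun τ * pFun τ - 1

/-- The relation `xFun_pFun`, quadratic in p, has discriminant (x⁴ − 1)² + 16x⁴, and y is minus its
derivative in p. -/
lemma yFun_sq {τ : ℂ} (hτ : 0 < τ.im) : yFun τ ^ 2 = xFun τ ^ 8 + 14 * xFun τ ^ 4 + 1 := by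
  rw [yFun]
  linear_combination 8 * xFun τ * xFun_pFun hτ

lemma pFun_eq_of_yFun {τ : ℂ} (hτ : 0 < τ.im) :
    pFun τ = (xFun τ ^ 4 - yFun τ - 1) / (4 * xFun τ) := by
  have := xFun_ne_zero hτ
  rw [yFun]
  field_simp
  ring

lemma qFun_eq_of_yFun {τ : ℂ} (hτ : 0 < τ.im) :
    qFun τ = (xFun τ ^ 4 - yFun τ + 1) / (2 * xFun τ ^ 2) := by
  have := xFun_ne_zero hτ
  rw [yFun]
  field_simp
  linear_combination 2 * xFun_sq_mul_qFun hτ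

/-! ### Holomorphy on the half-plane -/

/-- The upper half-plane as a set of complex numbers. -/
def halfPlane : Set ℂ := {τ | 0 < τ.im}

lemma isOpen_halfPlane : IsOpen halfPlane := isOpen_lt continuous_const Complex.continuous_im

lemma halfPlane_mem_nhds {τ : ℂ} (hτ : 0 < τ.im) : halfPlane ∈ 𝓝 τ := isOpen_halfPlane.mem_nhds hτ

lemma isPreconnected_halfPlane : IsPreconnected halfPlane :=
  (convex_halfSpace_im_gt 0).isPreconnected

section Holomorphy

lemma theta₃_eq_jacobiTheta₂ (z τ : ℂ) : theta₃ z τ = jacobiTheta₂ z τ := by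
  simp [theta₃_eq, thetaShift_eq]

lemma theta₂_eq_jacobiTheta₂ (z τ : ℂ) :
    theta₂ z τ = cexp (Real.pi * I * τ / 4 + Real.pi * I * z) * jacobiTheta₂ (z + τ / 2) τ := by
  rw [theta₂_eq, thetaShift_eq]
  congr 2 <;> ring_nf

variable {τ : ℂ} (hτ : 0 < τ.im)
include hτ

lemma differentiableAt_theta₃ (z : ℂ) : DifferentiableAt ℂ (theta₃ z) τ := by
  rw [show theta₃ z = jacobiTheta₂ z from funext (theta₃_eq_jacobiTheta₂ z)]
  exact differentiableAt_jacobiTheta₂_snd z hτ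

lemma differentiableAt_theta₂ (z : ℂ) : DifferentiableAt ℂ (theta₂ z) τ := by
  rw [show theta₂ z = _ from funext (theta₂_eq_jacobiTheta₂ z)]
  refine DifferentiableAt.mul (by fun_prop) ?_
  have h := (hasFDerivAt_jacobiTheta₂ (z + τ / 2) hτ).differentiableAt
  exact DifferentiableAt.comp (f := fun τ : ℂ => (z + τ / 2, τ)) τ h (by fun_prop)

lemma differentiableAt_null₂ : DifferentiableAt ℂ null₂ τ := differentiableAt_theta₂ hτ 0

lemma differentiableAt_null₃ : DifferentiableAt ℂ null₃ τ := differentiableAt_theta₃ hτ 0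

lemma differentiableAt_null₄ : DifferentiableAt ℂ null₄ τ := by
  rw [show null₄ = _ from funext fun τ => (theta₃_half τ).symm]
  exact differentiableAt_theta₃ hτ _

lemma differentiableAt_sixth₃ : DifferentiableAt ℂ sixth₃ τ := differentiableAt_theta₃ hτ _

lemma differentiableAt_sixth₄ : DifferentiableAt ℂ sixth₄ τ := by
  rw [show sixth₄ = _ from funext fun τ => (theta₃_third τ).symm]
  exact differentiableAt_theta₃ hτ _

lemma differentiableAt_pFun : DifferentiableAt ℂ pFun τ :=
  (differentiableAt_null₄ hτ).div (differentiableAt_null₃ hτ) (null₃_ne_zero hτ)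

lemma xFun_eventuallyEq : xFun =ᶠ[𝓝 τ] fun τ => sixth₄ τ / sixth₃ τ := by
  filter_upwards [halfPlane_mem_nhds hτ] with τ hτ using xFun_eq hτ

lemma differentiableAt_xFun : DifferentiableAt ℂ xFun τ :=
  ((differentiableAt_sixth₄ hτ).div (differentiableAt_sixth₃ hτ)
    (sixth₃_ne_zero hτ)).congr_of_eventuallyEq (xFun_eventuallyEq hτ)

lemma differentiableAt_yFun : DifferentiableAt ℂ yFun τ := by
  have h1 := differentiableAt_xFun hτ
  have h2 := differentiableAt_pFun hτ
  exact ((h1.pow 4).sub ((h1.const_mul 4).mul h2)).sub_const 1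

end Holomorphy

/-! ### Theta constants under τ ↦ −1/τ -/

section Inversion

variable {τ : ℂ} (hτ : 0 < τ.im)
include hτ

lemma ne_zero_of_im_pos : τ ≠ 0 := by
  rintro rfl
  simp at hτ

lemma im_neg_one_div_pos : 0 < (-1 / τ).im := by
  rw [neg_div, one_div, neg_im, inv_im, neg_div, neg_neg]
  exact div_pos hτ (normSq_pos.2 (ne_zero_of_im_pos hτ))

/-- The automorphy factor of weight one half. -/
lemma sqrt_factor_ne_zero : (-I * τ) ^ (1 / 2 : ℂ) ≠ 0 := by
  rw [Ne, cpow_eq_zero_iff]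
  simp [ne_zero_of_im_pos hτ]

omit hτ in
lemma sqrt_factor_sq : ((-I * τ) ^ (1 / 2 : ℂ)) ^ 2 = -I * τ := by
  rw [← cpow_nat_mul]
  norm_num

omit hτ in
lemma sqrt_factor_pow_four : ((-I * τ) ^ (1 / 2 : ℂ)) ^ 4 = -τ ^ 2 := by
  rw [show (4 : ℕ) = 2 * 2 by norm_num, pow_mul, sqrt_factor_sq, mul_pow]
  simp

lemma null₃_inversion : null₃ (-1 / τ) = (-I * τ) ^ (1 / 2 : ℂ) * null₃ τ := by
  have h := jacobiTheta₂_functional_equation 0 τ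
  have h0 := sqrt_factor_ne_zero hτ
  rw [null₃, null₃, theta₃_eq_jacobiTheta₂, theta₃_eq_jacobiTheta₂, h, zero_div, ← mul_assoc,
    ← mul_assoc, mul_one_div_cancel h0]
  simp

lemma null₂_inversion : null₂ (-1 / τ) = (-I * τ) ^ (1 / 2 : ℂ) * null₄ τ := by
  have h := jacobiTheta₂_functional_equation (1 / 2) τ
  have h0 := sqrt_factor_ne_zero hτ
  rw [← theta₃_half, null₂, theta₂_eq_jacobiTheta₂, theta₃_eq_jacobiTheta₂, h, ← mul_assoc,
    ← mul_assoc, mul_one_div_cancel h0, one_mul, ← jacobiTheta₂_neg_left]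
  congr 2 <;> ring

lemma null₄_inversion : null₄ (-1 / τ) = (-I * τ) ^ (1 / 2 : ℂ) * null₂ τ := by
  have h := jacobiTheta₂_functional_equation (τ / 2) τ
  have h0 := sqrt_factor_ne_zero hτ
  have h1 := ne_zero_of_im_pos hτ
  rw [← theta₃_half, null₂, theta₂_eq_jacobiTheta₂, theta₃_eq_jacobiTheta₂, zero_add, h,
    show τ / 2 / τ = 1 / 2 by field_simp]
  have h2 : cexp (Real.pi * I * τ / 4 + Real.pi * I * 0) * cexp (-Real.pi * I * (τ / 2) ^ 2 / τ) = 1 := by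
    rw [← Complex.exp_add, Complex.exp_eq_one_iff]
    exact ⟨0, by field_simp; ring⟩
  linear_combination -jacobiTheta₂ (1 / 2) (-1 / τ) *
    ((-I * τ) ^ (1 / 2 : ℂ) * (1 / (-I * τ) ^ (1 / 2 : ℂ)) * h2 + mul_one_div_cancel h0)

end Inversion

/-! ### Level-one cusp forms of small weight -/

section LevelOne

open UpperHalfPlane ModularForm CuspForm

lemma tendsto_coe_atImInfty : Tendsto ((↑) : ℍ → ℂ) atImInfty atInfty :=
  tendsto_comap_iff.2 tendsto_comap

/-- The cusp form of level one defined by a holomorphic function on the upper half-plane with the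
two functional equations of weight `k` and with limit zero at `i∞`. -/
def cuspFormOfEquations (k : ℤ) (F : ℂ → ℂ) (hF : DifferentiableOn ℂ F halfPlane)
    (hT : ∀ τ : ℂ, 0 < τ.im → F (τ + 1) = F τ) (hS : ∀ τ : ℂ, 0 < τ.im → F (-1 / τ) = τ ^ k * F τ)
    (h0 : Tendsto F atInfty (𝓝 0)) : CuspForm 𝒮ℒ k :=
  have hS' : (fun τ : ℍ => F τ) ∣[k] ModularGroup.S = fun τ : ℍ => F τ := by
    ext z
    rw [SL_slash_apply, ModularGroup.denom_S, UpperHalfPlane.modular_S_smul]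
    have := hS z z.2
    rw [neg_div, one_div] at this
    simp only [← inv_neg] at this ⊢
    rw [this, mul_comm, ← mul_assoc, ← zpow_add₀ z.ne_zero, neg_add_cancel, zpow_zero, one_mul]
  have hT' : (fun τ : ℍ => F τ) ∣[k] ModularGroup.T = fun τ : ℍ => F τ := by
    ext z
    have h1 : denom ModularGroup.T z = 1 := by
      rw [ModularGroup.denom_apply]
      simp [ModularGroup.T]
    rw [SL_slash_apply, UpperHalfPlane.modular_T_smul, h1]
    have := hT z z.2
    simp [add_comm (1 : ℂ), this]
  { toFun := fun τ => F τ
    slash_action_eq' := by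
      rintro A ⟨A, rfl⟩
      exact SlashInvariantForm.slash_action_generators_SL2Z hS' hT' A
    holo' := by
      rw [UpperHalfPlane.mdifferentiable_iff]
      refine hF.congr fun z hz => ?_
      simp [ofComplex_apply_of_im_pos hz]
    zero_at_cusps' := by
      intro c hc
      rw [Subgroup.IsArithmetic.isCusp_iff_isCusp_SL2Z] at hc
      rw [OnePoint.isZeroAt_iff_forall_SL2Z hc]
      intro γ _
      have := SlashInvariantForm.slash_action_generators_SL2Z hS' hT' γ
      refine Eq.mpr (congrArg IsZeroAtImInfty this) ?_
      exact h0.comp tendsto_coe_atImInfty }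

lemma cuspFormOfEquations_apply (k : ℤ) (F : ℂ → ℂ) (hF : DifferentiableOn ℂ F halfPlane)
    (hT : ∀ τ : ℂ, 0 < τ.im → F (τ + 1) = F τ) (hS : ∀ τ : ℂ, 0 < τ.im → F (-1 / τ) = τ ^ k * F τ)
    (h0 : Tendsto F atInfty (𝓝 0)) (τ : ℍ) : cuspFormOfEquations k F hF hT hS h0 τ = F τ := rfl

/-- This is how differential identities are proved below: the difference of the two sides only has
to satisfy the two functional equations and to vanish at i∞. -/
lemma eq_zero_of_weight_lt_twelve {k : ℤ} (hk : k < 12) {F : ℂ → ℂ}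
    (hF : DifferentiableOn ℂ F halfPlane)
    (hT : ∀ τ : ℂ, 0 < τ.im → F (τ + 1) = F τ) (hS : ∀ τ : ℂ, 0 < τ.im → F (-1 / τ) = τ ^ k * F τ)
    (h0 : Tendsto F atInfty (𝓝 0)) {τ : ℂ} (hτ : 0 < τ.im) : F τ = 0 := by
  have h := rank_zero_iff_forall_zero.1 (CuspForm.rank_eq_zero_of_weight_lt_twelve hk)
    (cuspFormOfEquations k F hF hT hS h0)
  have h1 := cuspFormOfEquations_apply k F hF hT hS h0 ⟨τ, hτ⟩
  rw [h] at h1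
  exact h1.symm

lemma exists_eq_mul_eta {F : ℂ → ℂ}
    (hF : DifferentiableOn ℂ F halfPlane)
    (hT : ∀ τ : ℂ, 0 < τ.im → F (τ + 1) = F τ)
    (hS : ∀ τ : ℂ, 0 < τ.im → F (-1 / τ) = τ ^ (12 : ℤ) * F τ)
    (h0 : Tendsto F atInfty (𝓝 0)) :
    ∃ c : ℂ, ∀ τ : ℂ, 0 < τ.im → F τ = c * ModularForm.eta τ ^ 24 := by
  obtain ⟨c, hc⟩ := exists_smul_discriminant_of_weight_eq_twelve
    (cuspFormOfEquations 12 F hF hT hS h0)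
  refine ⟨c, fun τ hτ => ?_⟩
  have h1 := cuspFormOfEquations_apply 12 F hF hT hS h0 ⟨τ, hτ⟩
  rw [← hc] at h1
  exact h1.symm

end LevelOne

/-! ### Rigidity of holomorphic roots -/

section Rigidity

lemma differentiableOn_halfPlane {f : ℂ → ℂ} (hf : ∀ τ : ℂ, 0 < τ.im → DifferentiableAt ℂ f τ) :
    DifferentiableOn ℂ f halfPlane := fun τ hτ => (hf τ hτ).differentiableWithinAt

lemma eqOn_of_eventuallyEq {f g : ℂ → ℂ} (hf : DifferentiableOn ℂ f halfPlane)
    (hg : DifferentiableOn ℂ g halfPlane) {τ₀ : ℂ} (hτ₀ : 0 < τ₀.im) (h : f =ᶠ[𝓝 τ₀] g)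
    {τ : ℂ} (hτ : 0 < τ.im) : f τ = g τ :=
  (hf.analyticOnNhd isOpen_halfPlane).eqOn_of_preconnected_of_eventuallyEq
    (hg.analyticOnNhd isOpen_halfPlane) isPreconnected_halfPlane hτ₀ h hτ

/-- Two holomorphic roots of an equation agree if they agree at a point where the divided difference
of the equation does not vanish. -/
lemma eqOn_of_mul_eq_zero {f g D : ℂ → ℂ} (hf : DifferentiableOn ℂ f halfPlane)
    (hg : DifferentiableOn ℂ g halfPlane) {τ₀ : ℂ} (hτ₀ : 0 < τ₀.im) (hD : ContinuousAt D τ₀)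
    (hD0 : D τ₀ ≠ 0) (h : ∀ τ : ℂ, 0 < τ.im → (f τ - g τ) * D τ = 0)
    {τ : ℂ} (hτ : 0 < τ.im) : f τ = g τ := by
  refine eqOn_of_eventuallyEq hf hg hτ₀ ?_ hτ
  filter_upwards [hD.eventually_ne hD0, halfPlane_mem_nhds hτ₀] with σ h1 h2
  exact sub_eq_zero.1 ((mul_eq_zero.1 (h σ h2)).resolve_right h1)

/-- The constant ζ is read off at the point i. The cofactor of f − ζg in fⁿ − (ζg)ⁿ takes the value
n f(i)ⁿ⁻¹ ≠ 0 there, so f = ζg near i and hence everywhere. -/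
lemma exists_eq_const_mul {f g : ℂ → ℂ} (hf : DifferentiableOn ℂ f halfPlane)
    (hg : DifferentiableOn ℂ g halfPlane) (hg0 : ∀ τ : ℂ, 0 < τ.im → g τ ≠ 0) {n : ℕ} (hn : n ≠ 0)
    (h : ∀ τ : ℂ, 0 < τ.im → f τ ^ n = g τ ^ n) :
    ∃ ζ : ℂ, ζ ^ n = 1 ∧ ∀ τ : ℂ, 0 < τ.im → f τ = ζ * g τ := by
  have hI : 0 < I.im := by simp
  have hζ : (f I / g I) ^ n = 1 := by
    rw [div_pow, h I hI, div_self (pow_ne_zero _ (hg0 I hI))]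
  have hcont {k : ℂ → ℂ} (hk : DifferentiableOn ℂ k halfPlane) : ContinuousAt k I :=
    (hk.differentiableAt (halfPlane_mem_nhds hI)).continuousAt
  refine ⟨f I / g I, hζ, fun τ hτ => ?_⟩
  refine eqOn_of_mul_eq_zero (f := f) (g := fun τ => f I / g I * g τ) hf (hg.const_mul _) hI
    (D := fun τ => ∑ i ∈ Finset.range n, f τ ^ i * (f I / g I * g τ) ^ (n - 1 - i)) ?_ ?_ ?_ hτ
  · have h1 := hcont hf
    have h2 := hcont hg
    exact tendsto_finsetSum _ fun i _ => (h1.pow i).mul ((continuousAt_const.mul h2).pow _)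
  · simp only [div_mul_cancel₀ _ (hg0 I hI), ← pow_add]
    rw [Finset.sum_congr rfl (g := fun _ => f I ^ (n - 1))]
    · rw [Finset.sum_const, Finset.card_range, nsmul_eq_mul]
      refine mul_ne_zero (by exact_mod_cast hn) (pow_ne_zero _ fun h0 => ?_)
      have := h I hI
      rw [h0, zero_pow hn] at this
      exact pow_ne_zero _ (hg0 I hI) this.symm
    · intro i hi
      rw [Nat.add_sub_cancel' (by have := Finset.mem_range.1 hi; omega)]
  · intro σ hσ
    rw [mul_comm, (Commute.all _ _).geom_sum₂_mul, mul_pow, hζ, one_mul, h σ hσ, sub_self]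

end Rigidity

/-- By Cauchy's estimate, the derivative tends to zero at `i∞` if the function has a limit. -/
lemma tendsto_deriv_atInfty {f : ℂ → ℂ} (hf : ∀ τ : ℂ, 0 < τ.im → DifferentiableAt ℂ f τ) {c : ℂ}
    (h : Tendsto f atInfty (𝓝 c)) : Tendsto (deriv f) atInfty (𝓝 0) := by
  rw [Metric.tendsto_nhds]
  intro ε hε
  have h1 := (Metric.tendsto_nhds.1 h) (ε / 2) (by positivity)
  obtain ⟨M, hM⟩ := eventually_atInfty.1 h1
  -- The margin 2 keeps the closed unit disc about τ above both M and 0.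
  refine eventually_atInfty.2 ⟨max M 0 + 2, fun τ hτ => ?_⟩
  have him {σ : ℂ} (hσ : σ ∈ Metric.closedBall τ 1) : max M 0 < σ.im := by
    have : |σ.im - τ.im| ≤ 1 := by
      rw [← sub_im]
      exact (abs_im_le_norm _).trans (mem_closedBall_iff_norm.1 hσ)
    have := abs_le.1 this
    linarith
  have h2 := norm_deriv_le_of_forall_mem_sphere_norm_le (f := fun σ => f σ - c) (c := τ) (R := 1)
    (C := ε / 2) one_pos ?_ ?_
  · rw [deriv_sub_const] at h2
    rw [dist_zero_right]
    linarith
  · refine DifferentiableOn.diffContOnCl fun σ hσ => ?_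
    rw [closure_ball _ one_ne_zero] at hσ
    exact ((hf σ ((le_max_right _ _).trans_lt (him hσ))).sub_const c).differentiableWithinAt
  · intro σ hσ
    have := hM σ ((le_max_left _ _).trans_lt (him (Metric.sphere_subset_closedBall hσ)))
    rw [dist_eq_norm] at this
    exact this.le

lemma tendsto_nomeQuarter : Tendsto nomeQuarter atInfty (𝓝 0) := by
  have := tendsto_cexp_atInfty (c := Real.pi / 4) (by positivity)
  refine this.congr fun τ => ?_
  rw [nomeQuarter]
  congr 1
  push_cast
  ring

/-! ### Jacobi's identity and the eta quotient for x -/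

section Eta

lemma tendsto_eta : Tendsto (fun τ => ModularForm.eta τ / cexp (Real.pi * I * τ / 12)) atInfty
    (𝓝 1) := by
  have htprod : Tendsto (fun q : ℂ ↦ ∏' (n : ℕ), (1 - q ^ (n + 1))) (𝓝 0) (𝓝 1) := by
    have := tendsto_tprod_one_add_of_dominated_convergence (𝓕 := 𝓝 0) (g := 0)
      (f := fun (q : ℂ) (n : ℕ) ↦ -q ^ (n + 1)) (bound := fun n ↦ (1 / 2 : ℝ) ^ (n + 1))
    simp only [Pi.zero_apply, norm_neg, norm_pow, add_zero, tprod_one] at this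
    simp_rw [sub_eq_add_neg]
    refine this
      (by simpa only [pow_succ'] using (summable_geometric_of_abs_lt_one (by norm_num)).mul_left _)
      (fun k ↦ by simpa using ((continuous_pow (M := ℂ) (k + 1)).tendsto 0).neg) ?_
    filter_upwards [Metric.ball_mem_nhds (0 : ℂ) (by norm_num : (0 : ℝ) < 1 / 2)] with q hq k
    exact pow_le_pow_left₀ (norm_nonneg _) (mem_ball_zero_iff.mp hq).le _
  have h := htprod.comp (tendsto_cexp_atInfty (c := 2 * Real.pi) (by positivity))
  refine h.congr fun τ => ?_
  have h1 : (cexp (Real.pi * I * τ / 12)) = Function.Periodic.qParam 24 τ := by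
    rw [Function.Periodic.qParam]
    congr 1
    push_cast
    ring
  rw [ModularForm.eta, h1, mul_div_cancel_left₀ _ (by rw [← h1]; exact Complex.exp_ne_zero _)]
  simp only [Function.comp_apply, ModularForm.eta_q_eq_pow]
  congr 1
  funext n
  congr 3
  push_cast
  ring

lemma eta_ne_zero' {τ : ℂ} (hτ : 0 < τ.im) : ModularForm.eta τ ≠ 0 := ModularForm.eta_ne_zero hτ

lemma differentiableAt_eta {τ : ℂ} (hτ : 0 < τ.im) : DifferentiableAt ℂ ModularForm.eta τ :=
  ModularForm.differentiableAt_eta_of_mem_upperHalfPlaneSet hτ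

lemma tendsto_null_mul :
    Tendsto (fun τ => null₂ τ * null₃ τ * null₄ τ / nomeQuarter τ) atInfty (𝓝 2) := by
  have := (tendsto_null₂.mul tendsto_null₃).mul tendsto_null₄
  rw [mul_one, mul_one] at this
  refine this.congr fun τ => ?_
  ring

lemma differentiableAt_null_mul {τ : ℂ} (hτ : 0 < τ.im) :
    DifferentiableAt ℂ (fun τ => null₂ τ * null₃ τ * null₄ τ) τ :=
  ((differentiableAt_null₂ hτ).mul (differentiableAt_null₃ hτ)).mul (differentiableAt_null₄ hτ)

lemma tendsto_eta_cube :
    Tendsto (fun τ => ModularForm.eta τ ^ 3 / nomeQuarter τ) atInfty (𝓝 1) := by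
  have := tendsto_eta.pow 3
  rw [one_pow] at this
  refine this.congr fun τ => ?_
  rw [div_pow, ← Complex.exp_nat_mul, nomeQuarter]
  congr 2
  push_cast
  ring

/-- Jacobi's identity `θ₂ θ₃ θ₄ = 2 η³`. -/
lemma null_mul_eq_eta {τ : ℂ} (hτ : 0 < τ.im) :
    null₂ τ * null₃ τ * null₄ τ = 2 * ModularForm.eta τ ^ 3 := by
  -- The eighth power has weight 12 and is free of the root of unity that ϑ₂ acquires under
  -- translation, so it is a multiple of η²⁴.
  obtain ⟨c, hc⟩ := exists_eq_mul_eta (F := fun τ => (null₂ τ * null₃ τ * null₄ τ) ^ 8)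
    (differentiableOn_halfPlane fun τ hτ => (differentiableAt_null_mul hτ).pow 8)
    (fun τ hτ => by
      have h1 : cexp (Real.pi * I / 4) ^ 8 = 1 := by
        rw [← Complex.exp_nat_mul, Complex.exp_eq_one_iff]
        exact ⟨1, by push_cast; ring⟩
      simp only [null₂_add_one, null₃_add_one, null₄_add_one, mul_pow, h1]
      ring)
    (fun τ hτ => by
      simp only [null₂_inversion hτ, null₃_inversion hτ, null₄_inversion hτ]
      calc _ = (((-I * τ) ^ (1 / 2 : ℂ)) ^ 4) ^ 6 * (null₂ τ * null₃ τ * null₄ τ) ^ 8 := by ring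
        _ = _ := by
          rw [sqrt_factor_pow_four]
          norm_cast
          ring)
    (by
      have := (tendsto_null_mul.mul tendsto_nomeQuarter).pow 8
      rw [mul_zero, zero_pow (by norm_num)] at this
      refine this.congr fun τ => ?_
      rw [div_mul_cancel₀ _ (nomeQuarter_ne_zero τ)])
  -- Leading coefficients at i∞ fix the constant; the same comparison fixes the eighth root of unity
  -- ζ below.
  have hc' : c = 2 ^ 8 := by
    have h1 := tendsto_null_mul.pow 8
    have h2 := (tendsto_eta_cube.pow 8).const_mul c
    rw [one_pow, mul_one] at h2
    refine tendsto_nhds_unique (h2.congr' ?_) h1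
    filter_upwards [eventually_im_atInfty 0] with τ hτ
    rw [div_pow, div_pow, hc τ hτ]
    ring
  obtain ⟨ζ, -, hζ⟩ := exists_eq_const_mul (f := fun τ => null₂ τ * null₃ τ * null₄ τ)
    (g := fun τ => 2 * ModularForm.eta τ ^ 3) (n := 8)
    (differentiableOn_halfPlane fun τ hτ => differentiableAt_null_mul hτ)
    (differentiableOn_halfPlane fun τ hτ => ((differentiableAt_eta hτ).pow 3).const_mul 2)
    (fun τ hτ => mul_ne_zero two_ne_zero (pow_ne_zero _ (eta_ne_zero' hτ))) (by norm_num)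
    (fun τ hτ => by
      rw [hc τ hτ, hc']
      ring)
  have hζ' : ζ = 1 := by
    have h1 := tendsto_null_mul
    have h2 := (tendsto_eta_cube.const_mul (ζ * 2))
    have h3 : ζ * 2 * 1 = 2 := by
      refine tendsto_nhds_unique (h2.congr' ?_) h1
      filter_upwards [eventually_im_atInfty 0] with τ hτ
      rw [hζ τ hτ]
      ring
    linear_combination h3 / 2
  rw [hζ τ hτ, hζ', one_mul]

lemma xFun_eq_eta {τ : ℂ} (hτ : 0 < τ.im) : xFun τ = ModularForm.eta τ ^ 3 * theta₂ (1 / 3) τ /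
    (theta₁ (1 / 6) τ ^ 2 * theta₃ (1 / 6) τ ^ 2) := by
  have h1 := sixth₁_ne_zero hτ
  have h3 := sixth₃_ne_zero hτ
  have h := null_mul_eq_eta hτ
  rw [null_mul_eq hτ] at h
  change _ = _ / (sixth₁ τ ^ 2 * sixth₃ τ ^ 2)
  rw [xFun_eq hτ, theta₂_third]
  field_simp
  linear_combination h / 2

end Eta

/-! ### The derivative of p -/

section ModulusDerivative

lemma nomeQuarter_four_mul (τ : ℂ) : nomeQuarter (4 * τ) = nome τ := by
  rw [nomeQuarter, nome]
  congr 1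
  ring

/-- Two doublings give ϑ₃² − ϑ₄² = 2ϑ₂(2τ)² = 4ϑ₃(4τ)ϑ₂(4τ), and the leading term of ϑ₂(4τ) is twice
the nome of τ. -/
lemma tendsto_null₃_sub_null₄ :
    Tendsto (fun τ => (null₃ τ - null₄ τ) / nome τ) atInfty (𝓝 4) := by
  have h4 : Tendsto (fun τ : ℂ => 4 * τ) atInfty atInfty := by
    simpa using tendsto_const_mul_atInfty (c := 4) (by norm_num)
  have h1 := (((tendsto_null₃.comp h4).const_mul 4).mul (tendsto_null₂.comp h4)).div
    (tendsto_null₃.add tendsto_null₄) (by norm_num)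
  rw [show (4 * 1 * 2 / (1 + 1) : ℂ) = 4 by norm_num] at h1
  have h2 : ∀ᶠ τ in atInfty, null₃ τ + null₄ τ ≠ 0 :=
    (tendsto_null₃.add tendsto_null₄).eventually_ne (by norm_num)
  refine h1.congr' ?_
  filter_upwards [h2, eventually_im_atInfty 0] with τ h2 hτ
  have h3 : (null₃ τ - null₄ τ) * (null₃ τ + null₄ τ) = 4 * null₃ (4 * τ) * null₂ (4 * τ) := by
    have e1 := null₂_sq (im_two_mul hτ)
    rw [← mul_assoc, show (2 * 2 : ℂ) = 4 by norm_num] at e1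
    linear_combination null₃_sq hτ - null₄_sq hτ + 2 * e1
  have h5 := nome_ne_zero τ
  simp only [Pi.div_apply, Function.comp_apply, nomeQuarter_four_mul]
  field_simp
  linear_combination -h3

lemma tendsto_pFun : Tendsto pFun atInfty (𝓝 1) := by
  have := tendsto_null₄.div tendsto_null₃ one_ne_zero
  rwa [div_one] at this

lemma tendsto_pFun_sub_one : Tendsto (fun τ => (pFun τ - 1) / nome τ) atInfty (𝓝 (-4)) := by
  have := tendsto_null₃_sub_null₄.neg.div tendsto_null₃ one_ne_zero
  rw [div_one] at this
  refine this.congr' ?_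
  filter_upwards [eventually_im_atInfty 0] with τ hτ
  have h3 := null₃_ne_zero hτ
  have h5 := nome_ne_zero τ
  simp only [Pi.div_apply]
  rw [pFun_eq]
  field_simp
  ring

lemma hasDerivAt_nome (τ : ℂ) : HasDerivAt nome (Real.pi * I * nome τ) τ := by
  have := ((hasDerivAt_id τ).const_mul (Real.pi * I : ℂ)).cexp
  refine this.congr_deriv ?_
  simp only [id, nome]
  ring

lemma differentiable_nome : Differentiable ℂ nome := fun τ => (hasDerivAt_nome τ).differentiableAt

/-- Differentiation of an expansion in the nome. -/
lemma tendsto_deriv_div_nome {f : ℂ → ℂ} (hf : ∀ τ : ℂ, 0 < τ.im → DifferentiableAt ℂ f τ) {b c : ℂ}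
    (h : Tendsto (fun τ => (f τ - b) / nome τ) atInfty (𝓝 c)) :
    Tendsto (fun τ => deriv f τ / nome τ) atInfty (𝓝 (Real.pi * I * c)) := by
  have h1 := tendsto_deriv_atInfty (f := fun τ => (f τ - b) / nome τ)
    (fun τ hτ => ((hf τ hτ).sub_const b).div (differentiable_nome τ) (nome_ne_zero τ)) h
  have h2 := h1.add (h.const_mul (Real.pi * I))
  rw [zero_add] at h2
  refine h2.congr' ?_
  filter_upwards [eventually_im_atInfty 0] with τ hτ
  have h5 := nome_ne_zero τ
  have := (((hf τ hτ).hasDerivAt.sub_const b).div (hasDerivAt_nome τ) h5).deriv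
  rw [show (fun τ => (f τ - b) / nome τ) = (fun τ => f τ - b) / nome from rfl, this]
  field_simp
  ring

lemma pFun_add_one (τ : ℂ) : pFun (τ + 1) = (pFun τ)⁻¹ := by
  rw [pFun_eq, pFun_eq, null₃_add_one, null₄_add_one, inv_div]

lemma pFun_inversion {τ : ℂ} (hτ : 0 < τ.im) : pFun (-1 / τ) = null₂ τ / null₃ τ := by
  rw [pFun_eq, null₄_inversion hτ, null₃_inversion hτ, mul_div_mul_left _ _ (sqrt_factor_ne_zero hτ)]

lemma pFun_inversion_pow_four {τ : ℂ} (hτ : 0 < τ.im) : pFun (-1 / τ) ^ 4 = 1 - pFun τ ^ 4 := by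
  rw [pFun_inversion hτ, one_sub_pFun_pow_four hτ, div_pow]

lemma hasDerivAt_neg_one_div {τ : ℂ} (hτ : 0 < τ.im) :
    HasDerivAt (fun τ : ℂ => -1 / τ) (1 / τ ^ 2) τ := by
  have h0 := ne_zero_of_im_pos hτ
  have := (hasDerivAt_inv h0).const_mul (-1)
  refine this.congr_deriv ?_ |>.congr_of_eventuallyEq (.of_forall fun σ => ?_)
  · field_simp
  · simp [div_eq_mul_inv]

lemma null₂_pow_four_add_one (τ : ℂ) : null₂ (τ + 1) ^ 4 = -null₂ τ ^ 4 := by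
  rw [null₂_add_one, mul_pow, ← Complex.exp_nat_mul,
    show ((4 : ℕ) : ℂ) * (Real.pi * I / 4) = Real.pi * I by push_cast; ring, Complex.exp_pi_mul_I]
  ring

/-- `p' = -(π i / 4) ϑ₂⁴ p`. -/
lemma deriv_pFun {τ : ℂ} (hτ : 0 < τ.im) :
    deriv pFun τ = -(Real.pi * I / 4) * null₂ τ ^ 4 * pFun τ := by
  have hpd : ∀ τ : ℂ, 0 < τ.im → DifferentiableAt ℂ pFun τ := fun τ hτ => differentiableAt_pFun hτ
  have hne : ∀ τ : ℂ, 0 < τ.im → pFun τ * null₂ τ ^ 4 ≠ 0 := fun τ hτ =>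
    mul_ne_zero (pFun_ne_zero hτ) (pow_ne_zero _ (null₂_ne_zero hτ))
  -- p'/(pϑ₂⁴) has weight 0 and tends to −πi/4 at i∞; with this limit removed it is a cusp form of
  -- weight 0.
  have key := eq_zero_of_weight_lt_twelve (k := 0) (by norm_num)
    (F := fun τ => deriv pFun τ / (pFun τ * null₂ τ ^ 4) + Real.pi * I / 4) ?_ ?_ ?_ ?_ hτ
  · have h := hne τ hτ
    have h1 := pFun_ne_zero hτ
    have h2 := null₂_ne_zero hτ
    field_simp at key ⊢
    linear_combination key
  · refine DifferentiableOn.add_const _ (DifferentiableOn.div ?_ ?_ hne)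
    · exact (differentiableOn_halfPlane hpd).deriv isOpen_halfPlane
    · exact differentiableOn_halfPlane fun τ hτ =>
        (hpd τ hτ).mul ((differentiableAt_null₂ hτ).pow 4)
  · intro τ hτ
    have h1 := pFun_ne_zero hτ
    have h2 := null₂_ne_zero hτ
    have hd : deriv pFun (τ + 1) = -deriv pFun τ / pFun τ ^ 2 := by
      rw [← deriv_comp_add_const, show (fun x => pFun (x + 1)) = pFun⁻¹ from
        funext fun x => pFun_add_one x]
      exact ((hpd τ hτ).hasDerivAt.inv h1).deriv
    simp only [hd, pFun_add_one, null₂_pow_four_add_one]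
    field_simp
  · intro τ hτ
    have h0 := ne_zero_of_im_pos hτ
    have hτ' := im_neg_one_div_pos hτ
    have h1 := pFun_ne_zero hτ
    have h1' := pFun_ne_zero hτ'
    have h2 := null₂_ne_zero hτ
    have h3 := null₃_ne_zero hτ
    have h4 := null₄_ne_zero hτ
    -- The value of p' at −1/τ is found by differentiating p(−1/τ)⁴ = 1 − p(τ)⁴.
    have e1 := ((hpd _ hτ').hasDerivAt.comp τ (hasDerivAt_neg_one_div hτ)).pow 4
    have e2 := ((hpd _ hτ).hasDerivAt.pow 4).const_sub 1
    have e3 := (e1.congr_of_eventuallyEq (f₁ := fun τ => 1 - pFun τ ^ 4) ?_).unique e2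
    · have h5 : pFun (-1 / τ) ^ 4 = null₂ τ ^ 4 / null₃ τ ^ 4 := by
        rw [pFun_inversion hτ, div_pow]
      have h6 : pFun τ ^ 4 = null₄ τ ^ 4 / null₃ τ ^ 4 := by rw [pFun_eq, div_pow]
      have h7 : null₂ (-1 / τ) ^ 4 = -τ ^ 2 * null₄ τ ^ 4 := by
        rw [null₂_inversion hτ, mul_pow, sqrt_factor_pow_four]
      have e4 : deriv pFun (-1 / τ) * pFun (-1 / τ) ^ 3 = -τ ^ 2 * (pFun τ ^ 3 * deriv pFun τ) := by
        simp only [Function.comp_apply] at e3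
        field_simp at e3
        push_cast at e3
        rw [neg_div]
        linear_combination e3
      simp only [h7, zpow_zero, one_mul]
      congr 1
      have e5 : deriv pFun (-1 / τ) / (pFun (-1 / τ) * (-τ ^ 2 * null₄ τ ^ 4)) =
          deriv pFun (-1 / τ) * pFun (-1 / τ) ^ 3 /
            (pFun (-1 / τ) ^ 4 * (-τ ^ 2 * null₄ τ ^ 4)) := by
        field_simp
      have e6 : deriv pFun τ / (pFun τ * null₂ τ ^ 4) =
          (pFun τ ^ 3 * deriv pFun τ) / (pFun τ ^ 4 * null₂ τ ^ 4) := by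
        field_simp
      rw [e5, e6, e4, h5, h6]
      field_simp
    · filter_upwards [halfPlane_mem_nhds hτ] with σ hσ
      simp only [Pi.pow_apply, Function.comp_apply, pFun_inversion_pow_four hσ]
  · have h1 := tendsto_deriv_div_nome hpd tendsto_pFun_sub_one
    have h2 := ((h1.div (tendsto_pFun.mul (tendsto_null₂.pow 4)) (by norm_num)).add_const
      (Real.pi * I / 4 : ℂ))
    rw [show (Real.pi * I * -4 / (1 * 2 ^ 4) + Real.pi * I / 4 : ℂ) = 0 by ring] at h2
    refine h2.congr fun τ => ?_
    have := nome_ne_zero τ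
    simp only [Pi.div_apply, div_pow, nomeQuarter_pow_four]
    field_simp

end ModulusDerivative

/-! ### The logarithmic derivative of η -/

section EtaLogDerivative

/-- The logarithmic derivative of `η`. -/
def etaLog (τ : ℂ) : ℂ := logDeriv ModularForm.eta τ

open EisensteinSeries UpperHalfPlane ModularForm

lemma etaLog_eq (τ : ℍ) : etaLog τ = Real.pi * Complex.I / 12 * E2 τ := ModularForm.logDeriv_eta_eq_E2 τ

lemma differentiableAt_etaLog {τ : ℂ} (hτ : 0 < τ.im) : DifferentiableAt ℂ etaLog τ := by
  have h1 : DifferentiableOn ℂ ModularForm.eta halfPlane :=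
    differentiableOn_halfPlane fun τ hτ => differentiableAt_eta hτ
  have h2 : DifferentiableOn ℂ (deriv ModularForm.eta / ModularForm.eta) halfPlane :=
    (h1.deriv isOpen_halfPlane).div h1 fun τ hτ => eta_ne_zero' hτ
  exact h2.differentiableAt (halfPlane_mem_nhds hτ)

lemma etaLog_add_one {τ : ℂ} (hτ : 0 < τ.im) : etaLog (τ + 1) = etaLog τ := by
  have h := congrFun (E2_slash_action ModularGroup.T) ⟨τ, hτ⟩
  have h1 : denom ModularGroup.T (⟨τ, hτ⟩ : ℍ) = 1 := by
    rw [ModularGroup.denom_apply]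
    simp [ModularGroup.T]
  rw [D2_T, smul_zero, sub_zero, SL_slash_apply, UpperHalfPlane.modular_T_smul, h1] at h
  have h2 := etaLog_eq ((1 : ℝ) +ᵥ (⟨τ, hτ⟩ : ℍ))
  have h3 := etaLog_eq ⟨τ, hτ⟩
  simp only [one_zpow, mul_one] at h
  rw [h, ← h3] at h2
  rw [← h2]
  congr 1
  simp [add_comm]

lemma etaLog_inversion {τ : ℂ} (hτ : 0 < τ.im) :
    etaLog (-1 / τ) = τ ^ 2 * etaLog τ + τ / 2 := by
  have h0 := ne_zero_of_im_pos hτ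
  have h := congrFun (E2_slash_action ModularGroup.S) ⟨τ, hτ⟩
  rw [SL_slash_apply, UpperHalfPlane.modular_S_smul, ModularGroup.denom_S, Pi.sub_apply,
    Pi.smul_apply, D2_S, riemannZeta_two] at h
  have h2 := etaLog_eq (UpperHalfPlane.mk (-(⟨τ, hτ⟩ : ℍ) : ℂ)⁻¹ (⟨τ, hτ⟩ : ℍ).im_inv_neg_coe_pos)
  have h3 := etaLog_eq ⟨τ, hτ⟩
  simp only [smul_eq_mul] at h h2 h3
  have hpi : (Real.pi : ℂ) ≠ 0 := by exact_mod_cast Real.pi_ne_zero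
  rw [show -1 / τ = (-τ)⁻¹ by rw [neg_div, one_div, inv_neg], h2, h3]
  have h4 : E2 (UpperHalfPlane.mk (-τ)⁻¹ (⟨τ, hτ⟩ : ℍ).im_inv_neg_coe_pos) =
      τ ^ 2 * (E2 ⟨τ, hτ⟩ - 1 / (2 * (Real.pi ^ 2 / 6)) * (2 * Real.pi * Complex.I / τ)) := by
    rw [← h, zpow_neg]
    field_simp
  rw [h4]
  field_simp
  linear_combination -12 * Complex.I_sq

lemma deriv_etaLog_add_one {τ : ℂ} (hτ : 0 < τ.im) : deriv etaLog (τ + 1) = deriv etaLog τ := by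
  rw [← deriv_comp_add_const]
  refine Filter.EventuallyEq.deriv_eq ?_
  filter_upwards [halfPlane_mem_nhds hτ] with σ hσ using etaLog_add_one hσ

lemma deriv_etaLog_inversion {τ : ℂ} (hτ : 0 < τ.im) : deriv etaLog (-1 / τ) =
    τ ^ 4 * deriv etaLog τ + 2 * τ ^ 3 * etaLog τ + τ ^ 2 / 2 := by
  have h0 := ne_zero_of_im_pos hτ
  have e1 := (differentiableAt_etaLog (im_neg_one_div_pos hτ)).hasDerivAt.comp τ
    (hasDerivAt_neg_one_div hτ)
  have e2 := (((hasDerivAt_pow 2 τ).mul (differentiableAt_etaLog hτ).hasDerivAt).add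
    ((hasDerivAt_id τ).div_const 2))
  have e3 := (e1.congr_of_eventuallyEq (f₁ := fun τ => τ ^ 2 * etaLog τ + τ / 2) ?_).unique e2
  · field_simp at e3
    rw [neg_div]
    linear_combination e3 / 2
  · filter_upwards [halfPlane_mem_nhds hτ] with σ hσ using (etaLog_inversion hσ).symm

lemma tendsto_etaLog : Tendsto etaLog atInfty (𝓝 (Real.pi * Complex.I / 12)) := by
  set c : ℂ := Real.pi * Complex.I / 12
  have hc : (fun τ : ℂ => cexp (Real.pi * Complex.I * τ / 12)) = fun τ => cexp (c * τ) := by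
    funext τ
    congr 1
    ring
  have hE := tendsto_eta
  rw [show (fun τ => ModularForm.eta τ / cexp (Real.pi * Complex.I * τ / 12)) =
    fun τ => ModularForm.eta τ / cexp (c * τ) from funext fun τ => congrArg _ (congrFun hc τ)] at hE
  have hd (τ : ℂ) : HasDerivAt (fun τ : ℂ => cexp (c * τ)) (c * cexp (c * τ)) τ := by
    refine (((hasDerivAt_id τ).const_mul c).cexp).congr_deriv ?_
    simp only [id]
    ring
  have h1 := tendsto_deriv_atInfty (fun τ hτ =>
    (differentiableAt_eta hτ).div (hd τ).differentiableAt (Complex.exp_ne_zero _)) hE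
  have h2 := (h1.div hE one_ne_zero).add_const c
  rw [zero_div, zero_add] at h2
  refine h2.congr' ?_
  filter_upwards [eventually_im_atInfty 0] with τ hτ
  have h3 := eta_ne_zero' hτ
  have h4 := Complex.exp_ne_zero (c * τ)
  have h5 := ((differentiableAt_eta hτ).hasDerivAt.div (hd τ) h4).deriv
  simp only [Pi.div_apply]
  rw [h5, etaLog, logDeriv_apply]
  field_simp
  ring

/-- Ramanujan's differential equation for the quasimodular form of weight two. -/
lemma deriv_etaLog {τ : ℂ} (hτ : 0 < τ.im) : deriv etaLog τ = 2 * etaLog τ ^ 2 +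
    (Real.pi : ℂ) ^ 2 / 144 * (null₂ τ ^ 8 + null₃ τ ^ 8 + null₄ τ ^ 8) := by
  -- The anomalies of E' and 2E² (E = `etaLog`) under inversion cancel, so the difference has weight
  -- 4. At i∞ it tends to −2(πi/12)² = 2π²/144, and the sum of eighth powers tends to 2; hence the
  -- constant.
  have key := eq_zero_of_weight_lt_twelve (k := 4) (by norm_num)
    (F := fun τ => deriv etaLog τ - 2 * etaLog τ ^ 2 -
    (Real.pi : ℂ) ^ 2 / 144 * (null₂ τ ^ 8 + null₃ τ ^ 8 + null₄ τ ^ 8)) ?_ ?_ ?_ ?_ hτ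
  · linear_combination key
  · have h1 := differentiableOn_halfPlane fun τ hτ => differentiableAt_etaLog hτ
    refine ((h1.deriv isOpen_halfPlane).sub ((h1.pow 2).const_mul 2)).sub
      (differentiableOn_halfPlane fun τ hτ => ?_)
    exact ((((differentiableAt_null₂ hτ).pow 8).add ((differentiableAt_null₃ hτ).pow 8)).add
      ((differentiableAt_null₄ hτ).pow 8)).const_mul _
  · intro τ hτ
    have h8 : null₂ (τ + 1) ^ 8 = null₂ τ ^ 8 := by
      rw [show 8 = 4 * 2 by norm_num, pow_mul, null₂_pow_four_add_one]
      ring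
    simp only [deriv_etaLog_add_one hτ, etaLog_add_one hτ, h8, null₃_add_one, null₄_add_one]
    ring
  · intro τ hτ
    have h8 : ((-Complex.I * τ) ^ (1 / 2 : ℂ)) ^ 8 = τ ^ 4 := by
      rw [show 8 = 4 * 2 by norm_num, pow_mul, sqrt_factor_pow_four]
      ring
    simp only [deriv_etaLog_inversion hτ, etaLog_inversion hτ, null₂_inversion hτ,
      null₃_inversion hτ, null₄_inversion hτ, mul_pow, h8]
    norm_cast
    ring
  · have h2 : Tendsto (fun τ => null₂ τ) atInfty (𝓝 0) := by
      have := tendsto_null₂.mul tendsto_nomeQuarter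
      rw [mul_zero] at this
      refine this.congr fun τ => ?_
      rw [div_mul_cancel₀ _ (nomeQuarter_ne_zero τ)]
    have h := ((tendsto_deriv_atInfty (fun τ hτ => differentiableAt_etaLog hτ) tendsto_etaLog).sub
      ((tendsto_etaLog.pow 2).const_mul 2)).sub
      ((((h2.pow 8).add (tendsto_null₃.pow 8)).add (tendsto_null₄.pow 8)).const_mul
        ((Real.pi : ℂ) ^ 2 / 144))
    convert h using 2
    linear_combination (Real.pi : ℂ) ^ 2 / 72 * Complex.I_sq

end EtaLogDerivative

/-! ### Derivatives of the theta constants -/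

section NullDerivatives

variable {τ : ℂ} (hτ : 0 < τ.im)
include hτ

/-- The derivatives of ϑ₄/ϑ₃, of ϑ₂ϑ₃ϑ₄ = 2η³ and of ϑ₃⁴ = ϑ₂⁴ + ϑ₄⁴ give three linear equations for
the three logarithmic derivatives. -/
lemma null_logDeriv_system :
    deriv null₃ τ = (etaLog τ + Real.pi * I / 12 * (null₂ τ ^ 4 - null₄ τ ^ 4)) * null₃ τ ∧
    deriv null₄ τ = (etaLog τ - Real.pi * I / 12 * (2 * null₂ τ ^ 4 + null₄ τ ^ 4)) * null₄ τ ∧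
    deriv null₂ τ = (etaLog τ + Real.pi * I / 12 * (null₂ τ ^ 4 + 2 * null₄ τ ^ 4)) * null₂ τ := by
  have h2 := null₂_ne_zero hτ
  have h3 := null₃_ne_zero hτ
  have h4 := null₄_ne_zero hτ
  have hη := eta_ne_zero' hτ
  have d2 := (differentiableAt_null₂ hτ).hasDerivAt
  have d3 := (differentiableAt_null₃ hτ).hasDerivAt
  have d4 := (differentiableAt_null₄ hτ).hasDerivAt
  have dη := (differentiableAt_eta hτ).hasDerivAt
  set D2 := deriv null₂ τ
  set D3 := deriv null₃ τ
  set D4 := deriv null₄ τ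
  have hE : deriv ModularForm.eta τ = etaLog τ * ModularForm.eta τ := by
    rw [etaLog, logDeriv_apply, div_mul_cancel₀ _ hη]
  rw [hE] at dη
  -- the derivative of `ϑ₄ / ϑ₃`
  have e1 : D4 * null₃ τ - null₄ τ * D3 =
      -(Real.pi * I / 4) * null₂ τ ^ 4 * (null₄ τ * null₃ τ) := by
    have := deriv_pFun hτ
    rw [show pFun = fun τ => null₄ τ / null₃ τ from rfl, (d4.fun_div d3 h3).deriv] at this
    field_simp at this
    linear_combination this / 4
  -- the derivative of `ϑ₂ ϑ₃ ϑ₄ = 2 η³`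
  have e2 : (D2 * null₃ τ + null₂ τ * D3) * null₄ τ + null₂ τ * null₃ τ * D4 =
      3 * etaLog τ * (null₂ τ * null₃ τ * null₄ τ) := by
    have h := ((d2.mul d3).mul d4).unique (((dη.pow 3).const_mul 2).congr_of_eventuallyEq ?_)
    · have := null_mul_eq_eta hτ
      rw [this]
      simp only [Pi.mul_apply] at h
      rw [h]
      push_cast
      ring
    · filter_upwards [halfPlane_mem_nhds hτ] with σ hσ using null_mul_eq_eta hσ
  -- the derivative of `ϑ₃⁴ = ϑ₂⁴ + ϑ₄⁴`
  have e3 : null₃ τ ^ 3 * D3 = null₂ τ ^ 3 * D2 + null₄ τ ^ 3 * D4 := by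
    have h := (d3.pow 4).unique (((d2.pow 4).add (d4.pow 4)).congr_of_eventuallyEq ?_)
    · push_cast at h
      linear_combination h / 4
    · filter_upwards [halfPlane_mem_nhds hτ] with σ hσ using null₃_pow_four hσ
  have hJ := null₃_pow_four hτ
  -- logarithmic derivatives
  obtain ⟨u2, hu2⟩ : ∃ u, D2 = u * null₂ τ := ⟨D2 / null₂ τ, by field_simp⟩
  obtain ⟨u3, hu3⟩ : ∃ u, D3 = u * null₃ τ := ⟨D3 / null₃ τ, by field_simp⟩
  obtain ⟨u4, hu4⟩ : ∃ u, D4 = u * null₄ τ := ⟨D4 / null₄ τ, by field_simp⟩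
  rw [hu2, hu3, hu4] at e2
  rw [hu3, hu4] at e1
  rw [hu2, hu3, hu4] at e3
  rw [hu2, hu3, hu4]
  have f1 : u4 - u3 = -(Real.pi * I / 4) * null₂ τ ^ 4 := by
    refine mul_right_cancel₀ (mul_ne_zero h4 h3) ?_
    linear_combination e1
  have f2 : u2 + u3 + u4 = 3 * etaLog τ := by
    refine mul_right_cancel₀ (mul_ne_zero (mul_ne_zero h2 h3) h4) ?_
    linear_combination e2
  have f3 : u2 - u3 = Real.pi * I / 4 * null₄ τ ^ 4 := by
    refine mul_right_cancel₀ (pow_ne_zero 4 h2) ?_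
    linear_combination -e3 + u3 * hJ - null₄ τ ^ 4 * f1
  refine ⟨?_, ?_, ?_⟩
  · congr 1
    linear_combination (f2 - f1 - f3) / 3
  · congr 1
    linear_combination (f2 + 2 * f1 - f3) / 3
  · congr 1
    linear_combination (f2 - f1 + 2 * f3) / 3

end NullDerivatives

/-! ### First and second derivatives of x -/

section Schwarzian

variable {τ : ℂ} (hτ : 0 < τ.im)

lemma hasDerivAt_pFun (hτ : 0 < τ.im) :
    HasDerivAt pFun (-(Real.pi * I / 4) * null₂ τ ^ 4 * pFun τ) τ := by
  rw [← deriv_pFun hτ]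
  exact (differentiableAt_pFun hτ).hasDerivAt

lemma four_mul_pFun {τ : ℂ} : 4 * xFun τ * pFun τ = xFun τ ^ 4 - yFun τ - 1 := by
  rw [yFun]
  ring

include hτ

/-- The right side is the norm of 2(1 + x⁴) − y over the field of x. Its nonvanishing lets one
divide by this factor, and it rationalizes the reciprocal. -/
lemma quadForm_sub_yFun_mul : (2 * (1 + xFun τ ^ 4) - yFun τ) * (2 * (1 + xFun τ ^ 4) + yFun τ) =
    3 * (xFun τ ^ 4 - 1) ^ 2 := by
  linear_combination -yFun_sq hτ

lemma quadForm_sub_yFun_ne_zero : 2 * (1 + xFun τ ^ 4) - yFun τ ≠ 0 := by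
  intro h
  have := quadForm_sub_yFun_mul hτ
  rw [h, zero_mul] at this
  have h1 : xFun τ ^ 4 - 1 ≠ 0 := sub_ne_zero.2 (xFun_pow_four_ne_one hτ)
  exact mul_ne_zero three_ne_zero (pow_ne_zero 2 h1) this.symm

lemma mul_pFun_ne_zero : xFun τ ^ 4 - yFun τ - 1 ≠ 0 := by
  rw [← four_mul_pFun]
  exact mul_ne_zero (mul_ne_zero (by norm_num) (xFun_ne_zero hτ)) (pFun_ne_zero hτ)

/-- The first-order equation for `x`. -/
lemma deriv_xFun_mul : deriv xFun τ * (2 * (1 + xFun τ ^ 4) - yFun τ) =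
    Real.pi * I / 4 * null₂ τ ^ 4 * xFun τ * yFun τ := by
  have hx := (differentiableAt_xFun hτ).hasDerivAt
  have hp := hasDerivAt_pFun hτ
  have hx0 := xFun_ne_zero hτ
  have h1 := (((hx.const_mul 2).mul (hp.pow 2)).sub (((hx.pow 4).sub_const 1).mul hp)).sub
    ((hx.pow 3).const_mul 2)
  have h2 := h1.unique ((hasDerivAt_const τ (0 : ℂ)).congr_of_eventuallyEq (by
    filter_upwards [halfPlane_mem_nhds hτ] with σ hσ using xFun_pFun hσ))
  simp only [Pi.pow_apply] at h2
  push_cast at h2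
  set s := deriv xFun τ
  -- The relation F(x, p) = 0 is differentiated, with ∂F/∂p = 4xp − (x⁴ − 1) = −y.
  have h3 : s * (2 * pFun τ ^ 2 - 4 * xFun τ ^ 3 * pFun τ - 6 * xFun τ ^ 2) =
      -(Real.pi * I / 4) * null₂ τ ^ 4 * pFun τ * yFun τ := by
    rw [yFun]
    linear_combination h2
  have hm := mul_pFun_ne_zero hτ
  have hp' : pFun τ = (xFun τ ^ 4 - yFun τ - 1) / (4 * xFun τ) := pFun_eq_of_yFun hτ
  have hy := yFun_sq hτ
  rw [hp'] at h3
  field_simp at h3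
  refine mul_left_cancel₀ hm ?_
  linear_combination -h3 / 4 + 3 / 2 * s * hy

lemma deriv_xFun_eq : deriv xFun τ = Real.pi * I / 4 * null₂ τ ^ 4 * xFun τ * yFun τ /
    (2 * (1 + xFun τ ^ 4) - yFun τ) :=
  eq_div_of_mul_eq (quadForm_sub_yFun_ne_zero hτ) (deriv_xFun_mul hτ)

lemma deriv_xFun_ne_zero_iff_yFun : deriv xFun τ ≠ 0 ↔ yFun τ ≠ 0 := by
  have hpi : (Real.pi * I / 4 : ℂ) ≠ 0 := by
    simp [Real.pi_ne_zero]
  rw [deriv_xFun_eq hτ, Ne, div_eq_zero_iff, not_or, mul_eq_zero, not_or]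
  have := mul_ne_zero (mul_ne_zero hpi (pow_ne_zero 4 (null₂_ne_zero hτ))) (xFun_ne_zero hτ)
  exact ⟨fun h => h.1.2, fun h => ⟨⟨this, h⟩, quadForm_sub_yFun_ne_zero hτ⟩⟩

lemma yFun_ne_zero_iff : yFun τ ≠ 0 ↔ xFun τ ^ 8 + 14 * xFun τ ^ 4 + 1 ≠ 0 := by
  rw [← yFun_sq hτ]
  simp

lemma deriv_xFun_ne_zero_iff :
    deriv xFun τ ≠ 0 ↔ xFun τ ^ 8 + 14 * xFun τ ^ 4 + 1 ≠ 0 := by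
  rw [deriv_xFun_ne_zero_iff_yFun hτ, yFun_ne_zero_iff hτ]

lemma hasDerivAt_yFun (hy0 : yFun τ ≠ 0) : HasDerivAt yFun
    (deriv xFun τ * ((4 * xFun τ ^ 7 + 28 * xFun τ ^ 3) / yFun τ)) τ := by
  have hx := (differentiableAt_xFun hτ).hasDerivAt
  have hy := (differentiableAt_yFun hτ).hasDerivAt
  have h1 := (hy.pow 2).unique ((((hx.pow 8).add ((hx.pow 4).const_mul 14)).add_const
    1).congr_of_eventuallyEq (by
      filter_upwards [halfPlane_mem_nhds hτ] with σ hσ using yFun_sq hσ))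
  push_cast at h1
  refine hy.congr_deriv ?_
  field_simp
  linear_combination h1 / 2

/-- `π i / 4 · ϑ₂⁴` and `π i / 4 · ϑ₄⁴` in terms of `x`, `y` and `x'`. -/
lemma null₂_pow_four_eq (hy0 : yFun τ ≠ 0) : Real.pi * I / 4 * null₂ τ ^ 4 =
    deriv xFun τ * ((2 * (1 + xFun τ ^ 4) - yFun τ) / (xFun τ * yFun τ)) := by
  have h := deriv_xFun_mul hτ
  have hx0 := xFun_ne_zero hτ
  rw [← mul_div_assoc, h]
  field_simp

lemma null₄_pow_four_mul : null₄ τ ^ 4 * (1 - pFun τ ^ 4) = null₂ τ ^ 4 * pFun τ ^ 4 := by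
  have h3 := null₃_ne_zero hτ
  rw [one_sub_pFun_pow_four hτ, pFun_eq]
  field_simp

/-- The ratio of ϑ₄⁴ to ϑ₂⁴ is p⁴/(1 − p⁴), and p⁴ is a rational function on the curve. -/
lemma null₄_pow_four_eq (hy0 : yFun τ ≠ 0) : Real.pi * I / 4 * null₄ τ ^ 4 =
    deriv xFun τ * (((1 + 3 * xFun τ ^ 4) * yFun τ + (1 + 10 * xFun τ ^ 4 - 3 * xFun τ ^ 8)) /
      (2 * xFun τ * (xFun τ ^ 4 - 1) * yFun τ)) := by
  have h1 := null₂_pow_four_eq hτ hy0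
  have hx0 := xFun_ne_zero hτ
  have hx1 : xFun τ ^ 4 - 1 ≠ 0 := sub_ne_zero.2 (xFun_pow_four_ne_one hτ)
  have hp1 : 1 - pFun τ ^ 4 ≠ 0 := sub_ne_zero.2 (pFun_pow_four_ne_one hτ).symm
  have hy := yFun_sq hτ
  refine mul_right_cancel₀ hp1 ?_
  rw [mul_assoc, null₄_pow_four_mul hτ, ← mul_assoc, h1]
  have hm := four_mul_pFun (τ := τ)
  set x := xFun τ
  set y := yFun τ
  set p := pFun τ
  -- Powers of p are brought to the form a + by by means of 4xp = x⁴ − y − 1 and the equation of the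
  -- curve.
  have hp2 : 8 * x ^ 2 * p ^ 2 = x ^ 8 + 6 * x ^ 4 + 1 - (x ^ 4 - 1) * y := by
    linear_combination (4 * x * p + (x ^ 4 - y - 1)) * hm / 2 + hy / 2
  have hp4 : 64 * x ^ 4 * p ^ 4 = (x ^ 8 + 6 * x ^ 4 + 1) ^ 2 + (x ^ 4 - 1) ^ 2 *
      (x ^ 8 + 14 * x ^ 4 + 1) - 2 * (x ^ 8 + 6 * x ^ 4 + 1) * (x ^ 4 - 1) * y := by
    linear_combination (8 * x ^ 2 * p ^ 2 + (x ^ 8 + 6 * x ^ 4 + 1 - (x ^ 4 - 1) * y)) * hp2 +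
      (x ^ 4 - 1) ^ 2 * hy
  have h64 : (64 * x ^ 4) ≠ 0 := mul_ne_zero (by norm_num) (pow_ne_zero 4 hx0)
  have key : (2 * (1 + x ^ 4) - y) * (2 * (x ^ 4 - 1)) * p ^ 4 =
      ((1 + 3 * x ^ 4) * y + (1 + 10 * x ^ 4 - 3 * x ^ 8)) * (1 - p ^ 4) := by
    refine mul_left_cancel₀ h64 ?_
    linear_combination ((2 * (1 + x ^ 4) - y) * (2 * (x ^ 4 - 1)) +
      ((1 + 3 * x ^ 4) * y + (1 + 10 * x ^ 4 - 3 * x ^ 8))) * hp4 +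
      (2 * (x ^ 4 - 1) - (1 + 3 * x ^ 4)) * 2 * (x ^ 8 + 6 * x ^ 4 + 1) * (x ^ 4 - 1) * hy
  field_simp
  linear_combination deriv xFun τ * key

/-- The derivative of the logarithmic derivative of `x'`, up to the contribution of `η`. -/
def connection (x y : ℂ) : ℂ :=
  (5 - 15 * x ^ 4 + 63 * x ^ 8 + 11 * x ^ 12 - 4 * (1 + x ^ 4) ^ 2 * y) /
    (3 * x * (x ^ 4 - 1) * (x ^ 8 + 14 * x ^ 4 + 1))

omit hτ in
-- The left side is the logarithmic derivative of the expression for x' in `deriv_xFun_eq`, divided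
-- by x' and without its η part. Rationalizing the two denominators that contain y brings it to the
-- form a + by.
lemma connection_eq {x y : ℂ} (hx : x ≠ 0) (hx1 : x ^ 4 - 1 ≠ 0) (hy : y ≠ 0)
    (hq : 2 * (1 + x ^ 4) - y ≠ 0) (hf : y ^ 2 = x ^ 8 + 14 * x ^ 4 + 1) :
    4 / 3 * ((2 * (1 + x ^ 4) - y) / (x * y) + 2 * (((1 + 3 * x ^ 4) * y +
      (1 + 10 * x ^ 4 - 3 * x ^ 8)) / (2 * x * (x ^ 4 - 1) * y))) + 1 / x +
      (4 * x ^ 7 + 28 * x ^ 3) / y / y -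
      (8 * x ^ 3 - (4 * x ^ 7 + 28 * x ^ 3) / y) / (2 * (1 + x ^ 4) - y) = connection x y := by
  have hi : 1 / (2 * (1 + x ^ 4) - y) = (2 * (1 + x ^ 4) + y) / (3 * (x ^ 4 - 1) ^ 2) := by
    field_simp
    linear_combination hf
  have hy' : 1 / y = y / (x ^ 8 + 14 * x ^ 4 + 1) := by
    rw [← hf]
    field_simp
  have hf0 : x ^ 8 + 14 * x ^ 4 + 1 ≠ 0 := hf ▸ pow_ne_zero 2 hy
  have expand : 4 / 3 * ((2 * (1 + x ^ 4) - y) / (x * y) + 2 * (((1 + 3 * x ^ 4) * y +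
      (1 + 10 * x ^ 4 - 3 * x ^ 8)) / (2 * x * (x ^ 4 - 1) * y))) + 1 / x +
      (4 * x ^ 7 + 28 * x ^ 3) / y / y -
      (8 * x ^ 3 - (4 * x ^ 7 + 28 * x ^ 3) / y) / (2 * (1 + x ^ 4) - y) =
      4 / 3 * ((2 * (1 + x ^ 4) * (1 / y) - 1) / x + ((1 + 3 * x ^ 4) +
      (1 + 10 * x ^ 4 - 3 * x ^ 8) * (1 / y)) / (x * (x ^ 4 - 1))) + 1 / x +
      (4 * x ^ 7 + 28 * x ^ 3) / y ^ 2 -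
      (8 * x ^ 3 - (4 * x ^ 7 + 28 * x ^ 3) * (1 / y)) * (1 / (2 * (1 + x ^ 4) - y)) := by
    field_simp
  rw [expand, hi, hy', hf, connection]
  clear hy' expand hi
  generalize hF : x ^ 8 + 14 * x ^ 4 + 1 = F at *
  field_simp
  ring_nf
  simp only [hf, ← hF]
  ring

/-- Logarithmic differentiation of `deriv_xFun_eq`. The only part of x''/x' that is not x' times a
function on the curve is 4η'/η, coming from ϑ₂⁴. -/
lemma hasDerivAt_deriv_xFun (hy0 : yFun τ ≠ 0) : HasDerivAt (deriv xFun)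
    (deriv xFun τ * (4 * etaLog τ + deriv xFun τ * connection (xFun τ) (yFun τ))) τ := by
  have hx := (differentiableAt_xFun hτ).hasDerivAt
  have hy := hasDerivAt_yFun hτ hy0
  have hn := (differentiableAt_null₂ hτ).hasDerivAt
  rw [(null_logDeriv_system hτ).2.2] at hn
  have hq := quadForm_sub_yFun_ne_zero hτ
  have h1 := ((((hn.pow 4).const_mul (Real.pi * I / 4)).mul hx).mul hy).div
    ((((hx.pow 4).const_add 1).const_mul 2).sub hy) hq
  refine (h1.congr_of_eventuallyEq ?_).congr_deriv ?_
  · filter_upwards [halfPlane_mem_nhds hτ] with σ hσ using deriv_xFun_eq hσ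
  · have e1 := null₂_pow_four_eq hτ hy0
    have e2 := null₄_pow_four_eq hτ hy0
    have e3 := deriv_xFun_eq hτ
    have hx0 := xFun_ne_zero hτ
    have hx1 : xFun τ ^ 4 - 1 ≠ 0 := sub_ne_zero.2 (xFun_pow_four_ne_one hτ)
    have hyf := yFun_sq hτ
    have hf := (yFun_ne_zero_iff hτ).1 hy0
    simp only [Pi.pow_apply, Pi.mul_apply, Pi.sub_apply]
    push_cast
    rw [← connection_eq hx0 hx1 hy0 hq hyf]
    have e4 : Real.pi * I / 4 * null₂ τ ^ 4 * xFun τ * yFun τ =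
        deriv xFun τ * (2 * (1 + xFun τ ^ 4) - yFun τ) := by
      rw [e1]
      field_simp
    generalize (4 * xFun τ ^ 7 + 28 * xFun τ ^ 3) / yFun τ = y' at *
    set δ := (2 * (1 + xFun τ ^ 4) - yFun τ) / (xFun τ * yFun τ)
    set m := ((1 + 3 * xFun τ ^ 4) * yFun τ + (1 + 10 * xFun τ ^ 4 - 3 * xFun τ ^ 8)) /
      (2 * xFun τ * (xFun τ ^ 4 - 1) * yFun τ)
    set Q := 2 * (1 + xFun τ ^ 4) - yFun τ
    set s := deriv xFun τ
    set x := xFun τ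
    set y := yFun τ
    have e5 : 4 * (etaLog τ + Real.pi * I / 12 * (null₂ τ ^ 4 + 2 * null₄ τ ^ 4)) =
        4 * etaLog τ + 4 / 3 * (s * δ + 2 * (s * m)) := by
      rw [← e1, ← e2]
      ring
    have e6 : 4 * (Real.pi * I / 4 * null₂ τ ^ 4) * (etaLog τ + Real.pi * I / 12 *
        (null₂ τ ^ 4 + 2 * null₄ τ ^ 4)) * x * y = s * Q *
        (4 * etaLog τ + 4 / 3 * (s * δ + 2 * (s * m))) := by
      rw [← e5, ← e4]
      ring
    have e7 : Real.pi * I / 4 * null₂ τ ^ 4 * y = s * Q / x := by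
      rw [← e4]
      field_simp
    have e8 : Real.pi * I / 4 * null₂ τ ^ 4 * x = s * Q / y := by
      rw [← e4]
      field_simp
    rw [div_eq_iff (pow_ne_zero 2 hq)]
    have e9 : (1 : ℂ) = Q * (1 / Q) := by field_simp
    linear_combination (norm := (field_simp; ring)) Q * e6 + s * Q * e7 + s * y' * Q * e8 -
      (8 * x ^ 3 * s - s * y') * e4

end Schwarzian

/-! ### The Schwarzian derivative of x -/

section Schwarzian

variable {τ : ℂ} (hτ : 0 < τ.im)
include hτ

lemma schwarz_polynomial_ne_zero_near (hy0 : yFun τ ≠ 0) :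
    ∀ᶠ σ in 𝓝 τ, 0 < σ.im ∧ yFun σ ≠ 0 :=
  (show ∀ᶠ σ in 𝓝 τ, 0 < σ.im from halfPlane_mem_nhds hτ).and ((differentiableAt_yFun hτ).continuousAt.eventually_ne hy0)

/-- `∂γ/∂x` along the curve `y² = x⁸ + 14 x⁴ + 1`, where `γ` is `connection`. -/
def connectionDeriv (x y : ℂ) : ℂ :=
  ((-60 * x ^ 3 + 504 * x ^ 7 + 132 * x ^ 11 - 32 * x ^ 3 * (1 + x ^ 4) * y -
    4 * (1 + x ^ 4) ^ 2 * ((4 * x ^ 7 + 28 * x ^ 3) / y)) *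
      (3 * x * (x ^ 4 - 1) * (x ^ 8 + 14 * x ^ 4 + 1)) -
    (5 - 15 * x ^ 4 + 63 * x ^ 8 + 11 * x ^ 12 - 4 * (1 + x ^ 4) ^ 2 * y) *
      (39 * x ^ 12 + 351 * x ^ 8 - 195 * x ^ 4 - 3)) /
    (3 * x * (x ^ 4 - 1) * (x ^ 8 + 14 * x ^ 4 + 1)) ^ 2

lemma hasDerivAt_connection (hy0 : yFun τ ≠ 0) :
    HasDerivAt (fun σ => connection (xFun σ) (yFun σ))
      (deriv xFun τ * connectionDeriv (xFun τ) (yFun τ)) τ := by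
  have hx := (differentiableAt_xFun hτ).hasDerivAt
  have hy := hasDerivAt_yFun hτ hy0
  have hx0 := xFun_ne_zero hτ
  have hx1 : xFun τ ^ 4 - 1 ≠ 0 := sub_ne_zero.2 (xFun_pow_four_ne_one hτ)
  have hf := (yFun_ne_zero_iff hτ).1 hy0
  have hD : 3 * xFun τ * (xFun τ ^ 4 - 1) * (xFun τ ^ 8 + 14 * xFun τ ^ 4 + 1) ≠ 0 :=
    mul_ne_zero (mul_ne_zero (mul_ne_zero three_ne_zero hx0) hx1) hf
  have hN := ((((hx.pow 4).const_mul 15).const_sub 5).add ((hx.pow 8).const_mul 63)).add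
    ((hx.pow 12).const_mul 11) |>.sub (((((hx.pow 4).const_add 1).pow 2).const_mul 4).mul hy)
  have hDen := ((hx.const_mul 3).mul ((hx.pow 4).sub_const 1)).mul
    (((hx.pow 8).add ((hx.pow 4).const_mul 14)).add_const 1)
  refine (hN.div hDen hD).congr_deriv ?_
  simp only [Pi.pow_apply, Pi.mul_apply, Pi.sub_apply, Pi.add_apply, connectionDeriv]
  push_cast
  rw [mul_div_assoc' (deriv xFun τ) (_ - _)]
  congr 1
  ring

end Schwarzian

/-- This is the Schwarzian derivative divided by x'², once η'/η has been eliminated. Modulo the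
equation of the curve both sides have the form a + by, and the coefficient of y turns out to be 0.
-/
lemma connection_riccati {x y : ℂ} (hx : x ≠ 0) (hx1 : x ^ 4 - 1 ≠ 0) (hy : y ≠ 0)
    (hf : y ^ 2 = x ^ 8 + 14 * x ^ 4 + 1) :
    connection x y ^ 2 / 2 + connectionDeriv x y - 8 / 9 *
      (((2 * (1 + x ^ 4) - y) / (x * y)) ^ 2 + (2 * (1 + x ^ 4) - y) / (x * y) *
        (((1 + 3 * x ^ 4) * y + (1 + 10 * x ^ 4 - 3 * x ^ 8)) / (2 * x * (x ^ 4 - 1) * y)) +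
        (((1 + 3 * x ^ 4) * y + (1 + 10 * x ^ 4 - 3 * x ^ 8)) /
          (2 * x * (x ^ 4 - 1) * y)) ^ 2) = fuchsQ x := by
  have hf0 : x ^ 8 + 14 * x ^ 4 + 1 ≠ 0 := hf ▸ pow_ne_zero 2 hy
  have h5 : x ^ 5 - x = x * (x ^ 4 - 1) := by ring
  have hD : x ^ 2 * (x ^ 4 - 1) ^ 2 * (x ^ 8 + 14 * x ^ 4 + 1) ≠ 0 :=
    mul_ne_zero (mul_ne_zero (pow_ne_zero 2 hx) (pow_ne_zero 2 hx1)) hf0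
  have hquad : ((2 * (1 + x ^ 4) - y) / (x * y)) ^ 2 + (2 * (1 + x ^ 4) - y) / (x * y) *
        (((1 + 3 * x ^ 4) * y + (1 + 10 * x ^ 4 - 3 * x ^ 8)) / (2 * x * (x ^ 4 - 1) * y)) +
        (((1 + 3 * x ^ 4) * y + (1 + 10 * x ^ 4 - 3 * x ^ 8)) /
          (2 * x * (x ^ 4 - 1) * y)) ^ 2 =
      (5 * (1 + x ^ 4) ^ 4 + (-4 + 12 * x ^ 4 + 12 * x ^ 8 - 4 * x ^ 12) * y) /
        (x ^ 2 * (x ^ 4 - 1) ^ 2 * (x ^ 8 + 14 * x ^ 4 + 1)) := by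
    rw [eq_div_iff hD, ← hf]
    field_simp
    ring_nf
    simp only [hf]
    ring
  have hy' : (4 * x ^ 7 + 28 * x ^ 3) / y =
      (4 * x ^ 7 + 28 * x ^ 3) * y / (x ^ 8 + 14 * x ^ 4 + 1) := by
    rw [← hf]
    field_simp
  rw [hquad, connection, connectionDeriv, fuchsQ, h5, hy']
  generalize hF : x ^ 8 + 14 * x ^ 4 + 1 = F at *
  field_simp
  ring_nf
  simp only [hf, ← hF]
  ring

/-- With s = x', E = `etaLog` and s' = s(4E + sγ), one has s''/s − (3/2)(s'/s)² = 4E' − 8E² +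
s²(γ²/2 + ∂γ/∂x). Ramanujan's equation makes 4E' − 8E² a multiple of s², so E disappears. -/
lemma meroDeriv_xFun {τ : ℂ} (hτ : 0 < τ.im) (hy0 : yFun τ ≠ 0) :
    meroDeriv xFun τ = fuchsQ (xFun τ) := by
  have h2 : ∀ᶠ σ in 𝓝 τ, deriv (deriv xFun) σ = deriv xFun σ * (4 * etaLog σ +
      deriv xFun σ * connection (xFun σ) (yFun σ)) := by
    filter_upwards [schwarz_polynomial_ne_zero_near hτ hy0] with σ hσ
    exact (hasDerivAt_deriv_xFun hσ.1 hσ.2).deriv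
  have hs := hasDerivAt_deriv_xFun hτ hy0
  have h3 := hs.mul (((differentiableAt_etaLog hτ).hasDerivAt.const_mul 4).add
    (hs.mul (hasDerivAt_connection hτ hy0)))
  have h3' : deriv (deriv (deriv xFun)) τ = _ := (h3.congr_of_eventuallyEq h2).deriv
  have i2 : iteratedDeriv 2 xFun τ = deriv (deriv xFun) τ := by
    simp [iteratedDeriv_succ, iteratedDeriv_zero]
  have i3 : iteratedDeriv 3 xFun τ = deriv (deriv (deriv xFun)) τ := by
    rw [iteratedDeriv_succ]
    congr 1
    ext σ
    simp [iteratedDeriv_succ, iteratedDeriv_zero]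
  have hs0 : deriv xFun τ ≠ 0 := (deriv_xFun_ne_zero_iff_yFun hτ).2 hy0
  have hx1 : xFun τ ^ 4 - 1 ≠ 0 := sub_ne_zero.2 (xFun_pow_four_ne_one hτ)
  rw [meroDeriv, i2, i3, h3', hs.deriv, ← connection_riccati (xFun_ne_zero hτ) hx1 hy0
    (yFun_sq hτ)]
  have e1 := null₂_pow_four_eq hτ hy0
  have e2 := null₄_pow_four_eq hτ hy0
  have hn := null₃_pow_four hτ
  generalize (2 * (1 + xFun τ ^ 4) - yFun τ) / (xFun τ * yFun τ) = δ at *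
  generalize ((1 + 3 * xFun τ ^ 4) * yFun τ + (1 + 10 * xFun τ ^ 4 - 3 * xFun τ ^ 8)) /
    (2 * xFun τ * (xFun τ ^ 4 - 1) * yFun τ) = m at *
  -- By Jacobi's quartic identity the sum of eighth powers is 2(a² + ab + b²) with a = ϑ₂⁴, b = ϑ₄⁴,
  -- and these are x' times δ and m up to the factor πi/4.
  have hE : deriv etaLog τ =
      2 * etaLog τ ^ 2 - 2 / 9 * deriv xFun τ ^ 2 * (δ ^ 2 + δ * m + m ^ 2) := by
    have h8 : null₂ τ ^ 8 + null₃ τ ^ 8 + null₄ τ ^ 8 = 2 * ((null₂ τ ^ 4) ^ 2 +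
        null₂ τ ^ 4 * null₄ τ ^ 4 + (null₄ τ ^ 4) ^ 2) := by
      linear_combination (null₃ τ ^ 4 + (null₂ τ ^ 4 + null₄ τ ^ 4)) * hn
    have hδ : deriv xFun τ ^ 2 * (δ ^ 2 + δ * m + m ^ 2) = (deriv xFun τ * δ) ^ 2 +
        deriv xFun τ * δ * (deriv xFun τ * m) + (deriv xFun τ * m) ^ 2 := by ring
    rw [deriv_etaLog hτ, h8, mul_assoc (2 / 9 : ℂ), hδ, ← e1, ← e2]
    linear_combination (Real.pi : ℂ) ^ 2 / 72 * ((null₂ τ ^ 4) ^ 2 +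
        null₂ τ ^ 4 * null₄ τ ^ 4 + (null₄ τ ^ 4) ^ 2) * I_sq
  simp only [Pi.add_apply, Pi.mul_apply, hE]
  field_simp
  ring

/-! ### Partial fractions of the coefficient -/

section PartialFractions

open Polynomial

/-- This is Σ 1/(x − a)² = −(P'/P)' with denominators cleared; in this form it passes through the
product rule, one root at a time. -/
lemma sum_inv_sq_roots (s : Multiset ℂ) (x : ℂ) (hx : ∀ a ∈ s, x - a ≠ 0) :
    ((s.map fun a => X - C a).prod).eval x ≠ 0 ∧
    (s.map fun a => 1 / (x - a) ^ 2).sum * ((s.map fun a => X - C a).prod).eval x ^ 2 =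
      (derivative (s.map fun a => X - C a).prod).eval x ^ 2 -
        ((s.map fun a => X - C a).prod).eval x *
          (derivative (derivative (s.map fun a => X - C a).prod)).eval x := by
  induction s using Multiset.induction_on with
  | empty => simp
  | cons a s ih =>
    have ha := hx a (Multiset.mem_cons_self a s)
    obtain ⟨h0, ih⟩ := ih fun b hb => hx b (Multiset.mem_cons_of_mem hb)
    simp only [Multiset.map_cons, Multiset.prod_cons, Multiset.sum_cons]
    set P := (s.map fun a => X - C a).prod
    refine ⟨by simp [h0, ha], ?_⟩
    simp only [derivative_mul, derivative_sub, derivative_X, derivative_C, eval_mul, eval_sub,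
      eval_add, eval_X, eval_C, sub_zero, one_mul, derivative_add]
    have : 1 / (x - a) ^ 2 * (x - a) ^ 2 = 1 := by field_simp
    linear_combination (x - a) ^ 2 * ih + P.eval x ^ 2 * this

lemma sum_roots_eq {P : ℂ[X]} (hP : P.Monic) {x : ℂ} (hx : P.eval x ≠ 0) :
    (P.roots.map fun a => 1 / (x - a) ^ 2).sum = ((derivative P).eval x ^ 2 -
      P.eval x * (derivative (derivative P)).eval x) / P.eval x ^ 2 := by
  have hsplit : (P.roots.map fun a => X - C a).prod = P := by
    have := (IsAlgClosed.splits P).eq_prod_roots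
    rw [hP.leadingCoeff] at this
    simpa using this.symm
  have h := sum_inv_sq_roots P.roots x (by
    intro a ha h
    rw [sub_eq_zero.1 h] at hx
    exact hx (isRoot_of_mem_roots ha))
  rw [hsplit] at h
  rw [eq_div_iff (pow_ne_zero 2 hx), h.2]

lemma monic_faceForm : faceForm.Monic := by
  rw [faceForm]
  monicity!

lemma monic_vertexForm : vertexForm.Monic := by
  rw [vertexForm]
  monicity!

lemma fuchsQ_eq_partial {x : ℂ} (h1 : x ^ 8 + 14 * x ^ 4 + 1 ≠ 0) (h2 : x ^ 5 - x ≠ 0) :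
    fuchsQ x = fuchsQPartial x := by
  have e1 : faceForm.eval x = x ^ 8 + 14 * x ^ 4 + 1 := by simp [faceForm]
  have e2 : vertexForm.eval x = x ^ 5 - x := by simp [vertexForm]
  have e3 : (derivative faceForm).eval x = 8 * x ^ 7 + 56 * x ^ 3 := by
    simp [faceForm]; ring
  have e4 : (derivative vertexForm).eval x = 5 * x ^ 4 - 1 := by simp [vertexForm]; norm_num
  have e5 : (derivative (derivative faceForm)).eval x = 56 * x ^ 6 + 168 * x ^ 2 := by
    simp [faceForm]; ring
  have e6 : (derivative (derivative vertexForm)).eval x = 20 * x ^ 3 := by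
    simp [vertexForm]; ring
  rw [fuchsQPartial, sum_roots_eq monic_faceForm (by rwa [e1]),
    sum_roots_eq monic_vertexForm (by rwa [e2]), e1, e2, e3, e4, e5, e6, fuchsQ]
  generalize hF : x ^ 8 + 14 * x ^ 4 + 1 = F at *
  generalize hG : x ^ 5 - x = G at *
  field_simp
  rw [← hF, ← hG]
  ring

end PartialFractions

/-! ### Discreteness of automorphism groups -/

section Discreteness

/-- A fixed point is a root of the real quadratic cz² + (d − a)z − b, which has at most one root in
the half-plane unless it is zero. Then g = ±1, and the positive entry excludes −1. -/
lemma eq_one_of_fixes_two {g : SL(2, ℝ)} {σ τ : ℍ} (hστ : σ ≠ τ) (hσ : g • σ = σ) (hτ : g • τ = τ)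
    (hpos : 0 < g 0 0) : g = 1 := by
  have key : ∀ z : ℍ, g • z = z → (g 1 0 : ℂ) * (z : ℂ) ^ 2 + (g 1 1 - g 0 0) * z - g 0 1 = 0 := by
    intro z hz
    have h := UpperHalfPlane.coe_specialLinearGroup_apply g z
    rw [hz] at h
    simp only [Algebra.algebraMap_self, RingHom.id_apply] at h
    have hd : (g 1 0 : ℂ) * z + g 1 1 ≠ 0 := by
      intro h0
      rw [h0, div_zero] at h
      exact UpperHalfPlane.ne_zero z h
    rw [eq_div_iff hd] at h
    linear_combination h
  have real : ∀ z : ℍ, g • z = z → g 1 0 * (z.re ^ 2 + z.im ^ 2) = - g 0 1 ∧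
      g 1 1 - g 0 0 = - 2 * g 1 0 * z.re := by
    intro z hz
    have h := key z hz
    have hi : (g 1 0 * (2 * z.re) + (g 1 1 - g 0 0)) * z.im = 0 := by
      have := congr_arg Complex.im h
      simp [pow_two] at this
      linarith
    have hr : g 1 0 * (z.re ^ 2 - z.im ^ 2) + (g 1 1 - g 0 0) * z.re - g 0 1 = 0 := by
      have := congr_arg Complex.re h
      simp [pow_two] at this
      linarith
    have hi' := (mul_eq_zero.1 hi).resolve_right z.im_ne_zero
    constructor
    · linear_combination -hr + z.re * hi'
    · linear_combination hi'
  obtain ⟨h1, h2⟩ := real σ hσ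
  obtain ⟨h3, h4⟩ := real τ hτ
  have hc : g 1 0 = 0 := by
    by_contra hc
    apply hστ
    have hre : σ.re = τ.re := mul_left_cancel₀ hc (by linarith)
    have him : σ.im ^ 2 = τ.im ^ 2 := by
      have := mul_left_cancel₀ hc (h1.trans h3.symm)
      rw [hre] at this
      linarith
    have him' : σ.im = τ.im := by
      rwa [sq_eq_sq₀ σ.im_pos.le τ.im_pos.le] at him
    exact UpperHalfPlane.ext (Complex.ext hre him')
  have hb : g 0 1 = 0 := by simpa [hc] using h1.symm
  have had : g 1 1 = g 0 0 := by
    rw [hc] at h2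
    linarith
  have hdet := g.det_coe
  rw [Matrix.det_fin_two] at hdet
  have ha : g 0 0 = 1 := by
    rw [had, hc, mul_zero, sub_zero] at hdet
    nlinarith
  ext i j
  fin_cases i <;> fin_cases j <;> simp [hc, hb, had, ha]

lemma exists_mem_nhds_injOn {f : ℂ → ℂ} {a : ℂ} (hf : AnalyticAt ℂ f a) (hd : deriv f a ≠ 0) :
    ∃ V ∈ 𝓝 a, Set.InjOn f V := by
  have hs := hf.hasStrictDerivAt.hasStrictFDerivAt_equiv hd
  exact ⟨_, (hs.toOpenPartialHomeomorph f).open_source.mem_nhds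
    hs.mem_toOpenPartialHomeomorph_source, (hs.toOpenPartialHomeomorph f).injOn⟩

lemma exists_isOpen_injOn {f : ℂ → ℂ} (hf : DifferentiableOn ℂ f halfPlane) (τ : ℍ)
    (hd : deriv f τ ≠ 0) : ∃ U : Set ℍ, IsOpen U ∧ τ ∈ U ∧ Set.InjOn (fun z : ℍ => f z) U := by
  obtain ⟨V, hV, hinj⟩ := exists_mem_nhds_injOn (hf.analyticAt (halfPlane_mem_nhds τ.im_pos)) hd
  obtain ⟨W, hWV, hW, hτW⟩ := mem_nhds_iff.1 hV
  refine ⟨((↑) : ℍ → ℂ) ⁻¹' W, hW.preimage UpperHalfPlane.continuous_coe, hτW, fun a ha b hb hab => ?_⟩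
  exact UpperHalfPlane.ext (hinj (hWV ha) (hWV hb) hab)

/-- Take two points in a neighbourhood on which f is injective. An automorphism close to 1 keeps
both inside and preserves their values, hence fixes both. -/
lemma discreteTopology_autGroup {f : ℂ → ℂ} (hf : DifferentiableOn ℂ f halfPlane) (τ : ℍ)
    (hd : deriv f τ ≠ 0) : DiscreteTopology (autGroup f) := by
  obtain ⟨U, hU, hτU, hinj⟩ := exists_isOpen_injOn hf τ hd
  obtain ⟨σ, hσ, hστ⟩ : ∃ σ ∈ U, σ ≠ τ := by
    have : Tendsto (fun t : ℝ => t +ᵥ τ) (𝓝[≠] 0) (𝓝 τ) := by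
      have hc : Continuous fun t : ℝ => t +ᵥ τ := by
        rw [UpperHalfPlane.isEmbedding_coe.continuous_iff]
        simp only [Function.comp_def, UpperHalfPlane.coe_vadd]
        fun_prop
      have := hc.tendsto 0
      rw [zero_vadd] at this
      exact this.mono_left nhdsWithin_le_nhds
    obtain ⟨t, ht, ht0⟩ := ((this.eventually (hU.mem_nhds hτU)).and self_mem_nhdsWithin).exists
    refine ⟨t +ᵥ τ, ht, fun h => ht0 ?_⟩
    have := congr_arg UpperHalfPlane.re h
    simpa using this
  have hcont : ∀ z : ℍ, Continuous fun g : autGroup f => (g : SL(2, ℝ)) • z := fun z =>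
    continuous_subtype_val.smul continuous_const
  have h00 : Continuous fun g : autGroup f => (g : SL(2, ℝ)) 0 0 := by
    have : Continuous fun g : SL(2, ℝ) => (g : Matrix (Fin 2) (Fin 2) ℝ) 0 0 :=
      (continuous_subtype_val.matrix_elem 0 0)
    exact this.comp continuous_subtype_val
  refine discreteTopology_of_isOpen_singleton_one ?_
  have hset : ({1} : Set (autGroup f)) = {g : autGroup f | (g : SL(2, ℝ)) • τ ∈ U} ∩
      {g : autGroup f | (g : SL(2, ℝ)) • σ ∈ U} ∩ {g : autGroup f | 0 < (g : SL(2, ℝ)) 0 0} := by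
    ext g
    simp only [Set.mem_singleton_iff, Set.mem_inter_iff, Set.mem_ofPred_eq]
    constructor
    · rintro rfl
      simp [hτU, hσ]
    · rintro ⟨⟨h1, h2⟩, h3⟩
      refine Subtype.ext (eq_one_of_fixes_two hστ (hinj h2 hσ (g.2 σ)) (hinj h1 hτU (g.2 τ)) h3)
  rw [hset]
  exact ((hU.preimage (hcont τ)).inter (hU.preimage (hcont σ))).inter
    (isOpen_lt continuous_const h00)

lemma discreteTopology_autGroup_inf {f : ℂ → ℂ} (v : ℂ → ℂ) (hf : DifferentiableOn ℂ f halfPlane)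
    (τ : ℍ) (hd : deriv f τ ≠ 0) : DiscreteTopology ↥(autGroup f ⊓ autGroup v) := by
  have := discreteTopology_autGroup hf τ hd
  exact DiscreteTopology.of_subset (s := (autGroup f : Set SL(2, ℝ))) this inf_le_left

end Discreteness

/-! ### The modular function λ under SL(2, ℤ) -/

section Modular

/-- The modular function `1 - λ = ϑ₄⁴ / ϑ₃⁴`. -/
def lambdaFun (τ : ℂ) : ℂ := pFun τ ^ 4

lemma lambdaFun_ne_zero {τ : ℂ} (hτ : 0 < τ.im) : lambdaFun τ ≠ 0 := pow_ne_zero 4 (pFun_ne_zero hτ)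

lemma lambdaFun_ne_one {τ : ℂ} (hτ : 0 < τ.im) : lambdaFun τ ≠ 1 := pFun_pow_four_ne_one hτ

lemma lambdaFun_add_one (τ : ℂ) : lambdaFun (τ + 1) = (lambdaFun τ)⁻¹ := by
  rw [lambdaFun, pFun_add_one, inv_pow, lambdaFun]

lemma lambdaFun_inversion {τ : ℂ} (hτ : 0 < τ.im) : lambdaFun (-1 / τ) = 1 - lambdaFun τ :=
  pFun_inversion_pow_four hτ

lemma differentiableAt_lambdaFun {τ : ℂ} (hτ : 0 < τ.im) : DifferentiableAt ℂ lambdaFun τ :=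
  (differentiableAt_pFun hτ).pow 4

lemma differentiableOn_lambdaFun : DifferentiableOn ℂ lambdaFun halfPlane :=
  differentiableOn_halfPlane fun _ hτ => differentiableAt_lambdaFun hτ

lemma continuous_lambdaFun : Continuous fun τ : ℍ => lambdaFun τ :=
  continuous_iff_continuousAt.2 fun τ =>
    ContinuousAt.comp (f := ((↑) : ℍ → ℂ)) (differentiableAt_lambdaFun τ.im_pos).continuousAt
      UpperHalfPlane.continuous_coe.continuousAt

lemma deriv_lambdaFun_ne_zero {τ : ℂ} (hτ : 0 < τ.im) : deriv lambdaFun τ ≠ 0 := by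
  have h := ((differentiableAt_pFun hτ).hasDerivAt.pow 4).deriv
  rw [show lambdaFun = pFun ^ 4 from rfl, h, deriv_pFun hτ]
  have := pFun_ne_zero hτ
  have := null₂_ne_zero hτ
  have := Real.pi_ne_zero
  simp [*]

lemma tendsto_lambdaFun : Tendsto lambdaFun atInfty (𝓝 1) := by
  simpa using! tendsto_pFun.pow 4

/-- The six anharmonic substitutions. -/
def anharmonic : Fin 6 → ℂ → ℂ :=
  ![fun z => z, fun z => z⁻¹, fun z => 1 - z, fun z => (1 - z)⁻¹, fun z => 1 - z⁻¹,
    fun z => (1 - z⁻¹)⁻¹]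

lemma anharmonic_inv (i : Fin 6) : ∃ j, ∀ z, (anharmonic i z)⁻¹ = anharmonic j z := by
  fin_cases i
  exacts [⟨1, fun z => rfl⟩, ⟨0, fun z => inv_inv z⟩, ⟨3, fun z => rfl⟩, ⟨2, fun z => inv_inv _⟩,
    ⟨5, fun z => rfl⟩, ⟨4, fun z => inv_inv _⟩]

lemma anharmonic_one_sub (i : Fin 6) :
    ∃ j, ∀ z, z ≠ 0 → z ≠ 1 → 1 - anharmonic i z = anharmonic j z := by
  fin_cases i
  · exact ⟨2, fun z _ _ => rfl⟩
  · exact ⟨4, fun z _ _ => rfl⟩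
  · exact ⟨0, fun z _ _ => sub_sub_cancel 1 z⟩
  · refine ⟨5, fun z h0 h1 => ?_⟩
    have : 1 - z ≠ 0 := sub_ne_zero.2 h1.symm
    have : z - 1 ≠ 0 := sub_ne_zero.2 h1
    change 1 - (1 - z)⁻¹ = (1 - z⁻¹)⁻¹
    field_simp
    ring
  · exact ⟨1, fun z _ _ => sub_sub_cancel 1 z⁻¹⟩
  · refine ⟨3, fun z h0 h1 => ?_⟩
    have : 1 - z ≠ 0 := sub_ne_zero.2 h1.symm
    have : z - 1 ≠ 0 := sub_ne_zero.2 h1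
    change 1 - (1 - z⁻¹)⁻¹ = (1 - z)⁻¹
    field_simp
    ring

lemma anharmonic_ne_one (i : Fin 6) {z : ℂ} (h0 : z ≠ 0) (h1 : z ≠ 1) : anharmonic i z ≠ 1 := by
  have h1' : 1 - z ≠ 0 := sub_ne_zero.2 h1.symm
  fin_cases i <;> simp [anharmonic, h0, h1]

lemma continuousAt_anharmonic (i : Fin 6) {z : ℂ} (h0 : z ≠ 0) (h1 : z ≠ 1) :
    ContinuousAt (anharmonic i) z := by
  have h1' : 1 - z ≠ 0 := sub_ne_zero.2 h1.symm
  have h2' : 1 - z⁻¹ ≠ 0 := by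
    rw [sub_ne_zero, Ne, eq_comm, inv_eq_one]
    exact h1
  fin_cases i
  · exact continuousAt_id
  · exact continuousAt_inv₀ h0
  · exact continuousAt_const.sub continuousAt_id
  · exact (continuousAt_const.sub continuousAt_id).inv₀ h1'
  · exact continuousAt_const.sub (continuousAt_inv₀ h0)
  · exact (continuousAt_const.sub (continuousAt_inv₀ h0)).inv₀ h2'

lemma lambdaFun_T_smul (τ : ℍ) : lambdaFun ↑(ModularGroup.T • τ) = (lambdaFun τ)⁻¹ := by
  rw [UpperHalfPlane.modular_T_smul, UpperHalfPlane.coe_vadd, ofReal_one, add_comm,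
    lambdaFun_add_one]

lemma lambdaFun_S_smul (τ : ℍ) : lambdaFun ↑(ModularGroup.S • τ) = 1 - lambdaFun τ := by
  rw [UpperHalfPlane.modular_S_smul, ← lambdaFun_inversion τ.im_pos]
  congr 1
  rw [UpperHalfPlane.coe_mk, inv_neg, neg_div, one_div]

lemma lambdaFun_smul (γ : SL(2, ℤ)) :
    ∃ i, ∀ τ : ℍ, lambdaFun ↑(γ • τ) = anharmonic i (lambdaFun τ) := by
  have hγ : γ ∈ Subgroup.closure {ModularGroup.S, ModularGroup.T} := by
    simp [SpecialLinearGroup.SL2Z_generators]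
  have hS : ∀ δ : SL(2, ℤ), (∃ i, ∀ τ : ℍ, lambdaFun ↑(δ • τ) = anharmonic i (lambdaFun τ)) →
      ∀ ε : SL(2, ℤ), (∀ τ : ℍ, lambdaFun ↑(ε • τ) = 1 - lambdaFun τ) →
      ∃ i, ∀ τ : ℍ, lambdaFun ↑((ε * δ) • τ) = anharmonic i (lambdaFun τ) := by
    rintro δ ⟨i, hi⟩ ε hε
    obtain ⟨j, hj⟩ := anharmonic_one_sub i
    refine ⟨j, fun τ => ?_⟩
    rw [mul_smul, hε, hi, hj _ (lambdaFun_ne_zero τ.im_pos) (lambdaFun_ne_one τ.im_pos)]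
  have hT : ∀ δ : SL(2, ℤ), (∃ i, ∀ τ : ℍ, lambdaFun ↑(δ • τ) = anharmonic i (lambdaFun τ)) →
      ∀ ε : SL(2, ℤ), (∀ τ : ℍ, lambdaFun ↑(ε • τ) = (lambdaFun τ)⁻¹) →
      ∃ i, ∀ τ : ℍ, lambdaFun ↑((ε * δ) • τ) = anharmonic i (lambdaFun τ) := by
    rintro δ ⟨i, hi⟩ ε hε
    obtain ⟨j, hj⟩ := anharmonic_inv i
    refine ⟨j, fun τ => ?_⟩
    rw [mul_smul, hε, hi, hj]
  induction hγ using Subgroup.closure_induction_left with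
  | one => exact ⟨0, fun τ => by rw [one_smul]; rfl⟩
  | mul_left x hx y hy ih =>
    rcases hx with rfl | rfl
    · exact hS y ih _ lambdaFun_S_smul
    · exact hT y ih _ lambdaFun_T_smul
  | inv_mul_cancel x hx y hy ih =>
    rcases hx with rfl | rfl
    · refine hS y ih _ fun τ => ?_
      have := lambdaFun_S_smul (ModularGroup.S⁻¹ • τ)
      rw [smul_inv_smul] at this
      rw [this, sub_sub_cancel]
    · refine hT y ih _ fun τ => ?_
      have := lambdaFun_T_smul (ModularGroup.T⁻¹ • τ)
      rw [smul_inv_smul] at this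
      rw [this, inv_inv]

lemma exists_eventually_eq_of_finite {α ι : Type*} [Finite ι] (𝓤 : Ultrafilter α) (f : α → ι) :
    ∃ i, ∀ᶠ a in (𝓤 : Filter α), f a = i := by
  have := (𝓤.map f).eq_pure_of_finite
  obtain ⟨i, hi⟩ := this
  refine ⟨i, ?_⟩
  have h : {i} ∈ 𝓤.map f := by
    rw [hi]
    exact Ultrafilter.mem_pure.2 rfl
  exact h

/-- Properness of λ modulo SL(2, ℤ): representatives in the fundamental domain have λ-values tending
to an anharmonic image of c, which is not 1. As λ → 1 at i∞, their heights are bounded, and the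
truncated domain is compact. -/
lemma exists_tendsto_smul {α : Type*} (𝓤 : Ultrafilter α) {u : α → ℍ} {c : ℂ} (h0 : c ≠ 0)
    (h1 : c ≠ 1) (h : Tendsto (fun a => lambdaFun (u a)) 𝓤 (𝓝 c)) :
    ∃ (γ : α → SL(2, ℤ)) (σ : ℍ), Tendsto (fun a => γ a • u a) 𝓤 (𝓝 σ) := by
  choose γ hγ using fun a => ModularGroup.exists_smul_mem_fd (u a)
  choose i hi using lambdaFun_smul
  obtain ⟨i₀, hi₀⟩ := exists_eventually_eq_of_finite 𝓤 fun a => i (γ a)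
  have hlim : Tendsto (fun a => lambdaFun ↑(γ a • u a)) 𝓤 (𝓝 (anharmonic i₀ c)) := by
    refine ((continuousAt_anharmonic i₀ h0 h1).tendsto.comp h).congr' ?_
    filter_upwards [hi₀] with a ha
    rw [hi, ha, Function.comp_apply]
  obtain ⟨V, W, hV, hW, hcV, h1W, hVW⟩ := t2_separation (anharmonic_ne_one i₀ h0 h1)
  obtain ⟨M, hM⟩ := eventually_atInfty.1 (tendsto_lambdaFun.eventually (hW.mem_nhds h1W))
  have hmem : ModularGroup.truncatedFundamentalDomain M ∈ 𝓤.map fun a => γ a • u a := by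
    change ∀ᶠ a in (𝓤 : Filter α), γ a • u a ∈ ModularGroup.truncatedFundamentalDomain M
    filter_upwards [hlim.eventually (hV.mem_nhds hcV)] with a ha
    refine ⟨hγ a, not_lt.1 fun hlt => ?_⟩
    exact Set.disjoint_left.1 hVW ha (hM _ hlt)
  obtain ⟨σ, -, hσ⟩ := (ModularGroup.isCompact_truncatedFundamentalDomain M).ultrafilter_le_nhds _
    (le_principal_iff.2 hmem)
  exact ⟨γ, σ, hσ⟩

end Modular

/-! ### The fibres of λ are orbits -/

section Fibers

/-- An integral unimodular matrix as a real one. -/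
def castSL : SL(2, ℤ) →* SL(2, ℝ) := Matrix.SpecialLinearGroup.map (Int.castRingHom ℝ)

lemma castSL_smul (γ : SL(2, ℤ)) (τ : ℍ) : castSL γ • τ = γ • τ := by
  ext
  rw [UpperHalfPlane.coe_specialLinearGroup_apply, UpperHalfPlane.coe_specialLinearGroup_apply]
  simp [castSL]

lemma castSL_mem_autGroup {f : ℂ → ℂ} {γ : SL(2, ℤ)} (h : ∀ τ : ℍ, f ↑(γ • τ) = f τ) :
    castSL γ ∈ autGroup f := fun τ => by rw [castSL_smul, h]

lemma apply_smul_of_mem {f : ℂ → ℂ} {g : SL(2, ℝ)} (hg : g ∈ autGroup f) (τ : ℍ) :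
    f ↑(g • τ) = f τ := hg τ

lemma exists_tendsto_smul_autGroup {α : Type*} (𝓤 : Ultrafilter α) {u : α → ℍ} {c : ℂ}
    (h0 : c ≠ 0) (h1 : c ≠ 1) (h : Tendsto (fun a => lambdaFun (u a)) 𝓤 (𝓝 c)) :
    ∃ (k : α → SL(2, ℝ)) (σ : ℍ), (∀ a, k a ∈ autGroup lambdaFun) ∧
      Tendsto (fun a => k a • u a) 𝓤 (𝓝 σ) := by
  obtain ⟨γ, σ, hσ⟩ := exists_tendsto_smul 𝓤 h0 h1 h
  choose i hi using lambdaFun_smul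
  obtain ⟨i₀, hi₀⟩ := exists_eventually_eq_of_finite 𝓤 fun a => i (γ a)
  obtain ⟨a₀, ha₀⟩ := hi₀.exists
  classical
  -- Matrices with the same anharmonic substitution differ by an automorphism of λ. The value 1 is a
  -- default on indices outside the ultrafilter set.
  refine ⟨fun a => if i (γ a) = i₀ then castSL ((γ a₀)⁻¹ * γ a) else 1,
    castSL (γ a₀)⁻¹ • σ, fun a => ?_, ?_⟩
  · by_cases hia : i (γ a) = i₀
    · simp only [hia, if_true]
      refine castSL_mem_autGroup fun τ => ?_
      rw [mul_smul, hi (γ a₀)⁻¹, hi (γ a), hia, ← ha₀, ← hi (γ a₀), ← hi (γ a₀)⁻¹, inv_smul_smul]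
    · simp only [hia, if_false]
      exact one_mem _
  · refine (hσ.const_smul (castSL (γ a₀)⁻¹)).congr' ?_
    filter_upwards [hi₀] with a ha
    rw [if_pos ha, map_mul, mul_smul, castSL_smul (γ a)]

lemma image_mem_nhds_of_deriv_ne_zero {f : ℂ → ℂ} (hf : DifferentiableOn ℂ f halfPlane) (σ : ℍ)
    (hd : deriv f σ ≠ 0) {s : Set ℍ} (hs : s ∈ 𝓝 σ) : (fun z : ℍ => f z) '' s ∈ 𝓝 (f σ) := by
  have h := (hf.analyticAt (halfPlane_mem_nhds σ.im_pos)).hasStrictDerivAt.map_nhds_eq hd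
  rw [← h, show (fun z : ℍ => f z) = f ∘ (↑) from rfl, Set.image_comp]
  exact image_mem_map (UpperHalfPlane.isOpenEmbedding_coe.image_mem_nhds.2 hs)

/-- The points that are alone in their fibre of `lambdaFun`, up to automorphisms. -/
def uniqueFiber : Set ℍ :=
  {τ | ∀ σ : ℍ, lambdaFun σ = lambdaFun τ → ∃ k ∈ autGroup lambdaFun, k • σ = τ}

/-- Let σ lie over τ. A good point τ' near τ has a preimage partner σ' near σ and some k with kσ' =
τ'. Since k is an isometry, kσ is near τ, and local injectivity of λ gives kσ = τ. -/
lemma isClosed_uniqueFiber : IsClosed uniqueFiber := by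
  refine isClosed_iff_frequently.2 fun τ hτ σ hσ => ?_
  obtain ⟨U, hU, hτU, hinj⟩ := exists_isOpen_injOn differentiableOn_lambdaFun τ
    (deriv_lambdaFun_ne_zero τ.im_pos)
  obtain ⟨r, hr, hrU⟩ := Metric.isOpen_iff.1 hU τ hτU
  have him := image_mem_nhds_of_deriv_ne_zero differentiableOn_lambdaFun σ
    (deriv_lambdaFun_ne_zero σ.im_pos) (Metric.ball_mem_nhds σ (half_pos hr))
  rw [hσ] at him
  obtain ⟨τ', hτ', ⟨σ', hσ', hL⟩, hd⟩ := (hτ.and_eventually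
    ((continuous_lambdaFun.continuousAt.eventually him).and
      (Metric.ball_mem_nhds τ (half_pos hr)))).exists
  obtain ⟨k, hk, hkσ⟩ := hτ' σ' hL
  refine ⟨k, hk, hinj (hrU ?_) hτU ((hk σ).trans hσ)⟩
  rw [Metric.mem_ball] at *
  have h1 : dist (k • σ) τ' = dist σ' σ := by rw [← hkσ, dist_smul, dist_comm]
  linarith [dist_triangle (k • σ) τ' τ]

/-- Suppose bad points tend to τ. By properness, their unreachable partners can be moved by
automorphisms to converge to a point over τ, hence to τ itself; local injectivity then identifies
them with the bad points, a contradiction. -/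
lemma isOpen_uniqueFiber : IsOpen uniqueFiber := by
  refine isOpen_iff_ultrafilter.2 fun τ hτ 𝓤 h𝓤 => ?_
  by_contra hN
  have hN' : ∀ᶠ τ' in (𝓤 : Filter ℍ), τ' ∉ uniqueFiber := Ultrafilter.compl_mem_iff_notMem.2 hN
  have hσ : ∀ τ' : ℍ, ∃ σ : ℍ, lambdaFun σ = lambdaFun τ' ∧
      (τ' ∉ uniqueFiber → ∀ k ∈ autGroup lambdaFun, k • σ ≠ τ') := by
    intro τ'
    by_cases h : τ' ∈ uniqueFiber
    · exact ⟨τ', rfl, fun h' => absurd h h'⟩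
    · simp only [uniqueFiber, Set.mem_ofPred_eq, not_forall] at h
      obtain ⟨σ, hσ, hk⟩ := h
      exact ⟨σ, hσ, fun _ k hk' hkσ => hk ⟨k, hk', hkσ⟩⟩
  choose σ hσ hne using hσ
  have hlim : Tendsto (fun τ' : ℍ => lambdaFun τ') 𝓤 (𝓝 (lambdaFun τ)) :=
    continuous_lambdaFun.continuousAt.mono_left h𝓤
  obtain ⟨k, σ₀, hk, hkσ⟩ := exists_tendsto_smul_autGroup 𝓤 (lambdaFun_ne_zero τ.im_pos)
    (lambdaFun_ne_one τ.im_pos) (u := σ) (by simpa only [hσ] using hlim)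
  have hσ₀ : lambdaFun σ₀ = lambdaFun τ := by
    refine tendsto_nhds_unique ((continuous_lambdaFun.tendsto σ₀).comp hkσ) (hlim.congr fun a => ?_)
    rw [Function.comp_apply, apply_smul_of_mem (hk a), hσ]
  obtain ⟨g, hg, hgσ⟩ := hτ σ₀ hσ₀
  obtain ⟨U, hU, hτU, hinj⟩ := exists_isOpen_injOn differentiableOn_lambdaFun τ
    (deriv_lambdaFun_ne_zero τ.im_pos)
  have h1 : ∀ᶠ τ' in (𝓤 : Filter ℍ), g • k τ' • σ τ' ∈ U := by
    refine (hkσ.const_smul g).eventually (hU.mem_nhds ?_)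
    rwa [hgσ]
  have h2 : ∀ᶠ τ' in (𝓤 : Filter ℍ), τ' ∈ U := h𝓤 (hU.mem_nhds hτU)
  obtain ⟨τ', h1, h2, h3⟩ := (h1.and (h2.and hN')).exists
  refine hne τ' h3 (g * k τ') (mul_mem hg (hk τ')) ?_
  rw [mul_smul]
  refine hinj h1 h2 ?_
  change lambdaFun _ = lambdaFun _
  rw [apply_smul_of_mem hg, apply_smul_of_mem (hk τ'), hσ]

lemma lambdaFun_add_two (τ : ℂ) : lambdaFun (τ + 2) = lambdaFun τ := by
  rw [show τ + 2 = τ + 1 + 1 by ring, lambdaFun_add_one, lambdaFun_add_one, inv_inv]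

/-- Injectivity of a function of the nome near the cusp `i∞`. -/
lemma exists_forall_eq_nome {f : ℂ → ℂ} (hf : ∀ τ : ℂ, 0 < τ.im → DifferentiableAt ℂ f τ)
    (hper : ∀ τ, f (τ + 2) = f τ) {b c : ℂ} (hc : c ≠ 0)  (hb : Tendsto f atInfty (𝓝 b))
    (h : Tendsto (fun τ => (f τ - b) / nome τ) atInfty (𝓝 c)) :
    ∃ M : ℝ, ∀ σ τ : ℂ, M < σ.im → M < τ.im → f σ = f τ → nome σ = nome τ := by
  have hperf : Function.Periodic f (2 : ℝ) := fun τ => by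
    push_cast
    exact hper τ
  have hq : ∀ τ, Function.Periodic.qParam 2 τ = nome τ := fun τ => by
    rw [Function.Periodic.qParam, nome]
    congr 1
    push_cast
    ring
  have hol : ∀ᶠ z in comap im atTop, DifferentiableAt ℂ f z :=
    (eventually_im_atInfty 0).mono hf
  have hbd : BoundedAtFilter (comap im atTop) f := hb.isBigO_one ℝ
  have hG : ∀ τ, Function.Periodic.cuspFunction 2 f (nome τ) = f τ := fun τ => by
    rw [← hq]
    exact Function.Periodic.eq_cuspFunction two_ne_zero hperf τ
  set G := Function.Periodic.cuspFunction 2 f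
  have hd0 : DifferentiableAt ℂ G 0 :=
    Function.Periodic.differentiableAt_cuspFunction_zero two_pos hperf hol hbd
  have han : AnalyticAt ℂ G 0 := by
    rw [Complex.analyticAt_iff_eventually_differentiableAt]
    have := Function.Periodic.eventually_differentiableAt_cuspFunction_nhds_ne_zero two_pos hperf hol
    rw [eventually_nhdsWithin_iff] at this
    filter_upwards [this] with q hq
    rcases eq_or_ne q 0 with rfl | h
    exacts [hd0, hq h]
  have hG0 : G 0 = b := tendsto_nhds_unique (l := atInfty)
    (Function.Periodic.tendsto_at_I_inf two_pos hperf hol hbd) hb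
  -- In the nome as local parameter, the expansion at i∞ says G'(0) = c ≠ 0, so G is injective near
  -- 0.
  have hderiv : deriv G 0 = c := by
    have h1 := hasDerivAt_iff_tendsto_slope.1 hd0.hasDerivAt
    have h2 : Tendsto nome atInfty (𝓝[≠] 0) :=
      tendsto_nhdsWithin_iff.2 ⟨tendsto_nome, Eventually.of_forall nome_ne_zero⟩
    refine tendsto_nhds_unique (h1.comp h2) (h.congr fun τ => ?_)
    rw [Function.comp_apply, slope_def_field, hG, hG0, sub_zero]
  obtain ⟨V, hV, hinj⟩ := exists_mem_nhds_injOn han (by rwa [hderiv])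
  obtain ⟨M, hM⟩ := eventually_atInfty.1 (tendsto_nome.eventually hV)
  refine ⟨M, fun σ τ hσ hτ h => hinj (hM σ hσ) (hM τ hτ) ?_⟩
  rw [hG, hG, h]

lemma exists_eq_add_of_nome_eq {σ τ : ℂ} (h : nome σ = nome τ) : ∃ n : ℤ, τ = σ + 2 * n := by
  rw [nome, nome, Complex.exp_eq_exp_iff_exists_int] at h
  obtain ⟨n, hn⟩ := h
  refine ⟨-n, ?_⟩
  have hpi : (Real.pi : ℂ) * I ≠ 0 := mul_ne_zero (by exact_mod_cast Real.pi_ne_zero) I_ne_zero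
  refine mul_left_cancel₀ hpi ?_
  push_cast
  linear_combination -hn

lemma tendsto_lambdaFun_sub_one :
    Tendsto (fun τ => (lambdaFun τ - 1) / nome τ) atInfty (𝓝 (-16)) := by
  have h := tendsto_pFun_sub_one.mul (((tendsto_pFun.pow 3).add (tendsto_pFun.pow 2)).add
    (tendsto_pFun.add_const 1))
  norm_num at h
  refine h.congr fun τ => ?_
  rw [lambdaFun]
  ring

lemma exists_smul_eq_of_nome_eq {σ τ : ℍ} (h : nome σ = nome τ) :
    ∃ n : ℤ, ModularGroup.T ^ (2 * n) • σ = τ := by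
  obtain ⟨n, hn⟩ := exists_eq_add_of_nome_eq h
  refine ⟨n, UpperHalfPlane.ext ?_⟩
  rw [UpperHalfPlane.modular_T_zpow_smul, UpperHalfPlane.coe_vadd, hn]
  push_cast
  ring

lemma lambdaFun_T_zpow_smul (n : ℤ) (τ : ℍ) :
    lambdaFun ↑(ModularGroup.T ^ (2 * n) • τ) = lambdaFun τ := by
  have hper : Function.Periodic lambdaFun 2 := lambdaFun_add_two
  rw [UpperHalfPlane.modular_T_zpow_smul, UpperHalfPlane.coe_vadd, add_comm]
  push_cast
  rw [mul_comm]
  exact hper.int_mul n _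

/-- Points near i∞ are good. A partner, reduced to the fundamental domain, must also tend to i∞,
since λ → 1. Of the six substitutions only z and 1/z preserve the limit 1, and T absorbs the second;
injectivity in the nome then leaves a translation by an even integer. -/
lemma nonempty_uniqueFiber : uniqueFiber.Nonempty := by
  by_contra hempty
  rw [Set.not_nonempty_iff_eq_empty] at hempty
  have hσ : ∀ τ : ℍ, ∃ σ : ℍ, lambdaFun σ = lambdaFun τ ∧
      ∀ k ∈ autGroup lambdaFun, k • σ ≠ τ := by
    intro τ
    have h : τ ∉ uniqueFiber := by simp [hempty]
    simp only [uniqueFiber, Set.mem_ofPred_eq, not_forall] at h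
    obtain ⟨σ, hσ, hk⟩ := h
    exact ⟨σ, hσ, fun k hk' hkσ => hk ⟨k, hk', hkσ⟩⟩
  choose σ hσ hne using hσ
  choose γ hγ using fun τ => ModularGroup.exists_smul_mem_fd (σ τ)
  choose i hi using lambdaFun_smul
  set 𝓤 := Ultrafilter.of UpperHalfPlane.atImInfty
  have h𝓤 : (𝓤 : Filter ℍ) ≤ UpperHalfPlane.atImInfty := Ultrafilter.of_le _
  obtain ⟨j, hj⟩ := exists_eventually_eq_of_finite 𝓤 fun τ => i (γ τ)⁻¹
  have hL : ∀ᶠ τ : ℍ in (𝓤 : Filter ℍ), lambdaFun τ = anharmonic j (lambdaFun ↑(γ τ • σ τ)) := by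
    filter_upwards [hj] with τ hτ
    rw [← hτ, ← hi, inv_smul_smul, hσ]
  have hlim : Tendsto (fun τ : ℍ => lambdaFun τ) 𝓤 (𝓝 1) :=
    (tendsto_lambdaFun.comp tendsto_coe_atImInfty).mono_left h𝓤
  have hbig : Tendsto (fun τ => ((γ τ • σ τ : ℍ) : ℂ)) 𝓤 atInfty := by
    refine tendsto_comap_iff.2 (tendsto_atTop.2 fun M => ?_)
    by_contra hM
    have hM' : ∀ᶠ τ in (𝓤 : Filter ℍ), (γ τ • σ τ).im ≤ M := by
      filter_upwards [Ultrafilter.compl_mem_iff_notMem.2 hM] with τ hτ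
      exact le_of_not_ge hτ
    have hmem : ModularGroup.truncatedFundamentalDomain M ∈ 𝓤.map fun τ => γ τ • σ τ := by
      change ∀ᶠ τ in (𝓤 : Filter ℍ), γ τ • σ τ ∈ ModularGroup.truncatedFundamentalDomain M
      filter_upwards [hM'] with τ hτ using ⟨hγ τ, hτ⟩
    obtain ⟨σ₀, -, hσ₀⟩ := (ModularGroup.isCompact_truncatedFundamentalDomain
      M).ultrafilter_le_nhds _ (le_principal_iff.2 hmem)
    have h1 : Tendsto (fun τ => lambdaFun ↑(γ τ • σ τ)) 𝓤 (𝓝 (lambdaFun σ₀)) :=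
      (continuous_lambdaFun.tendsto σ₀).comp hσ₀
    have h2 := ((continuousAt_anharmonic j (lambdaFun_ne_zero σ₀.im_pos)
      (lambdaFun_ne_one σ₀.im_pos)).tendsto.comp h1)
    exact anharmonic_ne_one j (lambdaFun_ne_zero σ₀.im_pos) (lambdaFun_ne_one σ₀.im_pos)
      (tendsto_nhds_unique h2 (hlim.congr' hL))
  have hlim' : Tendsto (fun τ => lambdaFun ↑(γ τ • σ τ)) 𝓤 (𝓝 1) := tendsto_lambdaFun.comp hbig
  have hlimj := hlim.congr' hL
  have hj01 : j = 0 ∨ j = 1 := by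
    have hinv : Tendsto (fun τ => (lambdaFun ↑(γ τ • σ τ))⁻¹) 𝓤 (𝓝 1) := by
      simpa using hlim'.inv₀ one_ne_zero
    have no : ∀ {f : ℍ → ℂ}, Tendsto f 𝓤 (𝓝 1) → ¬ Tendsto (fun τ => 1 - f τ) 𝓤 (𝓝 1) := by
      intro f hf h
      have := tendsto_nhds_unique h (hf.const_sub 1)
      simp at this
    have no' : ∀ {f : ℍ → ℂ}, Tendsto f 𝓤 (𝓝 1) → ¬ Tendsto (fun τ => (1 - f τ)⁻¹) 𝓤 (𝓝 1) := by
      intro f hf h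
      refine no hf ?_
      simpa using h.inv₀ one_ne_zero
    fin_cases j
    · exact Or.inl rfl
    · exact Or.inr rfl
    · exact absurd hlimj (no hlim')
    · exact absurd hlimj (no' hlim')
    · exact absurd hlimj (no hinv)
    · exact absurd hlimj (no' hinv)
  obtain ⟨M, hM⟩ := exists_forall_eq_nome (fun τ hτ => differentiableAt_lambdaFun hτ)
    lambdaFun_add_two (by norm_num) tendsto_lambdaFun tendsto_lambdaFun_sub_one
  have hbig' : ∀ᶠ τ : ℍ in (𝓤 : Filter ℍ), M < τ.im :=
    (tendsto_coe_atImInfty.mono_left h𝓤).eventually (eventually_im_atInfty M)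
  obtain ⟨τ, hjτ, hτM, hσM⟩ :=
    (hj.and (hbig'.and (hbig.eventually (eventually_im_atInfty M)))).exists
  have finish : ∀ δ : SL(2, ℤ), (∀ z : ℍ, lambdaFun ↑(δ • z) = lambdaFun z) →
      M < (δ • σ τ).im → False := by
    intro δ hδ hδM
    obtain ⟨n, hn⟩ := exists_smul_eq_of_nome_eq (σ := δ • σ τ) (τ := τ)
      (hM _ _ hδM hτM (by rw [hδ, hσ]))
    refine hne τ (castSL (ModularGroup.T ^ (2 * n) * δ)) (castSL_mem_autGroup fun z => ?_) ?_
    · rw [mul_smul, lambdaFun_T_zpow_smul, hδ]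
    · rw [castSL_smul, mul_smul, hn]
  have hi' : ∀ z : ℍ, lambdaFun z = anharmonic j (lambdaFun ↑(γ τ • z)) := fun z => by
    rw [← hjτ, ← hi, inv_smul_smul]
  rcases hj01 with rfl | rfl
  · exact finish (γ τ) (fun z => (hi' z).symm) hσM
  · refine finish (ModularGroup.T * γ τ) (fun z => ?_) ?_
    · rw [mul_smul, lambdaFun_T_smul]
      exact (hi' z).symm
    · rw [mul_smul, UpperHalfPlane.modular_T_smul, UpperHalfPlane.vadd_im]
      exact hσM

/-- The fibres of `ϑ₄⁴ / ϑ₃⁴` are orbits of its automorphism group. -/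
lemma exists_smul_eq_of_lambdaFun_eq {σ τ : ℍ} (h : lambdaFun σ = lambdaFun τ) :
    ∃ k ∈ autGroup lambdaFun, k • σ = τ := by
  have : uniqueFiber = Set.univ :=
    IsClopen.eq_univ ⟨isClosed_uniqueFiber, isOpen_uniqueFiber⟩ nonempty_uniqueFiber
  have hτ : τ ∈ uniqueFiber := this ▸ Set.mem_univ τ
  exact hτ σ h

end Fibers

/-! ### Functions composed with linear-fractional substitutions -/

section Substitution

/-- The linear-fractional substitution of a real unimodular matrix. -/
def moebius (g : SL(2, ℝ)) (τ : ℂ) : ℂ := (g 0 0 * τ + g 0 1) / (g 1 0 * τ + g 1 1)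

lemma moebius_eq_smul (g : SL(2, ℝ)) (τ : ℍ) : moebius g τ = ↑(g • τ) := by
  rw [UpperHalfPlane.coe_specialLinearGroup_apply, moebius]
  rfl

lemma im_moebius_pos (g : SL(2, ℝ)) {τ : ℂ} (hτ : 0 < τ.im) : 0 < (moebius g τ).im := by
  have := (g • (⟨τ, hτ⟩ : ℍ)).im_pos
  rwa [← UpperHalfPlane.coe_im, ← moebius_eq_smul] at this

lemma differentiableAt_moebius (g : SL(2, ℝ)) {τ : ℂ} (hτ : 0 < τ.im) :
    DifferentiableAt ℂ (moebius g) τ := by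
  refine DifferentiableAt.div (by fun_prop) (by fun_prop) fun h => ?_
  have := im_moebius_pos g hτ
  rw [moebius, h, div_zero] at this
  simp at this

lemma differentiableOn_comp_moebius (g : SL(2, ℝ)) {f : ℂ → ℂ} (hf : DifferentiableOn ℂ f halfPlane) :
    DifferentiableOn ℂ (fun τ => f (moebius g τ)) halfPlane := fun τ hτ =>
  ((hf.differentiableAt (halfPlane_mem_nhds (im_moebius_pos g hτ))).comp τ
    (differentiableAt_moebius g hτ)).differentiableWithinAt

lemma forall_im_pos_iff {P : ℂ → Prop} : (∀ τ : ℂ, 0 < τ.im → P τ) ↔ ∀ τ : ℍ, P τ :=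
  ⟨fun h τ => h τ τ.im_pos, fun h τ hτ => h ⟨τ, hτ⟩⟩

/-- A nonvanishing function acquires a root of unity from a substitution that preserves its `n`-th
power. -/
lemma exists_smul_eq_const_mul {f : ℂ → ℂ} (hf : DifferentiableOn ℂ f halfPlane)
    (h0 : ∀ τ : ℂ, 0 < τ.im → f τ ≠ 0) {n : ℕ} (hn : n ≠ 0) {g : SL(2, ℝ)}
    (h : ∀ τ : ℍ, f ↑(g • τ) ^ n = f τ ^ n) :
    ∃ ζ : ℂ, ζ ^ n = 1 ∧ ∀ τ : ℍ, f ↑(g • τ) = ζ * f τ := by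
  simp only [← moebius_eq_smul] at *
  obtain ⟨ζ, hζ, h⟩ := exists_eq_const_mul (differentiableOn_comp_moebius g hf) hf h0 hn
    (forall_im_pos_iff.2 h)
  exact ⟨ζ, hζ, fun τ => h τ τ.im_pos⟩

lemma mem_autGroup_of_pow_eq {f : ℂ → ℂ} (hf : DifferentiableOn ℂ f halfPlane)
    (h0 : ∀ τ : ℂ, 0 < τ.im → f τ ≠ 0) {n : ℕ} (hn : n ≠ 0) {g : SL(2, ℝ)}
    (h : ∀ τ : ℍ, f ↑(g • τ) ^ n = f τ ^ n) {σ : ℍ} (hσ : f ↑(g • σ) = f σ) : g ∈ autGroup f := by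
  obtain ⟨ζ, -, hζ⟩ := exists_smul_eq_const_mul hf h0 hn h
  have h1 : ζ = 1 := by
    rw [hζ] at hσ
    exact mul_right_cancel₀ (h0 σ σ.im_pos) (by rw [hσ, one_mul])
  intro τ
  rw [hζ, h1, one_mul]

end Substitution

/-! ### The relation between x and p as a quartic in x -/

section Quartic

/-- The expression is ∂F/∂x. Eliminating p between F and ∂F/∂x leaves x³(x⁴ − 1)² = 0, so off the
punctures x is a simple root for given p. -/
lemma divided_difference_ne_zero {x p : ℂ} (hx : x ≠ 0) (hx1 : x ^ 4 ≠ 1)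
    (h : 2 * x * p ^ 2 - (x ^ 4 - 1) * p - 2 * x ^ 3 = 0) :
    2 * p ^ 2 - 4 * x ^ 3 * p - 6 * x ^ 2 ≠ 0 := by
  intro h0
  have h1 : (3 * x ^ 4 + 1) * p + 4 * x ^ 3 = 0 := by linear_combination h - x * h0
  have h2 : x ^ 3 * (x ^ 4 - 1) ^ 2 = 0 := by
    linear_combination (-(3 * x ^ 4 + 1) ^ 2 / 6) * h + (2 * x * ((3 * x ^ 4 + 1) * p - 4 * x ^ 3) -
      (x ^ 4 - 1) * (3 * x ^ 4 + 1)) / 6 * h1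
  exact mul_ne_zero (pow_ne_zero 3 hx) (pow_ne_zero 2 (sub_ne_zero.2 hx1)) h2

/-- For p² = 1 the relation squares to (x² − 1)⁴ = 0, and for p² = −1 to (x² + 1)⁴ = 0. It keeps λ
away from 1 as long as x stays away from the punctures. -/
lemma pow_four_eq_one_of_quartic {x p : ℂ} (hp : p ^ 4 = 1)
    (h : 2 * x * p ^ 2 - (x ^ 4 - 1) * p - 2 * x ^ 3 = 0) : x ^ 4 = 1 := by
  have key : (x ^ 4 - 1) ^ 4 = 0 := by
    have h2 : (2 * x * p ^ 2 - 2 * x ^ 3) ^ 4 = (x ^ 4 - 1) ^ 4 := by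
      rw [show 2 * x * p ^ 2 - 2 * x ^ 3 = (x ^ 4 - 1) * p by linear_combination h, mul_pow, hp,
        mul_one]
    have h3 : (p ^ 2 - 1) * (p ^ 2 + 1) = 0 := by linear_combination hp
    rcases mul_eq_zero.1 h3 with h3 | h3
    · have e : p ^ 2 = 1 := by linear_combination h3
      have h4 : (x ^ 2 - 1) ^ 4 = 0 := by
        have : (2 * x - 2 * x ^ 3) ^ 2 = (x ^ 4 - 1) ^ 2 := by
          rw [show 2 * x - 2 * x ^ 3 = (x ^ 4 - 1) * p by linear_combination h - 2 * x * e, mul_pow,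
            e, mul_one]
        linear_combination -this
      have h5 : x ^ 2 - 1 = 0 := pow_eq_zero_iff (by norm_num) |>.1 h4
      rw [show x ^ 4 - 1 = (x ^ 2 - 1) * (x ^ 2 + 1) by ring, h5]
      ring
    · have e : p ^ 2 = -1 := by linear_combination h3
      have h4 : (x ^ 2 + 1) ^ 4 = 0 := by
        have : (-2 * x - 2 * x ^ 3) ^ 2 = -(x ^ 4 - 1) ^ 2 := by
          rw [show -2 * x - 2 * x ^ 3 = (x ^ 4 - 1) * p by linear_combination h - 2 * x * e,
            mul_pow, e]
          ring
        linear_combination this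
      have h5 : x ^ 2 + 1 = 0 := pow_eq_zero_iff (by norm_num) |>.1 h4
      rw [show x ^ 4 - 1 = (x ^ 2 - 1) * (x ^ 2 + 1) by ring, h5]
      ring
  exact sub_eq_zero.1 (pow_eq_zero_iff (by norm_num) |>.1 key)

lemma finite_setOf_pow_four_eq (c : ℂ) : {w : ℂ | w ^ 4 = c}.Finite := by
  have h := Polynomial.finite_setOfPred_isRoot (p := (Polynomial.X ^ 4 - Polynomial.C c))
    (Polynomial.X_pow_sub_C_ne_zero (by norm_num) c)
  refine h.subset fun w hw => ?_
  have hw' : w ^ 4 = c := hw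
  simp [Polynomial.IsRoot, hw']

lemma finite_setOf_quartic {p : ℂ} (hp : p ≠ 0) :
    {x : ℂ | 2 * x * p ^ 2 - (x ^ 4 - 1) * p - 2 * x ^ 3 = 0}.Finite := by
  open Polynomial in
  set P : ℂ[X] := 2 * X * C p ^ 2 - (X ^ 4 - 1) * C p - 2 * X ^ 3
  have hP : ∀ x, P.eval x = 2 * x * p ^ 2 - (x ^ 4 - 1) * p - 2 * x ^ 3 := fun x => by simp [P]
  have hP0 : P ≠ 0 := by
    intro h
    have := hP 0
    rw [h] at this
    simp at this
    exact hp this.symm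
  refine (Polynomial.finite_setOfPred_isRoot hP0).subset fun x hx => ?_
  exact (hP x).trans hx

lemma mem_punctures_iff {x : ℂ} : x ∈ punctures ↔ x = 0 ∨ x ^ 4 = 1 := by
  have h : x ^ 4 = 1 ↔ x = 1 ∨ x = -1 ∨ x = I ∨ x = -I := by
    rw [← sub_eq_zero, show x ^ 4 - 1 = (x - 1) * ((x + 1) * ((x - I) * (x + I))) by
      linear_combination (x ^ 2 - 1) * I_sq]
    simp only [mul_eq_zero, sub_eq_zero, add_eq_zero_iff_eq_neg]
  simp only [punctures, Set.mem_insert_iff, Set.mem_singleton_iff, h]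

end Quartic

/-! ### From λ to x: automorphisms and the range of x -/

lemma differentiableOn_pFun : DifferentiableOn ℂ pFun halfPlane :=
  differentiableOn_halfPlane fun _ hτ => differentiableAt_pFun hτ

lemma differentiableOn_xFun : DifferentiableOn ℂ xFun halfPlane :=
  differentiableOn_halfPlane fun _ hτ => differentiableAt_xFun hτ

lemma differentiableOn_yFun : DifferentiableOn ℂ yFun halfPlane :=
  differentiableOn_halfPlane fun _ hτ => differentiableAt_yFun hτ

lemma continuous_coe_of_differentiableOn {f : ℂ → ℂ} (hf : DifferentiableOn ℂ f halfPlane) :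
    Continuous fun τ : ℍ => f τ :=
  continuous_iff_continuousAt.2 fun τ =>
    ContinuousAt.comp (f := ((↑) : ℍ → ℂ))
      (hf.differentiableAt (halfPlane_mem_nhds τ.im_pos)).continuousAt
      UpperHalfPlane.continuous_coe.continuousAt

lemma mem_autGroup_pFun {k : SL(2, ℝ)} (hk : k ∈ autGroup lambdaFun) {σ : ℍ}
    (hσ : pFun ↑(k • σ) = pFun σ) : k ∈ autGroup pFun :=
  mem_autGroup_of_pow_eq differentiableOn_pFun (fun _ h => pFun_ne_zero h) four_ne_zero hk hσ

/-- Both x ∘ k and x solve the quartic with the same p. They agree at σ, where the root is simple,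
hence everywhere. -/
lemma mem_autGroup_xFun {k : SL(2, ℝ)} (hk : k ∈ autGroup pFun) {σ : ℍ}
    (hσ : xFun ↑(k • σ) = xFun σ) : k ∈ autGroup xFun := by
  have hk' : ∀ τ : ℂ, 0 < τ.im → pFun (moebius k τ) = pFun τ :=
    forall_im_pos_iff.2 fun τ => by rw [moebius_eq_smul, apply_smul_of_mem hk]
  have hσ' : xFun (moebius k σ) = xFun σ := by rw [moebius_eq_smul, hσ]
  intro τ
  rw [← moebius_eq_smul]
  have hd := differentiableOn_comp_moebius k differentiableOn_xFun
  have hcont {f : ℂ → ℂ} (hf : DifferentiableOn ℂ f halfPlane) : ContinuousAt f σ :=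
    (hf.differentiableAt (halfPlane_mem_nhds σ.im_pos)).continuousAt
  have c1 := hcont hd
  have c2 := hcont differentiableOn_xFun
  have c3 := hcont differentiableOn_pFun
  refine eqOn_of_mul_eq_zero (f := fun τ => xFun (moebius k τ)) (g := xFun) hd
    differentiableOn_xFun σ.im_pos (D := fun τ => 2 * pFun τ ^ 2 - (xFun (moebius k τ) ^ 3 +
      xFun (moebius k τ) ^ 2 * xFun τ + xFun (moebius k τ) * xFun τ ^ 2 + xFun τ ^ 3) * pFun τ -
      2 * (xFun (moebius k τ) ^ 2 + xFun (moebius k τ) * xFun τ + xFun τ ^ 2)) ?_ ?_ ?_ τ.im_pos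
  · fun_prop
  · have := divided_difference_ne_zero (xFun_ne_zero σ.im_pos) (xFun_pow_four_ne_one σ.im_pos)
      (xFun_pFun σ.im_pos)
    simp only [hσ']
    convert this using 1
    ring
  · intro τ hτ
    have h1 := xFun_pFun hτ
    have h2 := xFun_pFun (im_moebius_pos k hτ)
    rw [hk' τ hτ] at h2
    linear_combination h2 - h1

lemma mem_autGroup_yFun {k : SL(2, ℝ)} (hp : k ∈ autGroup pFun) (hx : k ∈ autGroup xFun) :
    k ∈ autGroup yFun := fun τ => by
  rw [yFun, yFun, apply_smul_of_mem hp, apply_smul_of_mem hx]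

/-- There are only finitely many functions `x ∘ γ` with `γ ∈ SL(2, ℤ)`. -/
lemma exists_eventually_xFun_smul_eq {α : Type*} (𝓤 : Ultrafilter α) (γ : α → SL(2, ℤ)) :
    ∃ δ : SL(2, ℤ), ∀ᶠ a in (𝓤 : Filter α), ∀ τ : ℍ, xFun ↑(γ a • τ) = xFun ↑(δ • τ) := by
  choose i hi using lambdaFun_smul
  obtain ⟨i₀, hi₀⟩ := exists_eventually_eq_of_finite 𝓤 fun a => i (γ a)
  -- The function x ∘ γ is determined by the substitution of λ and by the values of p and x at the
  -- single point γw, and each of these has finitely many possibilities.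
  set w : ℍ := UpperHalfPlane.I
  obtain ⟨p₀, hp₀, hp⟩ := (Ultrafilter.eventually_exists_mem_iff (f := 𝓤)
    (P := fun p a => pFun ↑(γ a • w) = p)
    (finite_setOf_pow_four_eq (anharmonic i₀ (lambdaFun w)))).1 (by
      filter_upwards [hi₀] with a ha
      refine ⟨_, ?_, rfl⟩
      change lambdaFun _ = _
      rw [hi, ha])
  obtain ⟨x₀, -, hx⟩ := (Ultrafilter.eventually_exists_mem_iff (f := 𝓤)
    (P := fun x a => xFun ↑(γ a • w) = x) (finite_setOf_quartic (p := p₀) (by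
      obtain ⟨a, ha⟩ := hp.exists
      rw [← ha]
      exact pFun_ne_zero (γ a • w).im_pos))).1 (by
      filter_upwards [hp] with a ha
      refine ⟨_, ?_, rfl⟩
      rw [← ha]
      exact xFun_pFun (γ a • w).im_pos)
  obtain ⟨b, hb1, hb2, hb3⟩ := (hi₀.and (hp.and hx)).exists
  refine ⟨γ b, ?_⟩
  filter_upwards [hi₀, hp, hx] with a h1 h2 h3 τ
  set k := castSL (γ a * (γ b)⁻¹)
  have hkb : ∀ τ : ℍ, k • γ b • τ = γ a • τ := fun τ => by
    rw [castSL_smul, mul_smul, inv_smul_smul]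
  have hk : k ∈ autGroup lambdaFun := castSL_mem_autGroup fun z => by
    rw [mul_smul, hi (γ a), h1, ← hb1, ← hi (γ b), smul_inv_smul]
  have hkp := mem_autGroup_pFun hk (σ := γ b • w) (by rw [hkb, h2, hb2])
  have hkx := mem_autGroup_xFun hkp (σ := γ b • w) (by rw [hkb, h3, hb3])
  rw [← hkb, apply_smul_of_mem hkx]

lemma tendsto_xFun : Tendsto xFun atInfty (𝓝 1) := by
  have h := tendsto_sixth₄.div tendsto_sixth₃ one_ne_zero
  rw [div_one] at h
  refine h.congr' ?_
  filter_upwards [eventually_im_atInfty 0] with τ hτ using (xFun_eq hτ).symm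

lemma exists_yFun_ne_zero : ∃ τ : ℍ, yFun τ ≠ 0 := by
  have h : Tendsto (fun τ => xFun τ ^ 8 + 14 * xFun τ ^ 4 + 1) atInfty (𝓝 16) := by
    have := ((tendsto_xFun.pow 8).add ((tendsto_xFun.pow 4).const_mul 14)).add_const 1
    norm_num at this
    exact this
  obtain ⟨τ, h1, h2⟩ := ((h.eventually_ne (by norm_num : (16 : ℂ) ≠ 0)).and
    (eventually_im_atInfty 0)).exists
  exact ⟨⟨τ, h2⟩, (yFun_ne_zero_iff h2).2 h1⟩

lemma isOpen_range_xFun : IsOpen (Set.range fun τ : ℍ => xFun τ) := by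
  have han := differentiableOn_xFun.analyticOnNhd isOpen_halfPlane
  have himage : (Set.range fun τ : ℍ => xFun τ) = xFun '' halfPlane := by
    ext c
    constructor
    · rintro ⟨τ, rfl⟩
      exact ⟨τ, τ.im_pos, rfl⟩
    · rintro ⟨τ, hτ, rfl⟩
      exact ⟨⟨τ, hτ⟩, rfl⟩
  rcases han.is_constant_or_isOpen isPreconnected_halfPlane with ⟨w, hw⟩ | h
  · exfalso
    obtain ⟨τ, hτ⟩ := exists_yFun_ne_zero
    refine (deriv_xFun_ne_zero_iff_yFun τ.im_pos).2 hτ ?_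
    rw [EventuallyEq.deriv_eq (f := fun _ => w)]
    · simp
    · filter_upwards [halfPlane_mem_nhds τ.im_pos] with σ hσ using hw σ hσ
  · rw [himage]
    exact h halfPlane subset_rfl isOpen_halfPlane

/-- Let x tend to c along an ultrafilter. Then y is bounded and converges, hence so does p, and λ
has a limit other than 0 and 1. By properness the points converge after moving by SL(2, ℤ), and only
finitely many functions x ∘ γ occur, so c is a value. -/
lemma closure_range_xFun {c : ℂ} (hc : c ∈ closure (Set.range fun τ : ℍ => xFun τ))
    (hcp : c ∉ punctures) : ∃ τ : ℍ, xFun τ = c := by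
  rw [mem_punctures_iff, not_or] at hcp
  have hne : (comap (fun τ : ℍ => xFun τ) (𝓝 c)).NeBot := by
    rw [comap_neBot_iff]
    intro t ht
    obtain ⟨z, hz, τ, rfl⟩ := mem_closure_iff_nhds.1 hc t ht
    exact ⟨τ, hz⟩
  set 𝓤 := Ultrafilter.of (comap (fun τ : ℍ => xFun τ) (𝓝 c))
  have hx : Tendsto (fun τ : ℍ => xFun τ) 𝓤 (𝓝 c) := tendsto_comap.mono_left (Ultrafilter.of_le _)
  have hy2 : Tendsto (fun τ : ℍ => yFun τ ^ 2) 𝓤 (𝓝 (c ^ 8 + 14 * c ^ 4 + 1)) := by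
    refine (((hx.pow 8).add ((hx.pow 4).const_mul 14)).add_const 1).congr fun τ => ?_
    exact (yFun_sq τ.im_pos).symm
  obtain ⟨y₀, hy⟩ : ∃ y₀, Tendsto (fun τ : ℍ => yFun τ) 𝓤 (𝓝 y₀) := by
    set R := ‖c ^ 8 + 14 * c ^ 4 + 1‖ + 1
    have hR : 1 ≤ R := le_add_of_nonneg_left (norm_nonneg _)
    have hmem : Metric.closedBall 0 R ∈ 𝓤.map fun τ : ℍ => yFun τ := by
      change ∀ᶠ τ : ℍ in (𝓤 : Filter ℍ), yFun τ ∈ Metric.closedBall 0 R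
      filter_upwards [hy2.norm.eventually_lt_const (lt_add_one _)] with τ hτ
      rw [mem_closedBall_zero_iff]
      rw [norm_pow] at hτ
      by_contra! h
      nlinarith
    obtain ⟨y₀, -, h⟩ := (isCompact_closedBall (0 : ℂ) R).ultrafilter_le_nhds _
      (le_principal_iff.2 hmem)
    exact ⟨y₀, h⟩
  have hp : Tendsto (fun τ : ℍ => pFun τ) 𝓤 (𝓝 ((c ^ 4 - y₀ - 1) / (4 * c))) := by
    refine ((((hx.pow 4).sub hy).sub_const 1).div (hx.const_mul 4)
      (mul_ne_zero (by norm_num) hcp.1)).congr fun τ => ?_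
    exact (pFun_eq_of_yFun τ.im_pos).symm
  set p₀ := (c ^ 4 - y₀ - 1) / (4 * c)
  have hF : 2 * c * p₀ ^ 2 - (c ^ 4 - 1) * p₀ - 2 * c ^ 3 = 0 := by
    have := (((hx.const_mul 2).mul (hp.pow 2)).sub (((hx.pow 4).sub_const 1).mul hp)).sub
      ((hx.pow 3).const_mul 2)
    refine tendsto_nhds_unique this ?_
    refine tendsto_const_nhds.congr fun τ => ?_
    exact (xFun_pFun τ.im_pos).symm
  have hp0 : p₀ ^ 4 ≠ 0 := by
    refine pow_ne_zero 4 fun h => ?_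
    rw [h] at hF
    exact pow_ne_zero 3 hcp.1 (by linear_combination -hF / 2)
  have hp1 : p₀ ^ 4 ≠ 1 := fun h => hcp.2 (pow_four_eq_one_of_quartic h hF)
  obtain ⟨γ, σ, hσ⟩ := exists_tendsto_smul 𝓤 (u := id) hp0 hp1 (hp.pow 4)
  obtain ⟨δ, hδ⟩ := exists_eventually_xFun_smul_eq 𝓤 fun a => (γ a)⁻¹
  refine ⟨δ • σ, ?_⟩
  have h1 : Tendsto (fun a => xFun ↑(δ • γ a • a)) 𝓤 (𝓝 (xFun ↑(δ • σ))) := by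
    have := ((continuous_coe_of_differentiableOn differentiableOn_xFun).tendsto
      (castSL δ • σ)).comp (hσ.const_smul (castSL δ))
    simpa only [castSL_smul, Function.comp_def, id] using this
  refine tendsto_nhds_unique (h1.congr' ?_) hx
  filter_upwards [hδ] with a ha
  rw [← ha, inv_smul_smul]

/-- Every complex number which is not a puncture is a value of `x`. -/
lemma exists_xFun_eq {c : ℂ} (hc : c ∉ punctures) : ∃ τ : ℍ, xFun τ = c := by
  have hconn : IsPreconnected puncturesᶜ := by
    refine (Set.Countable.isConnected_compl_of_one_lt_rank ?_ ?_).isPreconnected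
    · rw [Complex.rank_real_complex]
      exact_mod_cast one_lt_two
    · exact Set.Finite.countable (by simp [punctures])
  have hsub := hconn.subset_of_closure_inter_subset isOpen_range_xFun
    ⟨xFun UpperHalfPlane.I, ?_, UpperHalfPlane.I, rfl⟩ ?_
  · exact hsub hc
  · rw [Set.mem_compl_iff, mem_punctures_iff, not_or]
    exact ⟨xFun_ne_zero UpperHalfPlane.I.im_pos, xFun_pow_four_ne_one UpperHalfPlane.I.im_pos⟩
  · rintro z ⟨h1, h2⟩
    exact closure_range_xFun h1 h2

/-! ### The involution exchanging the sheets of Schwarz's curve -/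

section Involution

/-- With u = −1/τ the substitution becomes u ↦ u − 4, which preserves ϑ₃ and changes the sign of ϑ₂.
-/
lemma pFun_div_four_mul_add_one {τ : ℂ} (hτ : 0 < τ.im) : pFun (τ / (4 * τ + 1)) = -pFun τ := by
  have h0 := ne_zero_of_im_pos hτ
  set u := -1 / τ
  have hu : 0 < u.im := im_neg_one_div_pos hτ
  have hw : 0 < (u - 4).im := by simpa using hu
  have h1 : pFun τ = null₂ u / null₃ u := by
    rw [← pFun_inversion hu]
    congr 1
    simp only [u]
    field_simp
  have h41 : 4 * τ + 1 ≠ 0 := by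
    intro h
    have := congr_arg Complex.im h
    simp at this
    exact hτ.ne' this
  have h2 : pFun (τ / (4 * τ + 1)) = null₂ (u - 4) / null₃ (u - 4) := by
    rw [← pFun_inversion hw]
    congr 1
    have e : u - 4 = -(4 * τ + 1) / τ := by
      simp only [u]
      field_simp
      ring
    rw [e, div_div_eq_mul_div, neg_one_mul, neg_div_neg_eq]
  have h3 : null₃ u = null₃ (u - 4) := by
    rw [show u = u - 4 + 1 + 1 + 1 + 1 by ring, null₃_add_one, null₄_add_one, null₃_add_one,
      null₄_add_one]
    ring_nf
  have h4 : null₂ u = -null₂ (u - 4) := by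
    have he : cexp (Real.pi * I / 4) ^ 4 = -1 := by
      rw [← Complex.exp_nat_mul, ← Complex.exp_pi_mul_I]
      congr 1
      push_cast
      ring
    have : null₂ (u - 4 + 1 + 1 + 1 + 1) = cexp (Real.pi * I / 4) ^ 4 * null₂ (u - 4) := by
      rw [null₂_add_one, null₂_add_one, null₂_add_one, null₂_add_one]
      ring
    rw [he] at this
    rw [show u = u - 4 + 1 + 1 + 1 + 1 by ring, this]
    ring_nf
  rw [h1, h2, h3, h4]
  ring

/-- The elliptic substitution `τ ↦ (3τ - 1) / (12τ - 3)`. -/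
def sheetSwap : SL(2, ℝ) :=
  -- The integral matrix (3, −1; 12, −3) has determinant 3, hence the division by √3.
  ⟨!![√3, -1 / √3; 4 * √3, -√3], by
    rw [Matrix.det_fin_two_of]
    have h : √3 * √3 = 3 := Real.mul_self_sqrt (by norm_num)
    have h0 : √3 ≠ 0 := by positivity
    field_simp
    nlinarith⟩

lemma coe_sheetSwap_smul (τ : ℍ) : ((sheetSwap • τ : ℍ) : ℂ) = (3 * τ - 1) / (12 * τ - 3) := by
  have h0 : ((√3 : ℝ) : ℂ) ≠ 0 := by
    exact_mod_cast (Real.sqrt_pos.2 (by norm_num : (0 : ℝ) < 3)).ne'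
  have h : ((√3 : ℝ) : ℂ) ^ 2 = 3 := by
    rw [← ofReal_pow, Real.sq_sqrt (by norm_num)]
    norm_num
  rw [← moebius_eq_smul, moebius]
  simp only [sheetSwap, Matrix.of_apply, Matrix.cons_val', Matrix.cons_val_zero,
    Matrix.cons_val_one, Matrix.cons_val_fin_one]
  push_cast
  rw [← mul_div_mul_left _ _ h0]
  congr 1
  · field_simp
    linear_combination (τ : ℂ) * h
  · linear_combination (4 * (τ : ℂ) - 1) * h

lemma pFun_sheetSwap_smul (τ : ℍ) : pFun ↑(sheetSwap • τ) * pFun (3 * τ) = -1 := by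
  have h1 : 0 < (3 * (τ : ℂ) - 1).im := by simpa using τ.im_pos
  have h2 : pFun (3 * τ) = (pFun (3 * τ - 1))⁻¹ := by
    rw [← pFun_add_one, sub_add_cancel]
  rw [coe_sheetSwap_smul, show (12 * (τ : ℂ) - 3) = 4 * (3 * τ - 1) + 1 by ring,
    pFun_div_four_mul_add_one h1, h2, neg_mul, mul_inv_cancel₀ (pFun_ne_zero h1)]

lemma sheetSwap_smul_smul (τ : ℍ) : sheetSwap • sheetSwap • τ = τ := by
  refine UpperHalfPlane.ext ?_
  have h : 12 * (τ : ℂ) - 3 ≠ 0 := by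
    intro h
    have := congr_arg Complex.im h
    simp at this
    exact τ.im_ne_zero this
  rw [coe_sheetSwap_smul, coe_sheetSwap_smul]
  have h' : 12 * ((3 * (τ : ℂ) - 1) / (12 * τ - 3)) - 3 = -3 / (12 * τ - 3) := by
    field_simp
    ring
  rw [h', div_eq_iff (div_ne_zero (by norm_num) h), mul_div_assoc', mul_div_assoc', eq_div_iff h, sub_mul,
    div_mul_cancel₀ _ h]
  ring

lemma im_three_mul_pos (τ : ℍ) : 0 < (3 * (τ : ℂ)).im := by simpa using τ.im_pos

/-- The involution interchanges p(τ) and p(3τ) up to negative reciprocals, so x² = p(τ)/p(3τ) is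
invariant. The sign of x is settled at the fixed point 1/4 + i√3/12. -/
lemma sheetSwap_mem_autGroup_xFun : sheetSwap ∈ autGroup xFun := by
  set s : ℍ := ⟨1 / 4 + √3 / 12 * I, by simp⟩
  have hs : sheetSwap • s = s := by
    refine UpperHalfPlane.ext ?_
    have h3 : ((√3 : ℝ) : ℂ) ^ 2 = 3 := by
      rw [← ofReal_pow, Real.sq_sqrt (by norm_num)]
      norm_num
    have h : 12 * (s : ℂ) - 3 ≠ 0 := by
      intro h
      have := congr_arg Complex.im h
      simp at this
      exact s.im_ne_zero this
    rw [coe_sheetSwap_smul, div_eq_iff h]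
    simp only [s]
    linear_combination (I ^ 2 / 12) * (-h3) - I_sq / 4
  refine mem_autGroup_of_pow_eq differentiableOn_xFun (fun _ h => xFun_ne_zero h) two_ne_zero
    (fun τ => ?_) (σ := s) (by rw [hs])
  have h1 := xFun_sq_mul_pFun_three (sheetSwap • τ).im_pos
  have h2 := xFun_sq_mul_pFun_three τ.im_pos
  have h3 := pFun_sheetSwap_smul τ
  have h4 := pFun_sheetSwap_smul (sheetSwap • τ)
  rw [sheetSwap_smul_smul] at h4
  have h5 := pFun_ne_zero (im_three_mul_pos τ)
  refine mul_right_cancel₀ h5 ?_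
  linear_combination -(pFun τ * pFun (3 * τ)) * h1 + xFun ↑(sheetSwap • τ) ^ 2 * pFun (3 * τ) * h4 -
    h2 - pFun τ * h3

/-- The involution replaces p by the other root of the quadratic relation: the product of the two
values is −x². -/
lemma yFun_sheetSwap_smul (τ : ℍ) : yFun ↑(sheetSwap • τ) = -yFun τ := by
  have hx := sheetSwap_mem_autGroup_xFun τ
  have h2 := xFun_sq_mul_pFun_three τ.im_pos
  have h3 := pFun_sheetSwap_smul τ
  have h4 := xFun_pFun τ.im_pos
  have hp := pFun_ne_zero τ.im_pos
  rw [yFun, yFun, hx]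
  have h6 : pFun ↑(sheetSwap • τ) * pFun τ = -xFun τ ^ 2 := by
    rw [← h2]
    linear_combination xFun τ ^ 2 * h3
  refine mul_right_cancel₀ hp ?_
  linear_combination -4 * xFun τ * h6 - 2 * h4

end Involution

/-! ### Uniformization of Schwarz's curve -/

section Schwarz

/-- The fibres of `(x, y)` are orbits. -/
lemma exists_smul_eq_of_xFun_yFun_eq {σ τ : ℍ} (hx : xFun σ = xFun τ) (hy : yFun σ = yFun τ) :
    ∃ g ∈ autGroup xFun ⊓ autGroup yFun, g • σ = τ := by
  have hp : pFun σ = pFun τ := by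
    rw [pFun_eq_of_yFun σ.im_pos, pFun_eq_of_yFun τ.im_pos, hx, hy]
  obtain ⟨g, hg, hgσ⟩ := exists_smul_eq_of_lambdaFun_eq (σ := σ) (τ := τ) (by
    rw [lambdaFun, lambdaFun, hp])
  have h1 := mem_autGroup_pFun hg (σ := σ) (by rw [hgσ, hp])
  have h2 := mem_autGroup_xFun h1 (σ := σ) (by rw [hgσ, hx])
  exact ⟨g, ⟨h2, mem_autGroup_yFun h1 h2⟩, hgσ⟩

lemma exists_xFun_yFun_eq {c d : ℂ} (hc : c ∉ punctures) (h : d ^ 2 = c ^ 8 + 14 * c ^ 4 + 1) :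
    ∃ τ : ℍ, xFun τ = c ∧ yFun τ = d := by
  obtain ⟨τ, hτ⟩ := exists_xFun_eq hc
  have hy := yFun_sq τ.im_pos
  rw [hτ, ← h, sq_eq_sq_iff_eq_or_eq_neg] at hy
  rcases hy with hy | hy
  · exact ⟨τ, hτ, hy⟩
  · refine ⟨sheetSwap • τ, ?_, ?_⟩
    · rw [apply_smul_of_mem sheetSwap_mem_autGroup_xFun, hτ]
    · rw [yFun_sheetSwap_smul, hy, neg_neg]

lemma xFun_notMem_punctures (τ : ℍ) : xFun τ ∉ punctures := by
  rw [mem_punctures_iff, not_or]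
  exact ⟨xFun_ne_zero τ.im_pos, xFun_pow_four_ne_one τ.im_pos⟩

lemma finite_punctures : punctures.Finite := by simp [punctures]

lemma discreteTopology_autGroup_xFun (v : ℂ → ℂ) :
    DiscreteTopology ↥(autGroup xFun ⊓ autGroup v) := by
  obtain ⟨τ, hτ⟩ := exists_yFun_ne_zero
  exact discreteTopology_autGroup_inf v differentiableOn_xFun τ
    ((deriv_xFun_ne_zero_iff_yFun τ.im_pos).2 hτ)

/-- To uniformize a curve with `x`, it suffices to have a holomorphic `v` such that the points of the
curve are values of `(x, v)` and the fibres of `(x, v)` are orbits. -/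
lemma uniformizes_of {v : ℂ → ℂ} {C : Set (ℂ × ℂ)} (hv : DifferentiableOn ℂ v halfPlane)
    (hC : ∀ τ : ℍ, (xFun τ, v τ) ∈ C)
    (hsurj : ∀ P ∈ C, P.1 ∉ punctures → ∃ τ : ℍ, xFun τ = P.1 ∧ v τ = P.2)
    (hinj : ∀ σ τ : ℍ, xFun σ = xFun τ → v σ = v τ →
      ∃ g ∈ autGroup xFun ⊓ autGroup v, g • σ = τ) :
    Uniformizes xFun v C punctures where
  finite_punctures := finite_punctures
  holomorphic_fst := differentiableOn_xFun
  holomorphic_snd := hv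
  image_eq := by
    ext P
    constructor
    · rintro ⟨τ, rfl⟩
      exact ⟨hC τ, xFun_notMem_punctures τ⟩
    · rintro ⟨h1, h2⟩
      obtain ⟨τ, h3, h4⟩ := hsurj P h1 h2
      exact ⟨τ, Prod.ext h3 h4⟩
  discrete := discreteTopology_autGroup_xFun v
  fiber_eq := fun σ τ => by
    constructor
    · rintro ⟨h1, h2⟩
      exact hinj σ τ h1 h2
    · rintro ⟨g, hg, rfl⟩
      exact ⟨(hg.1 σ).symm, (hg.2 σ).symm⟩

lemma uniformizes_schwarzCurve : Uniformizes xFun yFun schwarzCurve punctures :=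
  uniformizes_of differentiableOn_yFun (fun τ => yFun_sq τ.im_pos)
    (fun _ hP hP1 => exists_xFun_yFun_eq hP1 hP)
    (fun _ _ => exists_smul_eq_of_xFun_yFun_eq)

/-- The fibres of `x` are orbits of its automorphism group; the substitution can be chosen to
preserve `y` up to sign. -/
lemma exists_smul_eq_of_xFun_eq {σ τ : ℍ} (hx : xFun σ = xFun τ) :
    ∃ g ∈ autGroup xFun, g • σ = τ ∧
      ((∀ z : ℍ, yFun ↑(g • z) = yFun z) ∨ ∀ z : ℍ, yFun ↑(g • z) = -yFun z) := by
  have hy := yFun_sq σ.im_pos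
  rw [hx, ← yFun_sq τ.im_pos, sq_eq_sq_iff_eq_or_eq_neg] at hy
  rcases hy with hy | hy
  · obtain ⟨g, hg, hgσ⟩ := exists_smul_eq_of_xFun_yFun_eq hx hy
    exact ⟨g, hg.1, hgσ, Or.inl hg.2⟩
  · obtain ⟨g, hg, hgσ⟩ := exists_smul_eq_of_xFun_yFun_eq (σ := sheetSwap • σ) (τ := τ)
      (by rw [apply_smul_of_mem sheetSwap_mem_autGroup_xFun, hx])
      (by rw [yFun_sheetSwap_smul, hy, neg_neg])
    refine ⟨g * sheetSwap, mul_mem hg.1 sheetSwap_mem_autGroup_xFun, ?_, Or.inr fun z => ?_⟩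
    · rw [mul_smul, hgσ]
    · rw [mul_smul, apply_smul_of_mem hg.2, yFun_sheetSwap_smul]

end Schwarz

/-! ### Logarithms on the half-plane and their monodromy at i∞ -/

section Logarithm

/-- The Cayley map w ↦ i(1 + w)/(1 − w), with derivative 2i/(1 − w)², transfers the problem to the
unit disc. -/
lemma exists_primitive_halfPlane {f : ℂ → ℂ} (hf : DifferentiableOn ℂ f halfPlane) :
    ∃ F : ℂ → ℂ, ∀ τ : ℂ, 0 < τ.im → HasDerivAt F (f τ) τ := by
  have hne : ∀ w ∈ Metric.ball (0 : ℂ) 1, 1 - w ≠ 0 := by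
    intro w hw h
    rw [← sub_eq_zero.1 h] at hw
    simp at hw
  have hmem : ∀ w ∈ Metric.ball (0 : ℂ) 1, I * (1 + w) / (1 - w) ∈ halfPlane := by
    intro w hw
    have h1 := normSq_pos.2 (hne w hw)
    have h2 : normSq w < 1 := by
      rw [mem_ball_zero_iff] at hw
      rw [normSq_eq_norm_sq]
      nlinarith [norm_nonneg w]
    change 0 < (I * (1 + w) / (1 - w)).im
    rw [div_im, ← sub_div]
    refine div_pos ?_ h1
    simp [normSq_apply] at *
    nlinarith
  have hdiff : DifferentiableOn ℂ (fun w => f (I * (1 + w) / (1 - w)) * (2 * I / (1 - w) ^ 2))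
      (Metric.ball 0 1) := by
    refine DifferentiableOn.mul (hf.comp (DifferentiableOn.div (by fun_prop) (by fun_prop) hne) hmem)
      (DifferentiableOn.div (by fun_prop) (by fun_prop) fun w hw => pow_ne_zero 2 (hne w hw))
  obtain ⟨G, hG⟩ := hdiff.isExactOn_ball
  refine ⟨fun τ => G ((τ - I) / (τ + I)), fun τ hτ => ?_⟩
  have hI : τ + I ≠ 0 := by
    intro h
    have := congr_arg Complex.im h
    simp at this
    linarith
  have hball : (τ - I) / (τ + I) ∈ Metric.ball (0 : ℂ) 1 := by
    rw [mem_ball_zero_iff, norm_div, div_lt_one (norm_pos_iff.2 hI), Complex.norm_def,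
      Complex.norm_def]
    refine Real.sqrt_lt_sqrt (normSq_nonneg _) ?_
    simp [normSq_apply]
    nlinarith
  have h1 : HasDerivAt (fun τ : ℂ => (τ - I) / (τ + I)) (2 * I / (τ + I) ^ 2) τ := by
    refine (((hasDerivAt_id τ).sub_const I).div ((hasDerivAt_id τ).add_const I) hI).congr_deriv ?_
    simp only [id]
    ring
  refine ((hG _ hball).comp τ h1).congr_deriv ?_
  have e1 : 1 - (τ - I) / (τ + I) = 2 * I / (τ + I) := by
    field_simp
    ring
  have e2 : I * (1 + (τ - I) / (τ + I)) / (1 - (τ - I) / (τ + I)) = τ := by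
    have hI0 := I_ne_zero
    rw [e1]
    field_simp
    ring
  have hI0 := I_ne_zero
  beta_reduce
  rw [e2, e1]
  field_simp

lemma exists_log_halfPlane {f : ℂ → ℂ} (hf : DifferentiableOn ℂ f halfPlane)
    (h0 : ∀ τ : ℂ, 0 < τ.im → f τ ≠ 0) : ∃ F : ℂ → ℂ, DifferentiableOn ℂ F halfPlane ∧
      ∀ τ : ℂ, 0 < τ.im → cexp (F τ) = f τ := by
  obtain ⟨F, hF⟩ := exists_primitive_halfPlane (f := fun τ => deriv f τ / f τ)
    ((hf.deriv isOpen_halfPlane).div hf fun τ hτ => h0 τ hτ)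
  have hI : I ∈ halfPlane := by simp [halfPlane]
  have hd : ∀ τ : ℂ, 0 < τ.im → HasDerivAt (fun τ => cexp (-F τ) * f τ) 0 τ := by
    intro τ hτ
    refine ((hF τ hτ).neg.cexp.mul (hf.differentiableAt (halfPlane_mem_nhds hτ)).hasDerivAt).congr_deriv
      ?_
    have := h0 τ hτ
    field_simp
    ring
  have hconst : ∀ τ : ℂ, 0 < τ.im → cexp (-F τ) * f τ = cexp (-F I) * f I := by
    intro τ hτ
    exact isOpen_halfPlane.is_const_of_deriv_eq_zero isPreconnected_halfPlane
      (fun σ hσ => (hd σ hσ).differentiableAt.differentiableWithinAt)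
      (fun σ hσ => (hd σ hσ).deriv) hτ hI
  have hc : cexp (-F I) * f I ≠ 0 := mul_ne_zero (Complex.exp_ne_zero _) (h0 I hI)
  refine ⟨fun τ => F τ + Complex.log (cexp (-F I) * f I),
    fun τ hτ => ((hF τ hτ).differentiableAt.add_const _).differentiableWithinAt, fun τ hτ => ?_⟩
  rw [Complex.exp_add, Complex.exp_log hc, ← hconst τ hτ, ← mul_assoc, ← Complex.exp_add,
    add_neg_cancel, Complex.exp_zero, one_mul]

/-- If the derivative of `m` tends to zero at `i∞`, so does its increment over a period. -/
lemma tendsto_add_two_sub {m : ℂ → ℂ} (hm : ∀ τ : ℂ, 0 < τ.im → DifferentiableAt ℂ m τ)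
    (h : Tendsto (deriv m) atInfty (𝓝 0)) :
    Tendsto (fun τ => m (τ + 2) - m τ) atInfty (𝓝 0) := by
  rw [Metric.tendsto_nhds]
  intro ε hε
  obtain ⟨M, hM⟩ := eventually_atInfty.1
    ((Metric.tendsto_nhds.1 h (ε / 3) (by positivity)).and (eventually_im_atInfty 0))
  refine eventually_atInfty.2 ⟨M, fun τ hτ => ?_⟩
  have hb := (convex_halfSpace_im_gt M).norm_image_sub_le_of_norm_deriv_le (𝕜 := ℂ) (f := m)
    (C := ε / 3) (fun σ hσ => hm σ (hM σ hσ).2)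
    (fun σ hσ => by simpa using (hM σ hσ).1.le) (x := τ) (y := τ + 2) hτ
    (show M < (τ + 2).im by simpa using hτ)
  rw [dist_zero_right]
  refine hb.trans_lt ?_
  rw [add_sub_cancel_left]
  norm_num
  linarith

/-- A root of a function that vanishes to the first order in the nome is multiplied by a primitive
root of unity when `τ` is replaced by `τ + 2`. -/
lemma exp_log_div_add_two {f F : ℂ → ℂ} (hf : DifferentiableOn ℂ f halfPlane)
    (hF : DifferentiableOn ℂ F halfPlane) (hFf : ∀ τ : ℂ, 0 < τ.im → cexp (F τ) = f τ)
    (hper : ∀ τ : ℂ, 0 < τ.im → f (τ + 2) = f τ) {c : ℂ} (hc : c ≠ 0)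
    (h : Tendsto (fun τ => f τ / nome τ) atInfty (𝓝 c)) {n : ℕ} (hn : n ≠ 0) {τ : ℂ}
    (hτ : 0 < τ.im) : cexp (F (τ + 2) / n) = cexp (2 * Real.pi * I / n) * cexp (F τ / n) := by
  -- F − πiτ is a logarithm of f divided by the nome, which has a nonzero limit. Its derivative,
  -- hence its increment over the period 2, tends to 0, so F itself increases by 2πi in the limit.
  have hmd : ∀ τ : ℂ, 0 < τ.im → DifferentiableAt ℂ (fun τ => F τ - Real.pi * I * τ) τ :=
    fun τ hτ => (hF.differentiableAt (halfPlane_mem_nhds hτ)).sub (by fun_prop)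
  have hu : ∀ τ : ℂ, 0 < τ.im → DifferentiableAt ℂ (fun τ => f τ / nome τ) τ := fun τ hτ =>
    (hf.differentiableAt (halfPlane_mem_nhds hτ)).div (differentiable_nome τ) (nome_ne_zero τ)
  have hexp : ∀ τ : ℂ, 0 < τ.im → cexp (F τ - Real.pi * I * τ) = f τ / nome τ := fun τ hτ => by
    rw [Complex.exp_sub, hFf τ hτ, nome]
  have hderiv : Tendsto (deriv fun τ => F τ - Real.pi * I * τ) atInfty (𝓝 0) := by
    have h1 := (tendsto_deriv_atInfty hu h).div h hc
    rw [zero_div] at h1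
    refine h1.congr' ?_
    filter_upwards [eventually_im_atInfty 0, h.eventually_ne hc] with τ hτ hne
    have h2 := ((hmd τ hτ).hasDerivAt.cexp).congr_of_eventuallyEq (f₁ := fun τ => f τ / nome τ) (by
      filter_upwards [halfPlane_mem_nhds hτ] with σ hσ using (hexp σ hσ).symm)
    simp only [Pi.div_apply]
    rw [h2.deriv, hexp τ hτ, mul_div_assoc, mul_comm, div_mul_cancel₀ _ hne]
  have hsub := tendsto_add_two_sub hmd hderiv
  have hshift : DifferentiableOn ℂ (fun τ => cexp (F (τ + 2) / n)) halfPlane := by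
    intro τ (hτ : 0 < τ.im)
    have : 0 < (τ + 2).im := by simpa using hτ
    have h1 : DifferentiableAt ℂ (fun τ => F (τ + 2)) τ :=
      (hF.differentiableAt (halfPlane_mem_nhds this)).comp τ
        (differentiableAt_id.add_const (2 : ℂ))
    exact (h1.div_const _).cexp.differentiableWithinAt
  have hn' : (n : ℂ) ≠ 0 := by exact_mod_cast hn
  have hpow : ∀ z : ℂ, cexp (z / n) ^ n = cexp z := fun z => by
    rw [← Complex.exp_nat_mul, mul_div_cancel₀ _ hn']
  obtain ⟨ζ, -, hζ⟩ := exists_eq_const_mul hshift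
    (fun τ hτ => ((hF.differentiableAt (halfPlane_mem_nhds hτ)).div_const (n : ℂ)).cexp.differentiableWithinAt)
    (fun τ _ => Complex.exp_ne_zero _) hn (fun τ hτ => by
      have : 0 < (τ + 2).im := by simpa using hτ
      rw [hpow, hpow, hFf _ this, hFf _ hτ, hper τ hτ])
  rw [hζ τ hτ]
  congr 1
  have h1 : Tendsto (fun τ => cexp ((F (τ + 2) - Real.pi * I * (τ + 2) - (F τ - Real.pi * I * τ)) / n))
      atInfty (𝓝 1) := by
    have := (hsub.div_const (n : ℂ)).cexp
    rwa [zero_div, Complex.exp_zero] at this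
  have h2 : Tendsto (fun _ : ℂ => ζ / cexp (2 * Real.pi * I / n)) atInfty (𝓝 1) := by
    refine h1.congr' ?_
    filter_upwards [eventually_im_atInfty 0] with σ hσ
    rw [show (F (σ + 2) - Real.pi * I * (σ + 2) - (F σ - Real.pi * I * σ)) / (n : ℂ) =
      F (σ + 2) / n - (F σ / n + 2 * Real.pi * I / n) by ring, Complex.exp_sub, Complex.exp_add, hζ σ hσ,
      mul_comm ζ, mul_div_mul_left _ _ (Complex.exp_ne_zero _)]
  have h3 := tendsto_nhds_unique tendsto_const_nhds h2
  rwa [div_eq_one_iff_eq (Complex.exp_ne_zero _)] at h3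

end Logarithm

/-! ### Burnside's tower and the product curve -/

section Curves

lemma xFun_add_one {τ : ℂ} (hτ : 0 < τ.im) : xFun (τ + 1) = (xFun τ)⁻¹ := by
  rw [xFun_eq hτ, xFun_eq (by simpa using hτ), sixth₄_add_one, sixth₃_add_one, inv_div]

lemma xFun_add_two {τ : ℂ} (hτ : 0 < τ.im) : xFun (τ + 2) = xFun τ := by
  have h : 0 < (τ + 1).im := by simpa using hτ
  rw [show τ + 2 = τ + 1 + 1 by ring, xFun_add_one h, xFun_add_one hτ, inv_inv]

lemma yFun_add_two {τ : ℂ} (hτ : 0 < τ.im) : yFun (τ + 2) = yFun τ := by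
  rw [yFun, xFun_add_two hτ, show τ + 2 = τ + 1 + 1 by ring, pFun_add_one, pFun_add_one, inv_inv,
    yFun]

/-- The value of the vertex form at `x(τ)`. -/
def vertexFun (τ : ℂ) : ℂ := xFun τ ^ 5 - xFun τ

lemma differentiableOn_vertexFun : DifferentiableOn ℂ vertexFun halfPlane :=
  (differentiableOn_xFun.pow 5).sub differentiableOn_xFun

lemma vertexFun_ne_zero {τ : ℂ} (hτ : 0 < τ.im) : vertexFun τ ≠ 0 := by
  rw [vertexFun, show xFun τ ^ 5 - xFun τ = xFun τ * (xFun τ ^ 4 - 1) by ring]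
  exact mul_ne_zero (xFun_ne_zero hτ) (sub_ne_zero.2 (xFun_pow_four_ne_one hτ))

/-- The relation between x and p rearranges to x⁵ − x = 2x²(x² + 1)(p² − 1)/((x² + 1)p + 2x), which
transfers the first-order zero of p − 1 at the cusp. -/
lemma tendsto_vertexFun : Tendsto (fun τ => vertexFun τ / nome τ) atInfty (𝓝 (-8)) := by
  have hden : Tendsto (fun τ => (xFun τ ^ 2 + 1) * pFun τ + 2 * xFun τ) atInfty (𝓝 4) := by
    have := (((tendsto_xFun.pow 2).add_const 1).mul tendsto_pFun).add (tendsto_xFun.const_mul 2)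
    norm_num at this
    exact this
  have h := (((tendsto_xFun.pow 2).const_mul 2).mul ((tendsto_xFun.pow 2).add_const 1)).mul
    ((tendsto_pFun_sub_one.mul (tendsto_pFun.add_const 1)).div hden (by norm_num))
  norm_num at h
  refine h.congr' ?_
  filter_upwards [eventually_im_atInfty 0, hden.eventually_ne (by norm_num : (4 : ℂ) ≠ 0)]
    with τ hτ hne
  have h1 := xFun_pFun hτ
  have h2 := nome_ne_zero τ
  rw [vertexFun]
  field_simp
  linear_combination xFun τ * (xFun τ ^ 2 + 1) * h1

lemma exists_root_vertexFun {n : ℕ} (hn : n ≠ 0) : ∃ z : ℂ → ℂ, DifferentiableOn ℂ z halfPlane ∧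
    (∀ τ : ℂ, 0 < τ.im → z τ ^ n = vertexFun τ) ∧
    ∀ τ : ℂ, 0 < τ.im → z (τ + 2) = cexp (2 * Real.pi * I / n) * z τ := by
  obtain ⟨F, hF, hFf⟩ := exists_log_halfPlane differentiableOn_vertexFun fun τ => vertexFun_ne_zero
  have hn' : (n : ℂ) ≠ 0 := by exact_mod_cast hn
  refine ⟨fun τ => cexp (F τ / n), fun τ hτ => ((hF.differentiableAt
    (halfPlane_mem_nhds hτ)).div_const (n : ℂ)).cexp.differentiableWithinAt, fun τ hτ => ?_,
    fun τ hτ => ?_⟩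
  · rw [← Complex.exp_nat_mul, mul_div_cancel₀ _ hn', hFf τ hτ]
  · exact exp_log_div_add_two differentiableOn_vertexFun hF hFf (fun τ hτ => by
      rw [vertexFun, xFun_add_two hτ, vertexFun]) (by norm_num) tendsto_vertexFun hn hτ

lemma root_ne_zero {z : ℂ → ℂ} {n : ℕ} (hn : n ≠ 0)
    (hz : ∀ τ : ℂ, 0 < τ.im → z τ ^ n = vertexFun τ) (τ : ℂ) (hτ : 0 < τ.im) : z τ ≠ 0 := by
  intro h
  have := hz τ hτ
  rw [h, zero_pow hn] at this
  exact vertexFun_ne_zero hτ this.symm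

lemma root_smul_pow_eq {z : ℂ → ℂ} {n : ℕ} (hz : ∀ τ : ℂ, 0 < τ.im → z τ ^ n = vertexFun τ)
    {g : SL(2, ℝ)} (hg : g ∈ autGroup xFun) (τ : ℍ) : z ↑(g • τ) ^ n = z τ ^ n := by
  rw [hz _ (g • τ).im_pos, hz _ τ.im_pos, vertexFun, vertexFun, apply_smul_of_mem hg]

/-- The translations by 2k fix x and run through all n-th roots over a given x. For the fibres, an
automorphism of x multiplies z by a constant, which is 1 if z agrees at one point. -/
lemma exists_uniformizes_burnsideCurve {n : ℕ} (hn : n ≠ 0) :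
    ∃ z : ℂ → ℂ, Uniformizes xFun z (burnsideCurve n) punctures := by
  obtain ⟨z, hzd, hz, hz2⟩ := exists_root_vertexFun hn
  refine ⟨z, uniformizes_of hzd (fun τ => hz τ τ.im_pos) ?_ ?_⟩
  · rintro ⟨c, d⟩ hP hc
    have hP' : d ^ n = c ^ 5 - c := hP
    obtain ⟨τ, hτ⟩ := exists_xFun_eq hc
    have hz0 := root_ne_zero hn hz τ τ.im_pos
    have h1 : (d / z τ) ^ n = 1 := by
      rw [div_pow, hz τ τ.im_pos, hP', ← show xFun τ = c from hτ]
      exact div_self (vertexFun_ne_zero τ.im_pos)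
    have : NeZero n := ⟨hn⟩
    obtain ⟨k, -, hk⟩ := (Complex.isPrimitiveRoot_exp n hn).eq_pow_of_pow_eq_one h1
    have hshift : ∀ k : ℕ, xFun (τ + 2 * k) = c ∧
        z (τ + 2 * k) = cexp (2 * Real.pi * I / n) ^ k * z τ := by
      intro k
      induction k with
      | zero => simp [hτ]
      | succ k ih =>
        have hk : 0 < ((τ : ℂ) + 2 * k).im := by simpa using τ.im_pos
        have e : (τ : ℂ) + 2 * (k + 1 : ℕ) = τ + 2 * k + 2 := by
          push_cast
          ring
        rw [e, xFun_add_two hk, hz2 _ hk, ih.1, ih.2]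
        exact ⟨rfl, by ring⟩
    refine ⟨⟨τ + 2 * k, by simpa using τ.im_pos⟩, (hshift k).1, (hshift k).2.trans ?_⟩
    rw [hk, div_mul_cancel₀ _ hz0]
  · intro σ τ hx hzστ
    obtain ⟨g, hg, hgσ, -⟩ := exists_smul_eq_of_xFun_eq hx
    exact ⟨g, ⟨hg, mem_autGroup_of_pow_eq hzd (root_ne_zero hn hz) hn (root_smul_pow_eq hz hg)
      (σ := σ) (by rw [hgσ, hzστ])⟩, hgσ⟩

/-- At a zero of `y`, the involution of the Schwarz curve is realized by a substitution with a fixed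
point. -/
lemma exists_smul_eq_self {τ : ℍ} (hy : yFun τ = 0) :
    ∃ e ∈ autGroup xFun, e • τ = τ ∧ ∀ z : ℍ, yFun ↑(e • z) = -yFun z := by
  obtain ⟨g, hg, hgτ⟩ := exists_smul_eq_of_xFun_yFun_eq (σ := sheetSwap • τ) (τ := τ)
    (by rw [apply_smul_of_mem sheetSwap_mem_autGroup_xFun])
    (by rw [yFun_sheetSwap_smul, hy, neg_zero])
  refine ⟨g * sheetSwap, mul_mem hg.1 sheetSwap_mem_autGroup_xFun, ?_, fun z => ?_⟩
  · rw [mul_smul, hgτ]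
  · rw [mul_smul, apply_smul_of_mem hg.2, yFun_sheetSwap_smul]

/-- Here w = yz, and τ ↦ τ + 2 changes its sign. An automorphism g of x with gσ = τ satisfies w ∘ g
= ±w. The minus sign forces y(σ) = 0; then the elliptic e fixing σ flips y but not z, because z(σ) ≠
0, and ge replaces g. -/
lemma exists_uniformizes_productCurve :
    ∃ w : ℂ → ℂ, Uniformizes xFun w productCurve punctures := by
  obtain ⟨z, hzd, hz, hz2⟩ := exists_root_vertexFun two_ne_zero
  have hz2' : ∀ τ : ℂ, 0 < τ.im → z (τ + 2) = -z τ := fun τ hτ => by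
    rw [hz2 τ hτ, Nat.cast_ofNat, show 2 * (Real.pi : ℂ) * I / 2 = Real.pi * I by ring,
      Complex.exp_pi_mul_I, neg_one_mul]
  have hz0 := root_ne_zero two_ne_zero hz
  have hzg : ∀ g ∈ autGroup xFun, (∀ τ : ℍ, z ↑(g • τ) = z τ) ∨ ∀ τ : ℍ, z ↑(g • τ) = -z τ := by
    intro g hg
    obtain ⟨ζ, hζ, h⟩ := exists_smul_eq_const_mul hzd hz0 two_ne_zero (root_smul_pow_eq hz hg)
    rcases (sq_eq_sq_iff_eq_or_eq_neg (a := ζ) (b := 1)).1 (by rw [hζ, one_pow]) with rfl | rfl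
    · exact Or.inl fun τ => by rw [h, one_mul]
    · exact Or.inr fun τ => by rw [h, neg_one_mul]
  have hsq : ∀ τ : ℍ, (yFun τ * z τ) ^ 2 =
      (xFun τ ^ 8 + 14 * xFun τ ^ 4 + 1) * (xFun τ ^ 5 - xFun τ) := fun τ => by
    rw [mul_pow, yFun_sq τ.im_pos, hz τ τ.im_pos, vertexFun]
  refine ⟨fun τ => yFun τ * z τ, uniformizes_of (differentiableOn_yFun.mul hzd) hsq ?_ ?_⟩
  · rintro ⟨c, d⟩ hP hc
    have hP' : d ^ 2 = (c ^ 8 + 14 * c ^ 4 + 1) * (c ^ 5 - c) := hP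
    obtain ⟨τ, hτ⟩ := exists_xFun_eq hc
    have h := hsq τ
    rw [hτ, ← hP', sq_eq_sq_iff_eq_or_eq_neg] at h
    rcases h with h | h
    · exact ⟨τ, hτ, h⟩
    · refine ⟨⟨τ + 2, by simpa using τ.im_pos⟩, ?_, ?_⟩
      · exact (xFun_add_two τ.im_pos).trans hτ
      · change yFun (τ + 2) * z (τ + 2) = d
        rw [yFun_add_two τ.im_pos, hz2' τ τ.im_pos, mul_neg, h, neg_neg]
  · intro σ τ hx hw
    have hw' : yFun σ * z σ = yFun τ * z τ := hw
    obtain ⟨g, hg, hgσ, hgy⟩ := exists_smul_eq_of_xFun_eq hx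
    have hgw : (∀ u : ℍ, yFun ↑(g • u) * z ↑(g • u) = yFun u * z u) ∨
        ∀ u : ℍ, yFun ↑(g • u) * z ↑(g • u) = -(yFun u * z u) := by
      rcases hgy with hy | hy <;> rcases hzg g hg with hz | hz
      · exact Or.inl fun u => by rw [hy, hz]
      · exact Or.inr fun u => by rw [hy, hz, mul_neg]
      · exact Or.inr fun u => by rw [hy, hz, neg_mul]
      · exact Or.inl fun u => by rw [hy, hz, neg_mul_neg]
    rcases hgw with h | h
    · exact ⟨g, ⟨hg, h⟩, hgσ⟩
    · have hy0 : yFun σ = 0 := by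
        have h1 := h σ
        rw [hgσ, ← hw'] at h1
        have h2 : yFun σ * z σ = 0 := self_eq_neg.1 h1
        exact (mul_eq_zero.1 h2).resolve_right (hz0 σ σ.im_pos)
      obtain ⟨e, he, heσ, hey⟩ := exists_smul_eq_self hy0
      have hez : ∀ u : ℍ, z ↑(e • u) = z u := by
        rcases hzg e he with h1 | h1
        · exact h1
        · exfalso
          have h2 := h1 σ
          rw [heσ] at h2
          exact hz0 σ σ.im_pos (self_eq_neg.1 h2)
      refine ⟨g * e, ⟨mul_mem hg he, fun u => ?_⟩, ?_⟩
      · rw [mul_smul]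
        change yFun ↑(g • e • u) * z ↑(g • e • u) = yFun u * z u
        rw [h, hey, hez]
        ring
      · rw [mul_smul, heσ, hgσ]

end Curves

end OctahedralUniformization

end

theorem proposition3 :
    -- the function is the theta-eta quotient, and it has neither zeros nor poles on `ℍ`
    (∀ τ : ℍ,
      OctahedralUniformization.theta₃ 0 τ ≠ 0 ∧
      OctahedralUniformization.theta₁ (1 / 6) τ ≠ 0 ∧
      OctahedralUniformization.theta₃ (1 / 6) τ ≠ 0 ∧
      OctahedralUniformization.pFun τ ^ 2 + OctahedralUniformization.qFun τ ≠ 0 ∧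
      OctahedralUniformization.xFun τ ≠ 0 ∧
      OctahedralUniformization.xFun τ =
        ModularForm.eta τ ^ 3 * OctahedralUniformization.theta₂ (1 / 3) τ /
          (OctahedralUniformization.theta₁ (1 / 6) τ ^ 2 *
            OctahedralUniformization.theta₃ (1 / 6) τ ^ 2)) ∧
    -- Schwarz's curve
    (∃ y : ℂ → ℂ,
      OctahedralUniformization.Uniformizes OctahedralUniformization.xFun y
        OctahedralUniformization.schwarzCurve OctahedralUniformization.punctures ∧
      ∀ τ : ℍ,
        OctahedralUniformization.pFun τ =
          (OctahedralUniformization.xFun τ ^ 4 - y τ - 1) /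
            (4 * OctahedralUniformization.xFun τ) ∧
        OctahedralUniformization.qFun τ =
          (OctahedralUniformization.xFun τ ^ 4 - y τ + 1) /
            (2 * OctahedralUniformization.xFun τ ^ 2)) ∧
    -- Burnside's tower
    (∀ n : ℕ, 1 ≤ n → ∃ z : ℂ → ℂ,
      OctahedralUniformization.Uniformizes OctahedralUniformization.xFun z
        (OctahedralUniformization.burnsideCurve n) OctahedralUniformization.punctures) ∧
    -- the product curve
    (∃ w : ℂ → ℂ,
      OctahedralUniformization.Uniformizes OctahedralUniformization.xFun w
        OctahedralUniformization.productCurve OctahedralUniformization.punctures) ∧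
    -- the Fuchsian equation
    (∀ τ : ℍ,
      deriv OctahedralUniformization.xFun τ ≠ 0 ↔
        OctahedralUniformization.xFun τ ^ 8 + 14 * OctahedralUniformization.xFun τ ^ 4 + 1 ≠ 0) ∧
    (∀ τ : ℍ,
      OctahedralUniformization.xFun τ ^ 8 + 14 * OctahedralUniformization.xFun τ ^ 4 + 1 ≠ 0 →
        OctahedralUniformization.meroDeriv OctahedralUniformization.xFun τ =
            OctahedralUniformization.fuchsQ (OctahedralUniformization.xFun τ) ∧
        OctahedralUniformization.fuchsQ (OctahedralUniformization.xFun τ) =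
            OctahedralUniformization.fuchsQPartial (OctahedralUniformization.xFun τ)) := by
  refine ⟨fun τ => ⟨OctahedralUniformization.null₃_ne_zero τ.im_pos,
      OctahedralUniformization.sixth₁_ne_zero τ.im_pos,
      OctahedralUniformization.sixth₃_ne_zero τ.im_pos,
      OctahedralUniformization.pFun_sq_add_qFun_ne_zero τ.im_pos,
      OctahedralUniformization.xFun_ne_zero τ.im_pos,
      OctahedralUniformization.xFun_eq_eta τ.im_pos⟩,
    ⟨OctahedralUniformization.yFun, OctahedralUniformization.uniformizes_schwarzCurve, fun τ =>
      ⟨OctahedralUniformization.pFun_eq_of_yFun τ.im_pos,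
        OctahedralUniformization.qFun_eq_of_yFun τ.im_pos⟩⟩,
    fun n hn => OctahedralUniformization.exists_uniformizes_burnsideCurve
      (Nat.one_le_iff_ne_zero.1 hn),
    OctahedralUniformization.exists_uniformizes_productCurve,
    fun τ => OctahedralUniformization.deriv_xFun_ne_zero_iff τ.im_pos,
    fun τ h => ⟨OctahedralUniformization.meroDeriv_xFun τ.im_pos
      ((OctahedralUniformization.yFun_ne_zero_iff τ.im_pos).2 h),
      OctahedralUniformization.fuchsQ_eq_partial h ?_⟩⟩
  exact OctahedralUniformization.vertexFun_ne_zero τ.im_pos
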